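/- Let $M$ be a compact, connected, Hausdorff, second countable smooth manifold (without boundary) of dimension $n$, and let $f : M\times\mathbb{R}^m \to TM$ be a smooth map with $f(x,u)\in T_xM$ for all $(x,u)$. Let $\mathcal{C}\subset\mathbb{R}^m$ be a non-empty compact set in which any two points can be joined by a polygonal path, that is, by finitely many consecutive line segments contained in $\mathcal{C}$ (for example, a non-empty compact convex set). All controls are piecewise constant functions on an interval $[0,T]$, $T\ge 0$: there is a partition $0=T_0<T_1<\dots<T_k=T$ such that the control is constant on each $[T_{i-1},T_i)$. A trajectory associated with a control is an absolutely continuous curve on $[0,T]$ that satisfies the differential equation for almost every $t\in[0,T]$. A system is globally controllable on a set of states if every point of the set can be steered to every point of the set by a trajectory that stays in the set. Then the following are equivalent: 1. The system $\dot x=f(x,u)$ is globally controllable on $M$ with controls $u$ valued in $\mathcal{C}$. 2. There is a bounded set $\mathcal{B}\subset\mathbb{R}^m$ such that the extended system $\dot x=f(x,y)$, $\dot y=v$ is globally controllable on $M\times\mathcal{C}$ (with $(x(t),y(t))\in M\times\mathcal{C}$ for all $t$) with controls $v$ valued in $\mathcal{B}$. -/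

import Mathlib

open Set MeasureTheory
open scoped Manifold ContDiff

noncomputable section

namespace ControlSystem

/-- `u` is piecewise constant on `[0, T]`: there is a partition `0 = s₀ < s₁ < ⋯ < s_k = T` such
that `u` is constant on each interval `[s_i, s_{i+1})`. Only the values on `[0, T]` matter. -/
def IsPiecewiseConstant {V : Type*} (T : ℝ) (u : ℝ → V) : Prop :=
  ∃ (k : ℕ) (s : Fin (k + 1) → ℝ), StrictMono s ∧ s 0 = 0 ∧ s (Fin.last k) = T ∧
    ∀ i : Fin k, ∀ t ∈ Ico (s i.castSucc) (s i.succ), u t = u (s i.castSucc)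

/-- A curve `γ : [0, T] → N` in a manifold is absolutely continuous: it is continuous, and on each
compact subinterval which it maps into the domain of one of the charts of the atlas attached to
the points of `N`, its coordinate expression is absolutely continuous. -/
def IsAbsolutelyContinuousCurve {E H N : Type*} [NormedAddCommGroup E] [NormedSpace ℝ E]
    [TopologicalSpace H] (I : ModelWithCorners ℝ E H) [TopologicalSpace N] [ChartedSpace H N]
    (T : ℝ) (γ : ℝ → N) : Prop :=
  ContinuousOn γ (Icc 0 T) ∧
    ∀ (z : N) (a b : ℝ), 0 ≤ a → a ≤ b → b ≤ T → MapsTo γ (Icc a b) (chartAt H z).source →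
      AbsolutelyContinuousOnInterval (extChartAt I z ∘ γ) a b

/-- `γ : [0, T] → N` is the trajectory of `ẋ = F(x, u)` associated with the control `u`: an
absolutely continuous curve with `γ'(t) = F(γ(t), u(t))` for almost every `t ∈ [0, T]`. -/
def IsTrajectory {E H N V : Type*} [NormedAddCommGroup E] [NormedSpace ℝ E]
    [TopologicalSpace H] (I : ModelWithCorners ℝ E H) [TopologicalSpace N] [ChartedSpace H N]
    (F : (x : N) → V → TangentSpace I x) (T : ℝ) (u : ℝ → V) (γ : ℝ → N) : Prop :=
  IsAbsolutelyContinuousCurve I T γ ∧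
    ∀ᵐ t ∂(volume.restrict (Icc 0 T)),
      HasMFDerivAt 𝓘(ℝ, ℝ) I γ t ((1 : ℝ →L[ℝ] ℝ).smulRight (F (γ t) (u t)))

/-- `q` is reachable by `p` for the system `ẋ = F(x, u)` with state set `S` and control set `U`:
some piecewise constant control on some `[0, T]` with values in `U` has an associated trajectory
which stays in `S` and goes from `p` to `q`. -/
def Reachable {E H N V : Type*} [NormedAddCommGroup E] [NormedSpace ℝ E]
    [TopologicalSpace H] (I : ModelWithCorners ℝ E H) [TopologicalSpace N] [ChartedSpace H N]
    (F : (x : N) → V → TangentSpace I x) (S : Set N) (U : Set V) (p q : N) : Prop :=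
  ∃ (T : ℝ) (u : ℝ → V) (γ : ℝ → N), 0 ≤ T ∧
    IsPiecewiseConstant T u ∧ (∀ t ∈ Icc 0 T, u t ∈ U) ∧
    IsTrajectory I F T u γ ∧ (∀ t ∈ Icc 0 T, γ t ∈ S) ∧ γ 0 = p ∧ γ T = q

/-- Global controllability on the state set `S` with controls valued in `U`: each point of `S` is
reachable by each point of `S`. -/
def GloballyControllable {E H N V : Type*} [NormedAddCommGroup E] [NormedSpace ℝ E]
    [TopologicalSpace H] (I : ModelWithCorners ℝ E H) [TopologicalSpace N] [ChartedSpace H N]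
    (F : (x : N) → V → TangentSpace I x) (S : Set N) (U : Set V) : Prop :=
  ∀ p ∈ S, ∀ q ∈ S, Reachable I F S U p q

/-- The right-hand side of the extended system `ẋ = f(x, y)`, `ẏ = v` with state `(x, y)` and
control `v`. -/
def extendedField {E H M V : Type*} [NormedAddCommGroup E] [NormedSpace ℝ E]
    [TopologicalSpace H] (I : ModelWithCorners ℝ E H) [TopologicalSpace M] [ChartedSpace H M]
    [NormedAddCommGroup V] [NormedSpace ℝ V]
    (f : (x : M) → V → TangentSpace I x) (p : M × V) (v : V) :
    TangentSpace (I.prod 𝓘(ℝ, V)) p :=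
  ((f p.1 p.2, v) : E × V)

/-- Any two points of `C` are joined by a polygonal path (finitely many segments) inside `C`. -/
def IsPolygonallyConnected {V : Type*} [AddCommGroup V] [Module ℝ V] (C : Set V) : Prop :=
  ∀ y ∈ C, ∀ z ∈ C, Relation.ReflTransGen (fun a b => segment ℝ a b ⊆ C) y z

end ControlSystem

end

/-! Embed `M` as a compact submanifold `K` of a Euclidean space and extend `f` (over `C`) to a
smooth compactly supported `F` tangent to `K`. Flows are then global, smooth, and leave `K`
invariant. Both conditions imply one weaker property: any two points of `K` are joined by a chain of
trajectories of `x' = F(x, y)` with continuous controls `y` in `C`. For the original system the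
controls are constant on each piece; for the extended system the state component `y` is itself such
a control. It remains to recover both conditions from this property.

Fix `c` in `C`. A letter `(u, t)` means: slide `y` from `c` to `u` along a polygon in `C`, follow `F
· u` for time `t`, slide back to `c`; every segment is run through in time `sin ε`. For small `ε >
0` a word is a trajectory of the extended system with speed of `y` at most `diam C / sin ε`. As `ε →
0` the slides tend to the identity, and at `ε = 0` a word is a piecewise constant control of the
original system. So the theorem follows once words steer any point of `K` to any other at `ε = 0`
(`steers_zero_of_chain`), and still do so at some small `ε > 0`, which fixes `B`
(`eventually_forall_steers`).

Replacing continuous controls by piecewise constant ones only steers approximately. Exactness comes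
from a rank argument. Take an immersed disc of points reached by words, of dimension `r`. If some
field, transported by some word, is transverse to the disc, flowing along it gives a disc of
dimension `r + 1` (`hasDisc_succ`). Otherwise all pullbacks of the fields by words are tangent to
the disc. Pull a trajectory starting on the disc back by a word which approximates it: the resulting
curve moves little and is tangent to the disc, so it stays exactly on it (`pullback_eq_graph`).
Hence every point of `K` lies in the image of a compact piece of the disc under a word, with letters
from a countable dense set. By Baire one of these images has interior in `K`, so `r ≥ dim M`
(`hasDisc_succ_of_lt`). A disc of full dimension fills an open subset of `K`, robustly in the
initial point and in `ε` (`eventually_steers_of_isDiscAt`). Approximate steering into it and out of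
it gives exact steering, and compactness of `K × K` makes the range of `ε` uniform. -/

namespace ControlSystem
open Filter Topology

/-! ### Differentiable dependence of local flows on the initial value -/

/-- Second-order estimate for the variational equation along a solution of `x' = G x`. -/
theorem norm_sub_sub_variation_le {P : Type*} [NormedAddCommGroup P] [NormedSpace ℝ P]
    {G : P → P} {s : Set P} (hs : Convex ℝ s) (hG : Differentiable ℝ G) {k m τ : ℝ}
    (hk0 : 0 ≤ k) (hm0 : 0 ≤ m)
    (hk : ∀ a ∈ s, ‖fderiv ℝ G a‖ ≤ k)
    (hm : ∀ a ∈ s, ∀ b ∈ s, ‖fderiv ℝ G a - fderiv ℝ G b‖ ≤ m * ‖a - b‖)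
    {X Y : ℝ → P} {W : ℝ → P →L[ℝ] P}
    (hX : ∀ t ∈ Icc 0 τ, HasDerivAt X (G (X t)) t) (hXs : ∀ t ∈ Icc 0 τ, X t ∈ s)
    (hY : ∀ t ∈ Icc 0 τ, HasDerivAt Y (G (Y t)) t) (hYs : ∀ t ∈ Icc 0 τ, Y t ∈ s)
    (hW : ∀ t ∈ Icc 0 τ, HasDerivAt W ((fderiv ℝ G (X t)).comp (W t)) t) (hW0 : W 0 = 1) :
    ∀ t ∈ Icc 0 τ, ‖Y t - X t - W t (Y 0 - X 0)‖ ≤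
      gronwallBound 0 k (m * Real.exp (k * τ) ^ 2 * ‖Y 0 - X 0‖ ^ 2) t := by
  have hdist : ∀ t ∈ Icc 0 τ, ‖Y t - X t‖ ≤ Real.exp (k * τ) * ‖Y 0 - X 0‖ := by
    intro t ht
    have h1 : ∀ t ∈ Ico 0 τ, ‖G (Y t) - G (X t)‖ ≤ k * ‖Y t - X t‖ + 0 := by
      intro t ht
      rw [add_zero]
      exact hs.norm_image_sub_le_of_norm_fderiv_le (fun x _ => hG x) hk (hXs t (Ico_subset_Icc_self ht))
        (hYs t (Ico_subset_Icc_self ht))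
    have h2 := norm_le_gronwallBound_of_norm_deriv_right_le (f := fun t => Y t - X t)
      (f' := fun t => G (Y t) - G (X t)) (a := 0) (b := τ) (δ := ‖Y 0 - X 0‖) (K := k) (ε := 0)
      (fun t ht => ((hY t ht).sub (hX t ht)).continuousAt.continuousWithinAt)
      (fun t ht => ((hY t (Ico_subset_Icc_self ht)).sub
        (hX t (Ico_subset_Icc_self ht))).hasDerivWithinAt) le_rfl h1 t ht
    rw [gronwallBound_ε0, sub_zero, mul_comm] at h2
    refine h2.trans ?_
    gcongr
    exact ht.2
  intro t ht
  have h3 := norm_le_gronwallBound_of_norm_deriv_right_le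
    (f := fun t => Y t - X t - W t (Y 0 - X 0))
    (f' := fun t => G (Y t) - G (X t) - ((fderiv ℝ G (X t)).comp (W t)) (Y 0 - X 0))
    (a := 0) (b := τ) (δ := 0) (K := k)
    (ε := m * Real.exp (k * τ) ^ 2 * ‖Y 0 - X 0‖ ^ 2) ?_ ?_ ?_ ?_ t ht
  · simpa using h3
  · intro t ht
    exact (((hY t ht).sub (hX t ht)).sub
      ((hW t ht).clm_apply (hasDerivAt_const t _))).continuousAt.continuousWithinAt
  · intro t ht
    have ht' := Ico_subset_Icc_self ht
    have := ((hY t ht').sub (hX t ht')).sub ((hW t ht').clm_apply (hasDerivAt_const t (Y 0 - X 0)))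
    simpa using! this.hasDerivWithinAt
  · simp [hW0]
  · intro t ht
    have ht' := Ico_subset_Icc_self ht
    have hseg : segment ℝ (X t) (Y t) ⊆ s := hs.segment_subset (hXs t ht') (hYs t ht')
    have h4 : ‖G (Y t) - G (X t) - fderiv ℝ G (X t) (Y t - X t)‖
        ≤ (m * ‖Y t - X t‖) * ‖Y t - X t‖ := by
      refine (convex_segment (X t) (Y t)).norm_image_sub_le_of_norm_fderiv_le' (fun x _ => hG x)
        (fun x hx => ?_) (left_mem_segment ..) (right_mem_segment ..)
      refine (hm x (hseg hx) (X t) (hXs t ht')).trans ?_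
      gcongr
      obtain ⟨θ, hθ, rfl⟩ := (segment_eq_image' ℝ (X t) (Y t)) ▸ hx
      simp only [add_sub_cancel_left, norm_smul, Real.norm_eq_abs, abs_of_nonneg hθ.1]
      exact mul_le_of_le_one_left (norm_nonneg _) hθ.2
    -- The error obeys the linear variational equation up to the Taylor remainder of `G`, which is
    -- quadratic in the initial distance; Grönwall applies with zero initial error.
    have h5 : G (Y t) - G (X t) - ((fderiv ℝ G (X t)).comp (W t)) (Y 0 - X 0) =
        (fderiv ℝ G (X t)) (Y t - X t - W t (Y 0 - X 0)) +
        (G (Y t) - G (X t) - fderiv ℝ G (X t) (Y t - X t)) := by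
      simp only [ContinuousLinearMap.comp_apply, map_sub]; abel
    rw [h5]
    refine (norm_add_le _ _).trans (add_le_add ?_ (h4.trans ?_))
    · exact ((fderiv ℝ G (X t)).le_opNorm _).trans (by gcongr; exact hk _ (hXs t ht'))
    · calc m * ‖Y t - X t‖ * ‖Y t - X t‖ = m * ‖Y t - X t‖ ^ 2 := by ring
        _ ≤ m * (Real.exp (k * τ) * ‖Y 0 - X 0‖) ^ 2 := by gcongr; exact hdist t ht'
        _ = _ := by ring

/-- `gronwallBound` is homogeneous in its inhomogeneity. -/
theorem gronwallBound_zero_eq_mul (k ε x : ℝ) :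
    gronwallBound 0 k ε x = gronwallBound 0 k 1 x * ε := by
  by_cases hk : k = 0
  · simp [gronwallBound_K0, hk]; ring
  · simp [gronwallBound_of_K_ne_0 hk]; ring

/-- Spatial differentiability of a family of solutions, forward in time. -/
theorem exists_norm_sub_sub_variation_le {P : Type*} [NormedAddCommGroup P] [NormedSpace ℝ P]
    {G : P → P} {s : Set P} (hs : Convex ℝ s) (hG : Differentiable ℝ G) {k m : ℝ}
    (hk0 : 0 ≤ k) (hm0 : 0 ≤ m)
    (hk : ∀ a ∈ s, ‖fderiv ℝ G a‖ ≤ k)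
    (hm : ∀ a ∈ s, ∀ b ∈ s, ‖fderiv ℝ G a - fderiv ℝ G b‖ ≤ m * ‖a - b‖)
    {U : Set P} {φ : P → ℝ → P} {W : P → ℝ → P →L[ℝ] P} {ε : ℝ}
    (hφ : ∀ x ∈ U, ∀ t ∈ Ioo (-ε) ε, HasDerivAt (φ x) (G (φ x t)) t)
    (hφs : ∀ x ∈ U, ∀ t ∈ Ioo (-ε) ε, φ x t ∈ s) (hφ0 : ∀ x ∈ U, φ x 0 = x)
    (hW : ∀ x ∈ U, ∀ t ∈ Ioo (-ε) ε, HasDerivAt (W x) ((fderiv ℝ G (φ x t)).comp (W x t)) t)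
    (hW0 : ∀ x ∈ U, W x 0 = 1) {t : ℝ} (ht : t ∈ Ioo (-ε) ε) :
    ∃ c : ℝ, ∀ x ∈ U, ∀ y ∈ U, ‖φ y t - φ x t - W x t (y - x)‖ ≤ c * ‖y - x‖ ^ 2 := by
  rcases le_total 0 t with h0 | h0
  · refine ⟨gronwallBound 0 k 1 t * (m * Real.exp (k * t) ^ 2), fun x hx y hy => ?_⟩
    have hsub : ∀ r ∈ Icc 0 t, r ∈ Ioo (-ε) ε := fun r hr =>
      ⟨by linarith [hr.1, hr.2, ht.1, ht.2], lt_of_le_of_lt hr.2 ht.2⟩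
    have := norm_sub_sub_variation_le hs hG hk0 hm0 hk hm
      (fun r hr => hφ x hx r (hsub r hr)) (fun r hr => hφs x hx r (hsub r hr))
      (fun r hr => hφ y hy r (hsub r hr)) (fun r hr => hφs y hy r (hsub r hr))
      (fun r hr => hW x hx r (hsub r hr)) (hW0 x hx) t ⟨h0, le_rfl⟩
    rw [gronwallBound_zero_eq_mul, hφ0 x hx, hφ0 y hy] at this
    linarith
  · refine ⟨gronwallBound 0 k 1 (-t) * (m * Real.exp (k * (-t)) ^ 2), fun x hx y hy => ?_⟩
    have hsub : ∀ r ∈ Icc 0 (-t), -r ∈ Ioo (-ε) ε := fun r hr =>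
      ⟨by linarith [hr.1, hr.2, ht.1, ht.2], by linarith [hr.1, hr.2, ht.1, ht.2]⟩
    -- Negative times reduce to positive ones by reversing time, which replaces `G` by `-G`.
    have hfn : ∀ a, fderiv ℝ (fun x => - G x) a = - fderiv ℝ G a := fun a => fderiv_fun_neg
    have := norm_sub_sub_variation_le (G := fun x => - G x) (X := fun r => φ x (-r))
      (Y := fun r => φ y (-r)) (W := fun r => W x (-r)) (τ := -t) hs hG.neg hk0 hm0
      (by simpa only [hfn, norm_neg] using hk)
      (fun a ha b hb => by
        rw [hfn, hfn, ← norm_neg]; simpa only [neg_sub, sub_neg_eq_add, neg_add, neg_neg,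
          ← sub_eq_add_neg] using hm a ha b hb)
      (fun r hr => by simpa using! (hφ x hx (-r) (hsub r hr)).scomp r (hasDerivAt_neg r))
      (fun r hr => hφs x hx (-r) (hsub r hr))
      (fun r hr => by simpa using! (hφ y hy (-r) (hsub r hr)).scomp r (hasDerivAt_neg r))
      (fun r hr => hφs y hy (-r) (hsub r hr))
      (fun r hr => by
        have := (hW x hx (-r) (hsub r hr)).scomp r (hasDerivAt_neg r)
        rw [hfn]; simpa using! this)
      (by simpa using hW0 x hx) (-t) ⟨by linarith, le_rfl⟩
    simp only [neg_neg, neg_zero] at this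
    rw [gronwallBound_zero_eq_mul, hφ0 x hx, hφ0 y hy] at this
    linarith

theorem hasFDerivAt_of_norm_le_sq {P Q : Type*} [NormedAddCommGroup P] [NormedSpace ℝ P]
    [NormedAddCommGroup Q] [NormedSpace ℝ Q] {f : P → Q} {L : P →L[ℝ] Q} {x : P} {c : ℝ}
    (h : ∀ᶠ y in 𝓝 x, ‖f y - f x - L (y - x)‖ ≤ c * ‖y - x‖ ^ 2) : HasFDerivAt f L x := by
  rw [hasFDerivAt_iff_isLittleO]
  have h1 : (fun y => f y - f x - L (y - x)) =O[𝓝 x] fun y => ‖y - x‖ ^ 2 := by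
    refine Asymptotics.IsBigO.of_bound c ?_
    filter_upwards [h] with y hy
    simpa using hy
  have h2 : (fun y : P => ‖y - x‖ ^ 2) =o[𝓝 x] fun y => y - x :=
    Asymptotics.isLittleO_norm_pow_id one_lt_two |>.comp_tendsto
      (by simpa using (tendsto_id (x := 𝓝 x)).sub_const x)
  exact h1.trans_isLittleO h2

/-- A smooth vector field has local flows of every finite differentiability class. -/
theorem exists_contDiffAt_local_flow.{u} (k : ℕ) : ∀ {P : Type u} [NormedAddCommGroup P]
    [NormedSpace ℝ P] [FiniteDimensional ℝ P] {G : P → P} (_ : ContDiff ℝ ∞ G) (x₀ : P),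
    ∃ α : P × ℝ → P, (∀ᶠ z in 𝓝 (x₀, (0 : ℝ)), α (z.1, 0) = z.1 ∧
      HasDerivAt (fun t => α (z.1, t)) (G (α z)) z.2) ∧ ContDiffAt ℝ k α (x₀, 0) := by
  induction k with
  | zero =>
    intro P _ _ _ G hG x₀
    have : CompleteSpace P := FiniteDimensional.complete ℝ P
    obtain ⟨ε, hε, a, r, L, K, hr, h⟩ := IsPicardLindelof.of_contDiffAt_one
      (hG.contDiffAt (x := x₀) |>.of_le (by exact_mod_cast le_top))
    obtain ⟨α, hα, hc⟩ := (h 0).exists_forall_mem_closedBall_eq_hasDerivWithinAt_continuousOn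
    simp only [zero_sub, zero_add] at hα hc
    have hU : Metric.closedBall x₀ r ×ˢ Icc (-ε) ε ∈ 𝓝 (x₀, (0 : ℝ)) :=
      prod_mem_nhds (Metric.closedBall_mem_nhds _ (by exact_mod_cast hr))
        (Icc_mem_nhds (by linarith) hε)
    refine ⟨α, ?_, ?_⟩
    · filter_upwards [eventually_eventually_nhds.2 hU] with z hz
      have hz0 := mem_of_mem_nhds hz
      refine ⟨(hα z.1 hz0.1).1, ((hα z.1 hz0.1).2 z.2 hz0.2).hasDerivAt ?_⟩
      have : Tendsto (fun t => (z.1, t)) (𝓝 z.2) (𝓝 z) :=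
        (Continuous.prodMk_right z.1).tendsto z.2
      filter_upwards [this hz] with t ht using ht.2
    · rw [Nat.cast_zero, contDiffAt_zero]
      exact ⟨_, hU, hc⟩
  | succ k ih =>
    intro P _ _ _ G hG x₀
    have hGd : Differentiable ℝ G := hG.differentiable (by simp)
    have hG' : ContDiff ℝ ∞ (fderiv ℝ G) := hG.fderiv_right (m := ∞) (by simp)
    -- The flow and its spatial derivative together solve the augmented system `x' = G x`, `w' =
    -- DG(x) w`. By induction that flow is `C^k`; the partial derivatives of its first component are
    -- its second component and `G` of the flow, so the first component is `C^(k+1)`. This is why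
    -- the space and the field are quantified inside the induction.
    let Ga : P × (P →L[ℝ] P) → P × (P →L[ℝ] P) := fun z => (G z.1, (fderiv ℝ G z.1).comp z.2)
    have hGa : ContDiff ℝ ∞ Ga :=
      (hG.comp contDiff_fst).prodMk ((hG'.comp contDiff_fst).clm_comp contDiff_snd)
    obtain ⟨α, hα, hαk⟩ := ih hGa (x₀, 1)
    have hι : Continuous fun z : P × ℝ => ((z.1, (1 : P →L[ℝ] P)), z.2) := by fun_prop
    let β : P × ℝ → P × (P →L[ℝ] P) := fun z => α ((z.1, 1), z.2)
    have hβk : ContDiffAt ℝ k β (x₀, 0) :=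
      ContDiffAt.comp (x₀, (0 : ℝ)) (g := α) (f := fun z : P × ℝ => ((z.1, (1 : P →L[ℝ] P)), z.2))
        hαk (by fun_prop)
    have hβ : ∀ᶠ z in 𝓝 (x₀, (0 : ℝ)), β (z.1, 0) = (z.1, 1) ∧
        HasDerivAt (fun t => β (z.1, t)) (Ga (β z)) z.2 := (hι.tendsto (x₀, 0)).eventually hα
    have hβ0 : β (x₀, 0) = (x₀, 1) := hβ.self_of_nhds.1
    obtain ⟨m, hm⟩ := (hG'.contDiffOn (s := Metric.closedBall x₀ 1)).exists_lipschitzOnWith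
      (by simp) (convex_closedBall _ _) (isCompact_closedBall _ _)
    obtain ⟨c, hc⟩ := (isCompact_closedBall x₀ (1 : ℝ)).exists_bound_of_continuousOn
      hG'.continuous.continuousOn
    have hin : ∀ᶠ z in 𝓝 (x₀, (0 : ℝ)), (β z).1 ∈ Metric.closedBall x₀ 1 := by
      have : ContinuousAt (fun z => (β z).1) (x₀, 0) := hβk.continuousAt.fst
      refine this.eventually ?_
      simp only [hβ0]
      exact Metric.closedBall_mem_nhds _ one_pos
    obtain ⟨U, hU, V, hV, hUV⟩ := mem_nhds_prod_iff.1 (hβ.and hin)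
    obtain ⟨ε, hε, hεV⟩ := Metric.mem_nhds_iff.1 hV
    rw [Real.ball_eq_Ioo, zero_sub, zero_add] at hεV
    have hall : ∀ x ∈ U, ∀ t ∈ Ioo (-ε) ε, (β (x, 0) = (x, 1) ∧
        HasDerivAt (fun t => β (x, t)) (Ga (β (x, t))) t) ∧ (β (x, t)).1 ∈ Metric.closedBall x₀ 1 :=
      fun x hx t ht => hUV (mk_mem_prod hx (hεV ht))
    have h00 : (0 : ℝ) ∈ Ioo (-ε) ε := ⟨by linarith, hε⟩
    have hφ : ∀ x ∈ U, ∀ t ∈ Ioo (-ε) ε,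
        HasDerivAt (fun t => (β (x, t)).1) (G (β (x, t)).1) t := fun x hx t ht => by
      simpa using! ((ContinuousLinearMap.fst ℝ P (P →L[ℝ] P)).hasFDerivAt.comp_hasDerivAt t
        (hall x hx t ht).1.2)
    have hW : ∀ x ∈ U, ∀ t ∈ Ioo (-ε) ε, HasDerivAt (fun t => (β (x, t)).2)
        ((fderiv ℝ G (β (x, t)).1).comp (β (x, t)).2) t := fun x hx t ht => by
      simpa using! ((ContinuousLinearMap.snd ℝ P (P →L[ℝ] P)).hasFDerivAt.comp_hasDerivAt t
        (hall x hx t ht).1.2)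
    have hvar : ∀ t ∈ Ioo (-ε) ε, ∃ c : ℝ, ∀ x ∈ U, ∀ y ∈ U,
        ‖(β (y, t)).1 - (β (x, t)).1 - (β (x, t)).2 (y - x)‖ ≤ c * ‖y - x‖ ^ 2 := by
      intro t ht
      exact exists_norm_sub_sub_variation_le (φ := fun x t => (β (x, t)).1)
        (W := fun x t => (β (x, t)).2) (convex_closedBall x₀ 1) hGd (k := max c 0) (m := m)
        (le_max_right _ _) m.2 (fun a ha => (hc a ha).trans (le_max_left _ _))
        (fun a ha b hb => by simpa [dist_eq_norm] using hm.dist_le_mul a ha b hb)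
        hφ (fun x hx t ht => (hall x hx t ht).2) (fun x hx => by simp [(hall x hx 0 h00).1.1]) hW
        (fun x hx => by simp [(hall x hx 0 h00).1.1]) ht
    have hO : interior U ×ˢ Ioo (-ε) ε ∈ 𝓝 (x₀, (0 : ℝ)) :=
      prod_mem_nhds (interior_mem_nhds.2 hU) (Ioo_mem_nhds (by linarith) hε)
    have hOo : IsOpen (interior U ×ˢ Ioo (-ε) ε) := isOpen_interior.prod isOpen_Ioo
    have hx : ∀ z ∈ interior U ×ˢ Ioo (-ε) ε,
        HasFDerivAt (fun x => (β (x, z.2)).1) (β z).2 z.1 := by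
      rintro ⟨x, t⟩ ⟨hx, ht⟩
      obtain ⟨c, hc⟩ := hvar t ht
      refine hasFDerivAt_of_norm_le_sq (c := c) ?_
      filter_upwards [mem_interior_iff_mem_nhds.1 hx] with y hy
      exact hc x (interior_subset hx) y hy
    have hcont : ∀ᶠ z in 𝓝 (x₀, (0 : ℝ)), ContinuousAt β z := by
      obtain ⟨u, hu, hc⟩ := contDiffAt_zero.1 (hβk.of_le (by simp))
      filter_upwards [eventually_eventually_nhds.2 hu] with z hz using hc.continuousAt hz
    refine ⟨fun z => (β z).1, ?_, ?_⟩
    · filter_upwards [hO] with z hz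
      exact ⟨by simp [(hall z.1 (interior_subset hz.1) z.2 hz.2).1.1],
        hφ z.1 (interior_subset hz.1) z.2 hz.2⟩
    · rw [Nat.cast_add, Nat.cast_one, contDiffAt_succ_iff_hasFDerivAt]
      refine ⟨fun z => ((β z).2).coprod ((ContinuousLinearMap.toSpanSingleton ℝ (G (β z).1))),
        ⟨_, inter_mem hO hcont, ?_⟩, ?_⟩
      · rintro z ⟨hz, hzc⟩
        have hst := hasStrictFDerivAt_uncurry_coprod (𝕜 := ℝ) (u := z)
          (f := fun x t => (β (x, t)).1) (f₁ := fun x t => (β (x, t)).2)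
          (f₂ := fun x t => ContinuousLinearMap.toSpanSingleton ℝ (G (β (x, t)).1))
          (by filter_upwards [hOo.mem_nhds hz] with v hv using hx v hv)
          (by
            filter_upwards [hOo.mem_nhds hz] with v hv
            exact (hφ v.1 (interior_subset hv.1) v.2 hv.2).hasFDerivAt)
          (by exact hzc.snd)
          (by
            have : ContinuousAt (fun z => G (β z).1) z :=
              hG.continuous.continuousAt.comp hzc.fst
            exact (ContinuousLinearMap.toSpanSingletonCLE (𝕜 := ℝ) (E := P)).continuous.continuousAt.comp this)
        exact hst.hasFDerivAt
      · have h1 : ContDiffAt ℝ k (fun z => (β z).2) (x₀, 0) := hβk.snd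
        have h2 : ContDiffAt ℝ k (fun z => G (β z).1) (x₀, 0) :=
          (hG.of_le (by exact_mod_cast le_top)).contDiffAt.comp _ hβk.fst
        have h3 := (ContinuousLinearMap.toSpanSingletonCLE (𝕜 := ℝ) (E := P)).contDiff.contDiffAt.comp
          (n := (k : ℕ∞ω)) _ h2
        have : (fun z => ((β z).2).coprod ((ContinuousLinearMap.toSpanSingleton ℝ (G (β z).1)))) =
            fun z => (β z).2.comp (ContinuousLinearMap.fst ℝ P ℝ) +
              (ContinuousLinearMap.toSpanSingleton ℝ (G (β z).1)).comp
                (ContinuousLinearMap.snd ℝ P ℝ) := by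
          ext z <;> simp
        rw [this]
        exact (h1.clm_comp contDiffAt_const).add (h3.clm_comp contDiffAt_const)

end ControlSystem

/-! ### Global flows -/

namespace ControlSystem
open Filter Topology

section Flow

variable {P : Type*} [NormedAddCommGroup P] [NormedSpace ℝ P]

/-- `φ` is the global flow of the vector field `G`. -/
structure IsFlow (G : P → P) (φ : ℝ → P → P) : Prop where
  zero : ∀ x, φ 0 x = x
  deriv : ∀ x t, HasDerivAt (fun t => φ t x) (G (φ t x)) t

variable [FiniteDimensional ℝ P] {G : P → P}

/-- A `C¹` field need not be globally Lipschitz, but on a compact interval both curves stay in one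
ball, and on that ball it is Lipschitz. -/
theorem eqOn_Icc_of_hasDerivAt (hG : ContDiff ℝ 1 G) {X Y : ℝ → P} {a b t₀ : ℝ}
    (ht₀ : t₀ ∈ Ioo a b) (hX : ∀ t ∈ Icc a b, HasDerivAt X (G (X t)) t)
    (hY : ∀ t ∈ Icc a b, HasDerivAt Y (G (Y t)) t) (h : X t₀ = Y t₀) : EqOn X Y (Icc a b) := by
  have hXc : ContinuousOn X (Icc a b) := fun t ht => (hX t ht).continuousAt.continuousWithinAt
  have hYc : ContinuousOn Y (Icc a b) := fun t ht => (hY t ht).continuousAt.continuousWithinAt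
  obtain ⟨r, hr⟩ := isCompact_Icc.exists_bound_of_continuousOn hXc
  obtain ⟨q, hq⟩ := isCompact_Icc.exists_bound_of_continuousOn hYc
  obtain ⟨k, hk⟩ := (hG.contDiffOn (s := Metric.closedBall 0 (max r q))).exists_lipschitzOnWith
    one_ne_zero (convex_closedBall _ _) (isCompact_closedBall _ _)
  refine ODE_solution_unique_of_mem_Icc (v := fun _ => G) (K := k)
    (s := fun _ => Metric.closedBall 0 (max r q)) (fun _ _ => hk) ht₀ hXc
    (fun t ht => hX t (Ioo_subset_Icc_self ht)) (fun t ht => ?_) hYc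
    (fun t ht => hY t (Ioo_subset_Icc_self ht)) (fun t ht => ?_) h
  · simpa using Or.inl (hr t (Ioo_subset_Icc_self ht))
  · simpa using Or.inr (hq t (Ioo_subset_Icc_self ht))

theorem eq_of_hasDerivAt (hG : ContDiff ℝ 1 G) {X Y : ℝ → P} {t₀ : ℝ}
    (hX : ∀ t, HasDerivAt X (G (X t)) t) (hY : ∀ t, HasDerivAt Y (G (Y t)) t)
    (h : X t₀ = Y t₀) : X = Y := by
  ext t
  exact eqOn_Icc_of_hasDerivAt hG (a := min t t₀ - 1) (b := max t t₀ + 1)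
    ⟨by linarith [min_le_right t t₀], by linarith [le_max_right t t₀]⟩
    (fun t _ => hX t) (fun t _ => hY t) h
    ⟨by linarith [min_le_left t t₀], by linarith [le_max_left t t₀]⟩

namespace IsFlow

variable {φ : ℝ → P → P}

theorem eq_of_hasDerivAt (hφ : IsFlow G φ) (hG : ContDiff ℝ 1 G) {X : ℝ → P}
    (hX : ∀ t, HasDerivAt X (G (X t)) t) (t : ℝ) : X t = φ t (X 0) :=
  congrFun (ControlSystem.eq_of_hasDerivAt hG (t₀ := 0) hX (hφ.deriv (X 0)) (hφ.zero _).symm) t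

theorem add (hφ : IsFlow G φ) (hG : ContDiff ℝ 1 G) (s t : ℝ) (x : P) :
    φ (s + t) x = φ t (φ s x) := by
  have := hφ.eq_of_hasDerivAt hG (X := fun t => φ (s + t) x)
    (fun t => by simpa using! (hφ.deriv x (s + t)).scomp t ((hasDerivAt_id t).const_add s)) t
  simpa using this

theorem neg_apply (hφ : IsFlow G φ) (hG : ContDiff ℝ 1 G) (t : ℝ) (x : P) :
    φ (-t) (φ t x) = x := by
  rw [← hφ.add hG, add_neg_cancel, hφ.zero]

theorem apply_neg (hφ : IsFlow G φ) (hG : ContDiff ℝ 1 G) (t : ℝ) (x : P) :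
    φ t (φ (-t) x) = x := by
  rw [← hφ.add hG, neg_add_cancel, hφ.zero]

/-- Near any point and for short times, a global flow is of class `C^k`. -/
theorem contDiffAt_zero (hφ : IsFlow G φ) (hG : ContDiff ℝ ∞ G) (k : ℕ) (x₀ : P) :
    ContDiffAt ℝ k (fun z : P × ℝ => φ z.2 z.1) (x₀, 0) := by
  obtain ⟨α, hα, hk⟩ := exists_contDiffAt_local_flow k hG x₀
  refine hk.congr_of_eventuallyEq ?_
  obtain ⟨U, hU, V, hV, hUV⟩ := mem_nhds_prod_iff.1 hα
  obtain ⟨ε, hε, hεV⟩ := Metric.mem_nhds_iff.1 hV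
  rw [Real.ball_eq_Ioo, zero_sub, zero_add] at hεV
  filter_upwards [prod_mem_nhds hU (Ioo_mem_nhds (by linarith : -(ε / 2) < 0) (half_pos hε))]
    with z hz
  have h : ∀ t ∈ Ioo (-ε) ε, α (z.1, 0) = z.1 ∧
      HasDerivAt (fun t => α (z.1, t)) (G (α (z.1, t))) t := fun t ht =>
    hUV (mk_mem_prod hz.1 (hεV ht))
  have hsub : Icc (-(ε / 2)) (ε / 2) ⊆ Ioo (-ε) ε := fun t ht =>
    ⟨by linarith [ht.1], by linarith [ht.2]⟩
  have h0 : (0 : ℝ) ∈ Ioo (-(ε / 2)) (ε / 2) := ⟨by linarith, by linarith⟩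
  exact eqOn_Icc_of_hasDerivAt (hG.of_le (by exact_mod_cast le_top)) h0
    (fun t _ => hφ.deriv z.1 t) (fun t ht => (h t (hsub ht)).2)
    (by rw [hφ.zero, (h 0 (hsub (Ioo_subset_Icc_self h0))).1]) (Ioo_subset_Icc_self hz.2)

/-- The global flow of a smooth vector field is smooth in time and space. -/
theorem contDiff (hφ : IsFlow G φ) (hG : ContDiff ℝ ∞ G) :
    ContDiff ℝ ∞ (fun z : P × ℝ => φ z.2 z.1) := by
  have hG1 : ContDiff ℝ 1 G := hG.of_le (by exact_mod_cast le_top)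
  rw [contDiff_infty]
  intro k
  rw [contDiff_iff_contDiffAt]
  rintro ⟨x₀, t₀⟩
  -- Since `φ t = φ (t - s) ∘ φ s`, regularity at time `s` passes to time `t` whenever the flow is
  -- regular near `(φ s x₀, t - s)`. With regularity for short times this makes the set of good
  -- times clopen.
  have step : ∀ s t, ContDiffAt ℝ k (fun z : P × ℝ => φ z.2 z.1) (φ s x₀, t - s) →
      ContDiffAt ℝ k (fun z : P × ℝ => φ z.2 z.1) (x₀, s) →
      ContDiffAt ℝ k (fun z : P × ℝ => φ z.2 z.1) (x₀, t) := by
    intro s t h1 h2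
    have h3 : ContDiffAt ℝ k (fun z : P × ℝ => φ s z.1) (x₀, t) :=
      ContDiffAt.comp (x₀, t) (g := fun z : P × ℝ => φ z.2 z.1) (f := fun z : P × ℝ => (z.1, s))
        h2 (by fun_prop)
    have h4 : ContDiffAt ℝ k (fun z : P × ℝ => φ (z.2 - s) (φ s z.1)) (x₀, t) :=
      ContDiffAt.comp (x₀, t) (g := fun z : P × ℝ => φ z.2 z.1)
        (f := fun z : P × ℝ => (φ s z.1, z.2 - s)) h1
        (h3.prodMk (contDiffAt_snd.sub contDiffAt_const))
    refine h4.congr_of_eventuallyEq (Eventually.of_forall fun z => ?_)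
    simp [← hφ.add hG1]
  have hloc : ∀ s, ∀ᶠ t in 𝓝 s,
      ContDiffAt ℝ k (fun z : P × ℝ => φ z.2 z.1) (φ t x₀, s - t) ∧
      ContDiffAt ℝ k (fun z : P × ℝ => φ z.2 z.1) (φ s x₀, t - s) := by
    intro s
    have hev := (hφ.contDiffAt_zero hG k (φ s x₀)).eventually (by simp)
    have hc : Continuous fun t => φ t x₀ :=
      continuous_iff_continuousAt.2 fun t => (hφ.deriv x₀ t).continuousAt
    have h1 : Tendsto (fun t => (φ t x₀, s - t)) (𝓝 s) (𝓝 (φ s x₀, 0)) := by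
      have : Continuous fun t => (φ t x₀, s - t) := by fun_prop
      simpa using this.tendsto s
    have h2 : Tendsto (fun t => (φ s x₀, t - s)) (𝓝 s) (𝓝 (φ s x₀, 0)) := by
      have : Continuous fun t => (φ s x₀, t - s) := by fun_prop
      simpa using this.tendsto s
    exact (h1.eventually hev).and (h2.eventually hev)
  have hcl : IsClopen {t | ContDiffAt ℝ k (fun z : P × ℝ => φ z.2 z.1) (x₀, t)} := by
    constructor
    · rw [← isOpen_compl_iff, isOpen_iff_eventually]
      intro s hs
      filter_upwards [hloc s] with t ht h
      exact hs (step t s ht.1 h)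
    · rw [isOpen_iff_eventually]
      intro s hs
      filter_upwards [hloc s] with t ht using step s t ht.2 hs
  have := hcl.eq_univ ⟨0, hφ.contDiffAt_zero hG k x₀⟩
  exact eq_univ_iff_forall.1 this t₀

end IsFlow

/-- A bounded Lipschitz vector field of class `C^1` has a global flow. -/
theorem exists_isFlow (hG : ContDiff ℝ 1 G) {b k : NNReal} (hb : ∀ x, ‖G x‖ ≤ b)
    (hk : LipschitzWith k G) : ∃ φ, IsFlow G φ := by
  have : CompleteSpace P := FiniteDimensional.complete ℝ P
  have hex : ∀ (x : P) (T : NNReal), ∃ X : ℝ → P, X 0 = x ∧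
      ∀ t ∈ Ioo (-(T : ℝ)) T, HasDerivAt X (G (X t)) t := by
    intro x T
    -- A field bounded by `b` moves a point by at most `b * T` in time `T`, so Picard–Lindelöf works
    -- on the whole of `[-T, T]`.
    have hpl : IsPicardLindelof (fun _ : ℝ => G) (tmin := -(T : ℝ)) (tmax := T)
        ⟨0, by simp⟩ x (b * T) 0 b k :=
      .of_time_independent (fun x _ => hb x) hk.lipschitzOnWith (by simp)
    obtain ⟨X, hX0, hX⟩ := hpl.exists_eq_forall_mem_Icc_hasDerivWithinAt₀
    exact ⟨X, hX0, fun t ht => (hX t (Ioo_subset_Icc_self ht)).hasDerivAt (Icc_mem_nhds ht.1 ht.2)⟩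
  choose X hX0 hX using hex
  have huniq : ∀ x (S T : NNReal), S ≤ T → ∀ t : ℝ, |t| < S → X x S t = X x T t := by
    intro x S T hST t ht
    obtain ⟨r, hr1, hr2⟩ := exists_between ht
    have h0 : 0 < r := (abs_nonneg t).trans_lt hr1
    have hST' : (S : ℝ) ≤ T := by exact_mod_cast hST
    exact eqOn_Icc_of_hasDerivAt hG (a := -r) (b := r) (t₀ := 0) ⟨by linarith, h0⟩
      (fun s hs => hX x S s ⟨by linarith [hs.1], by linarith [hs.2]⟩)
      (fun s hs => hX x T s ⟨by linarith [hs.1], by linarith [hs.2]⟩)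
      (by rw [hX0, hX0]) (abs_le.1 hr1.le)
  -- The margin `1` puts `t` inside the open interval where the equation holds; near `t` all the
  -- solutions used agree with the one on the interval of radius `‖t‖ + 2`.
  refine ⟨fun t x => X x (‖t‖₊ + 1) t, fun x => hX0 _ _, fun x t => ?_⟩
  have h1 : HasDerivAt (X x (‖t‖₊ + 2)) (G (X x (‖t‖₊ + 2) t)) t :=
    hX x _ t (abs_lt.1 (by simp))
  have h2 : ∀ᶠ s in 𝓝 t, X x (‖s‖₊ + 1) s = X x (‖t‖₊ + 2) s := by
    have hc : ∀ᶠ s in 𝓝 t, ‖s‖₊ < ‖t‖₊ + 1 :=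
      (continuous_nnnorm.tendsto t).eventually (gt_mem_nhds (by simp))
    filter_upwards [hc] with s hs
    refine huniq x _ _ ?_ s (by simp)
    calc ‖s‖₊ + 1 ≤ (‖t‖₊ + 1) + 1 := by gcongr
      _ = ‖t‖₊ + 2 := by rw [add_assoc]; norm_num
  have h3 : X x (‖t‖₊ + 1) t = X x (‖t‖₊ + 2) t := h2.self_of_nhds
  simp only [h3]
  exact h1.congr_of_eventuallyEq h2

end Flow

end ControlSystem

/-! ### Curves on graphs, words of flows and steering systems -/

namespace ControlSystem
open Filter Topology

section Graph

variable {E W : Type*} [NormedAddCommGroup E] [NormedSpace ℝ E]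
  [NormedAddCommGroup W] [NormedSpace ℝ W]

/-- A curve which starts on the graph `x = H (π x)` and solves an equation whose right-hand side
is tangent to that graph stays on it. -/
theorem eq_graph_of_tangent {π : E →L[ℝ] W} {H : W → E} {O : Set W} {c k T : ℝ}
    (hH : ∀ v ∈ O, DifferentiableAt ℝ H v) (hc : ∀ v ∈ O, ‖fderiv ℝ H v‖ ≤ c)
    (hπ : ∀ v ∈ O, ∀ a, π (fderiv ℝ H v a) = a) {g : ℝ → E → E} {ξ : ℝ → E}
    (hξ : ∀ s ∈ Icc 0 T, HasDerivWithinAt ξ (g s (ξ s)) (Icc 0 T) s)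
    (hO : ∀ s ∈ Icc 0 T, π (ξ s) ∈ O)
    (hk : ∀ s ∈ Icc 0 T, ‖g s (ξ s) - g s (H (π (ξ s)))‖ ≤ k * ‖ξ s - H (π (ξ s))‖)
    (htan : ∀ s ∈ Icc 0 T, ∃ a, g s (H (π (ξ s))) = fderiv ℝ H (π (ξ s)) a)
    (h0 : ξ 0 = H (π (ξ 0))) : ∀ s ∈ Icc 0 T, ξ s = H (π (ξ s)) := by
  have hd : ∀ s ∈ Icc 0 T, HasDerivWithinAt (fun s => ξ s - H (π (ξ s)))
      (g s (ξ s) - fderiv ℝ H (π (ξ s)) (π (g s (ξ s)))) (Icc 0 T) s := by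
    intro s hs
    refine (hξ s hs).sub ?_
    exact (hH _ (hO s hs)).hasFDerivAt.comp_hasDerivWithinAt s
      (π.hasFDerivAt.comp_hasDerivWithinAt s (hξ s hs))
  have h := eq_zero_of_abs_deriv_le_mul_abs_self_of_eq_zero_right
    (f := fun s => ξ s - H (π (ξ s)))
    (f' := fun s => g s (ξ s) - fderiv ℝ H (π (ξ s)) (π (g s (ξ s)))) (a := 0) (b := T)
    (K := (1 + c * ‖π‖) * k) (fun s hs => (hd s hs).continuousWithinAt)
    (fun s hs => (hd s (Ico_subset_Icc_self hs)).mono_of_mem_nhdsWithin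
      (Icc_mem_nhdsGE_of_mem hs)) (sub_eq_zero.2 h0) ?_
  · exact fun s hs => sub_eq_zero.1 (h s hs)
  · intro s hs
    replace hs := Ico_subset_Icc_self hs
    obtain ⟨a, ha⟩ := htan s hs
    -- Tangency enters here: `DH ∘ π` fixes vectors in the image of `DH`. Only the difference of `g`
    -- at the two points survives, so `ξ - H (π ξ)` satisfies a linear differential inequality and
    -- vanishes.
    have hfix : fderiv ℝ H (π (ξ s)) (π (g s (H (π (ξ s))))) = g s (H (π (ξ s))) := by
      rw [ha, hπ _ (hO s hs)]
    have heq : g s (ξ s) - fderiv ℝ H (π (ξ s)) (π (g s (ξ s))) =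
        (g s (ξ s) - g s (H (π (ξ s)))) -
          fderiv ℝ H (π (ξ s)) (π (g s (ξ s) - g s (H (π (ξ s))))) := by
      rw [map_sub, map_sub, hfix]; abel
    rw [heq]
    set e := g s (ξ s) - g s (H (π (ξ s)))
    have hc0 : 0 ≤ c := (norm_nonneg _).trans (hc _ (hO s hs))
    calc ‖e - fderiv ℝ H (π (ξ s)) (π e)‖ ≤ ‖e‖ + ‖fderiv ℝ H (π (ξ s)) (π e)‖ := norm_sub_le _ _
      _ ≤ ‖e‖ + c * (‖π‖ * ‖e‖) := by
        gcongr
        exact ((fderiv ℝ H (π (ξ s))).le_opNorm _).trans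
          (mul_le_mul (hc _ (hO s hs)) (π.le_opNorm _) (norm_nonneg _) hc0)
      _ = (1 + c * ‖π‖) * ‖e‖ := by ring
      _ ≤ (1 + c * ‖π‖) * (k * ‖ξ s - H (π (ξ s))‖) := by gcongr; exact hk s hs
      _ = _ := by ring

end Graph

namespace IsFlow

variable {P : Type*} [NormedAddCommGroup P] [NormedSpace ℝ P] {G : P → P} {φ : ℝ → P → P}

theorem norm_sub_le (hφ : IsFlow G φ) {k : NNReal} (hk : LipschitzWith k G) (t : ℝ) (x y : P) :
    ‖φ t x - φ t y‖ ≤ Real.exp (k * |t|) * ‖x - y‖ := by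
  rcases le_total 0 t with ht | ht
  · rw [abs_of_nonneg ht]
    have := dist_le_of_trajectories_ODE (v := fun _ => G) (fun _ => hk)
      (fun s _ => (hφ.deriv x s).continuousAt.continuousWithinAt)
      (fun s _ => (hφ.deriv x s).hasDerivWithinAt)
      (fun s _ => (hφ.deriv y s).continuousAt.continuousWithinAt)
      (fun s _ => (hφ.deriv y s).hasDerivWithinAt) (a := 0) (b := t) le_rfl t ⟨ht, le_rfl⟩
    rwa [hφ.zero, hφ.zero, dist_eq_norm, dist_eq_norm, sub_zero, mul_comm] at this
  · have hd : ∀ x s, HasDerivAt (fun s => φ (-s) x) (-G (φ (-s) x)) s := fun x s => by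
      simpa using! (hφ.deriv x (-s)).scomp s (hasDerivAt_neg s)
    have := dist_le_of_trajectories_ODE (v := fun _ x => - G x) (fun _ => hk.neg)
      (fun s _ => (hd x s).continuousAt.continuousWithinAt)
      (fun s _ => (hd x s).hasDerivWithinAt)
      (fun s _ => (hd y s).continuousAt.continuousWithinAt)
      (fun s _ => (hd y s).hasDerivWithinAt) (a := 0) (b := -t) le_rfl (-t) ⟨by linarith, le_rfl⟩
    rwa [neg_zero, hφ.zero, hφ.zero, dist_eq_norm, dist_eq_norm, sub_zero, mul_comm, neg_neg,
      ← abs_of_nonpos ht] at this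

/-- The flow preserves its vector field. -/
theorem fderiv_apply [FiniteDimensional ℝ P] (hφ : IsFlow G φ) (hG : ContDiff ℝ 1 G) {t : ℝ} {x : P}
    (hd : DifferentiableAt ℝ (φ t) x) : fderiv ℝ (φ t) x (G x) = G (φ t x) := by
  have hd' : HasFDerivAt (φ t) (fderiv ℝ (φ t) x) (φ 0 x) := by
    rw [hφ.zero]; exact hd.hasFDerivAt
  have h1 := hd'.comp_hasDerivAt (0 : ℝ) (hφ.deriv x 0)
  have h2 : HasDerivAt (fun s => φ t (φ s x)) (G (φ t x)) 0 := by
    have h3 : HasDerivAt (fun r => φ r x) (G (φ t x)) (0 + t) := by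
      rw [zero_add]; exact hφ.deriv x t
    have h4 := h3.comp_add_const 0 t
    simpa only [hφ.add hG] using h4
  have := h1.unique h2
  rwa [hφ.zero] at this

end IsFlow

section Words

variable {E U : Type*}

/-- The endpoint map of a word of (perturbed) flows. -/
def run (ℓ : U → ℝ → ℝ → E → E) (ε : ℝ) (w : List (U × NNReal)) (x : E) : E :=
  w.foldl (fun x l => ℓ l.1 ε l.2 x) x

/-- The inverse of the endpoint map of a word of unperturbed flows. -/
def runInv (ℓ : U → ℝ → ℝ → E → E) (w : List (U × NNReal)) (x : E) : E :=
  w.foldr (fun l x => ℓ l.1 0 (-l.2) x) x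

/-- The total duration of a word. -/
def duration (w : List (U × NNReal)) : ℝ := (w.map fun l => (l.2 : ℝ)).sum

section RunLemmas

variable (ℓ : U → ℝ → ℝ → E → E) (ε : ℝ) (w w' : List (U × NNReal)) (u : U) (t : NNReal) (x : E)

@[simp] theorem run_nil : run ℓ ε [] x = x := rfl

@[simp] theorem run_cons : run ℓ ε ((u, t) :: w) x = run ℓ ε w (ℓ u ε t x) := rfl

@[simp] theorem run_append : run ℓ ε (w ++ w') x = run ℓ ε w' (run ℓ ε w x) := by
  simp [run]

@[simp] theorem runInv_nil : runInv ℓ [] x = x := rfl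

@[simp] theorem runInv_cons :
    runInv ℓ ((u, t) :: w) x = ℓ u 0 (-t) (runInv ℓ w x) := rfl

@[simp] theorem runInv_append : runInv ℓ (w ++ w') x = runInv ℓ w (runInv ℓ w' x) := by
  simp [runInv]

@[simp] theorem duration_nil : duration ([] : List (U × NNReal)) = 0 := rfl

@[simp] theorem duration_cons : duration ((u, t) :: w) = t + duration w := rfl

@[simp] theorem duration_append : duration (w ++ w') = duration w + duration w' := by
  simp [duration]

end RunLemmas

end Words

section Steering

variable {E U : Type*} [NormedAddCommGroup E] [NormedSpace ℝ E] [PseudoMetricSpace U]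

/-- A bounded Lipschitz control system `x' = F(x, u)` on `E` which leaves the set `K` invariant,
together with smooth perturbations `ℓ u ε` of its flows `ℓ u 0`. -/
structure SteeringSystem (F : E → U → E) (K : Set E) (ℓ : U → ℝ → ℝ → E → E) (b L : NNReal) :
    Prop where
  bound : ∀ x u, ‖F x u‖ ≤ b
  lipschitz : ∀ x x' u u', ‖F x u - F x' u'‖ ≤ L * (‖x - x'‖ + dist u u')
  contDiff_field : ∀ u, ContDiff ℝ 1 (fun x => F x u)
  contDiff : ∀ u, ContDiff ℝ ∞ (fun z : ℝ × ℝ × E => ℓ u z.1 z.2.1 z.2.2)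
  mem_iff : ∀ u ε t x, ℓ u ε t x ∈ K ↔ x ∈ K
  flow : ∀ u, IsFlow (fun x => F x u) (ℓ u 0)

namespace SteeringSystem

variable {F : E → U → E} {K : Set E} {ℓ : U → ℝ → ℝ → E → E} {b L : NNReal}

theorem lipschitzWith (h : SteeringSystem F K ℓ b L) (u : U) : LipschitzWith L (fun x => F x u) :=
  LipschitzWith.of_dist_le_mul fun x y => by simpa [dist_eq_norm] using h.lipschitz x y u u

theorem contDiff_flow (h : SteeringSystem F K ℓ b L) (u : U) :
    ContDiff ℝ ∞ (fun z : ℝ × E => ℓ u 0 z.1 z.2) :=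
  (h.contDiff u).comp (g := fun z : ℝ × ℝ × E => ℓ u z.1 z.2.1 z.2.2)
    (f := fun z : ℝ × E => ((0 : ℝ), z.1, z.2)) (by fun_prop)

theorem contDiff_run (h : SteeringSystem F K ℓ b L) (w : List (U × NNReal)) :
    ContDiff ℝ ∞ (fun z : ℝ × E => run ℓ z.1 w z.2) := by
  induction w with
  | nil => simpa using contDiff_snd
  | cons l w ih =>
    obtain ⟨u, t⟩ := l
    simp only [run_cons]
    refine ih.comp (g := fun z : ℝ × E => run ℓ z.1 w z.2)
      (f := fun z : ℝ × E => (z.1, ℓ u z.1 t z.2)) (contDiff_fst.prodMk ?_)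
    exact (h.contDiff u).comp (g := fun z : ℝ × ℝ × E => ℓ u z.1 z.2.1 z.2.2)
      (f := fun z : ℝ × E => (z.1, (t : ℝ), z.2)) (by fun_prop)

theorem contDiff_run_zero (h : SteeringSystem F K ℓ b L) (w : List (U × NNReal)) :
    ContDiff ℝ ∞ (run ℓ 0 w) :=
  (h.contDiff_run w).comp (g := fun z : ℝ × E => run ℓ z.1 w z.2)
    (f := fun x : E => ((0 : ℝ), x)) (by fun_prop)

theorem contDiff_runInv (h : SteeringSystem F K ℓ b L) (w : List (U × NNReal)) :
    ContDiff ℝ ∞ (runInv ℓ w) := by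
  induction w with
  | nil => exact contDiff_id
  | cons l w ih =>
    obtain ⟨u, t⟩ := l
    exact (h.contDiff_flow u).comp (g := fun z : ℝ × E => ℓ u 0 z.1 z.2)
      (f := fun x => (-(t : ℝ), runInv ℓ w x)) (contDiff_const.prodMk ih)

theorem run_mem_iff (h : SteeringSystem F K ℓ b L) (ε : ℝ) (w : List (U × NNReal)) (x : E) :
    run ℓ ε w x ∈ K ↔ x ∈ K := by
  induction w generalizing x with
  | nil => simp
  | cons l w ih => rw [← Prod.mk.eta (p := l), run_cons, ih, h.mem_iff]

theorem runInv_mem_iff (h : SteeringSystem F K ℓ b L) (w : List (U × NNReal)) (x : E) :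
    runInv ℓ w x ∈ K ↔ x ∈ K := by
  induction w with
  | nil => simp
  | cons l w ih => rw [← Prod.mk.eta (p := l), runInv_cons, h.mem_iff, ih]

/-- The constant depends on the word only through its duration, not its number of letters. This
keeps the errors under control when a trajectory is cut into more and more pieces. -/
theorem norm_run_sub_le (h : SteeringSystem F K ℓ b L) (w : List (U × NNReal)) (x y : E) :
    ‖run ℓ 0 w x - run ℓ 0 w y‖ ≤ Real.exp (L * duration w) * ‖x - y‖ := by
  induction w generalizing x y with
  | nil => simp
  | cons l w ih =>
    obtain ⟨u, t⟩ := l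
    rw [run_cons, run_cons, duration_cons]
    refine (ih _ _).trans ?_
    refine (mul_le_mul_of_nonneg_left ((h.flow u).norm_sub_le (h.lipschitzWith u) t x y)
      (Real.exp_nonneg _)).trans ?_
    rw [← mul_assoc, ← Real.exp_add, NNReal.abs_eq, mul_add, add_comm]

theorem norm_runInv_sub_le (h : SteeringSystem F K ℓ b L) (w : List (U × NNReal)) (x y : E) :
    ‖runInv ℓ w x - runInv ℓ w y‖ ≤ Real.exp (L * duration w) * ‖x - y‖ := by
  induction w generalizing x y with
  | nil => simp
  | cons l w ih =>
    obtain ⟨u, t⟩ := l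
    rw [runInv_cons, runInv_cons, duration_cons]
    refine ((h.flow u).norm_sub_le (h.lipschitzWith u) (-t) _ _).trans ?_
    refine (mul_le_mul_of_nonneg_left (ih x y) (Real.exp_nonneg _)).trans ?_
    rw [← mul_assoc, ← Real.exp_add, abs_neg, NNReal.abs_eq, mul_add]

theorem norm_fderiv_runInv_le (h : SteeringSystem F K ℓ b L) (w : List (U × NNReal)) (x : E) :
    ‖fderiv ℝ (runInv ℓ w) x‖ ≤ Real.exp (L * duration w) := by
  have : LipschitzWith ⟨Real.exp (L * duration w), Real.exp_nonneg _⟩ (runInv ℓ w) :=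
    LipschitzWith.of_dist_le_mul fun x y => by
      simpa [dist_eq_norm] using! h.norm_runInv_sub_le w x y
  exact norm_fderiv_le_of_lipschitz ℝ this

variable [FiniteDimensional ℝ E]

theorem runInv_run (h : SteeringSystem F K ℓ b L) (w : List (U × NNReal)) (x : E) :
    runInv ℓ w (run ℓ 0 w x) = x := by
  induction w generalizing x with
  | nil => simp
  | cons l w ih =>
    obtain ⟨u, t⟩ := l
    rw [run_cons, runInv_cons, ih, (h.flow u).neg_apply (h.contDiff_field u)]

theorem run_runInv (h : SteeringSystem F K ℓ b L) (w : List (U × NNReal)) (x : E) :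
    run ℓ 0 w (runInv ℓ w x) = x := by
  induction w generalizing x with
  | nil => simp
  | cons l w ih =>
    obtain ⟨u, t⟩ := l
    rw [run_cons, runInv_cons, (h.flow u).apply_neg (h.contDiff_field u), ih]

theorem fderiv_runInv_fderiv_run (h : SteeringSystem F K ℓ b L) (w : List (U × NNReal)) (x a : E) :
    fderiv ℝ (runInv ℓ w) (run ℓ 0 w x) (fderiv ℝ (run ℓ 0 w) x a) = a := by
  have h1 := ((h.contDiff_runInv w).differentiable (by simp) (run ℓ 0 w x)).hasFDerivAt.comp x
    ((h.contDiff_run_zero w).differentiable (by simp) x).hasFDerivAt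
  have h2 : runInv ℓ w ∘ run ℓ 0 w = id := funext fun x => h.runInv_run w x
  rw [h2] at h1
  simpa using congrArg (fun A : E →L[ℝ] E => A a) (h1.unique (hasFDerivAt_id x))

end SteeringSystem

end Steering

end ControlSystem

/-! ### Pulling trajectories back along words -/

namespace ControlSystem
open Filter Topology

namespace SteeringSystem

variable {E U : Type*} [NormedAddCommGroup E] [NormedSpace ℝ E] [FiniteDimensional ℝ E]
  [PseudoMetricSpace U] {F : E → U → E} {K : Set E} {ℓ : U → ℝ → ℝ → E → E} {b L : NNReal}

/-- Differentiating the backward flow in time produces the field at the image point. As a flow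
transports its field to itself (`IsFlow.fderiv_apply`), this term goes inside the spatial
derivative, and only the mismatch `X' - c F(X, u)` remains. -/
theorem hasDerivWithinAt_flow_neg (h : SteeringSystem F K ℓ b L) (u : U) (c : ℝ) {X : ℝ → E}
    {X' : E} {S : Set ℝ} {s : ℝ} (hX : HasDerivWithinAt X X' S s) :
    HasDerivWithinAt (fun s => ℓ u 0 (-(c * s)) (X s))
      (fderiv ℝ (ℓ u 0 (-(c * s))) (X s) (X' - c • F (X s) u)) S s := by
  have hΨ : HasFDerivAt (fun z : ℝ × E => ℓ u 0 z.1 z.2)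
      (fderiv ℝ (fun z : ℝ × E => ℓ u 0 z.1 z.2) (-(c * s), X s)) (-(c * s), X s) :=
    ((h.contDiff_flow u).differentiable (by simp) _).hasFDerivAt
  set D := fderiv ℝ (fun z : ℝ × E => ℓ u 0 z.1 z.2) (-(c * s), X s)
  have hcurve : HasDerivWithinAt (fun s => (-(c * s), X s)) (-c, X') S s := by
    refine HasDerivWithinAt.prodMk ?_ hX
    simpa using! ((hasDerivAt_id s).const_mul c).neg.hasDerivWithinAt
  have h1 := hΨ.comp_hasDerivWithinAt s hcurve
  have hx : HasFDerivAt (ℓ u 0 (-(c * s))) (D.comp (ContinuousLinearMap.inr ℝ ℝ E)) (X s) :=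
    hΨ.comp (X s) (hasFDerivAt_prodMk_right (-(c * s)) (X s))
  have ht : HasDerivAt (fun t => ℓ u 0 t (X s)) (D (1, 0)) (-(c * s)) := by
    exact hΨ.comp_hasDerivAt (f := fun t => (t, X s)) (-(c * s))
      ((hasDerivAt_id _).prodMk (hasDerivAt_const _ (X s)))
  have hF := ht.unique ((h.flow u).deriv (X s) (-(c * s)))
  have hpres := (h.flow u).fderiv_apply (h.contDiff_field u) hx.differentiableAt
  refine h1.congr_deriv ?_
  rw [map_sub, map_smul, hpres, ← hF, hx.fderiv]
  have : ((-c, X') : ℝ × E) = (0, X') - c • (1, 0) := by ext <;> simp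
  rw [this, map_sub, map_smul]
  simp

omit [NormedAddCommGroup E] [NormedSpace ℝ E] [FiniteDimensional ℝ E] [PseudoMetricSpace U] in
theorem runInv_append_eq (w : List (U × NNReal)) (u : U) (c : NNReal) {s : ℝ} (hs : 0 ≤ s) :
    runInv ℓ (w ++ [(u, c * s.toNNReal)]) = fun x => runInv ℓ w (ℓ u 0 (-(c * s)) x) := by
  funext x
  simp [hs]

omit [NormedAddCommGroup E] [NormedSpace ℝ E] [FiniteDimensional ℝ E] [PseudoMetricSpace U] in
theorem run_append_eq (w : List (U × NNReal)) (u : U) (c : NNReal) {s : ℝ} (hs : 0 ≤ s) :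
    run ℓ 0 (w ++ [(u, c * s.toNNReal)]) = fun x => ℓ u 0 (c * s) (run ℓ 0 w x) := by
  funext x
  simp [hs]

/-- The pullback of a trajectory by the flow of a word which is being prolonged. -/
theorem hasDerivWithinAt_pullback (h : SteeringSystem F K ℓ b L) (w : List (U × NNReal)) (u : U)
    (c : NNReal) {X : ℝ → E} {X' : E} {T s : ℝ} (hs : s ∈ Icc 0 T)
    (hX : HasDerivWithinAt X X' (Icc 0 T) s) :
    HasDerivWithinAt (fun s => runInv ℓ (w ++ [(u, c * s.toNNReal)]) (X s))
      (fderiv ℝ (runInv ℓ (w ++ [(u, c * s.toNNReal)])) (X s) (X' - c • F (X s) u))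
      (Icc 0 T) s := by
  have h1 := h.hasDerivWithinAt_flow_neg u c hX
  have hfl : DifferentiableAt ℝ (ℓ u 0 (-(c * s))) (X s) :=
    (((h.contDiff_flow u).differentiable (by simp)) (-(c * s), X s)).comp (X s)
      (hasFDerivAt_prodMk_right _ _).differentiableAt
  have hr := (h.contDiff_runInv w).differentiable (by simp) (ℓ u 0 (-(c * s)) (X s))
  have h2 := hr.hasFDerivAt.comp_hasDerivWithinAt s h1
  have hcomp : fderiv ℝ (runInv ℓ (w ++ [(u, c * s.toNNReal)])) (X s) =
      (fderiv ℝ (runInv ℓ w) (ℓ u 0 (-(c * s)) (X s))).comp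
        (fderiv ℝ (ℓ u 0 (-(c * s))) (X s)) := by
    rw [runInv_append_eq w u c hs.1]
    exact fderiv_comp (X s) hr hfl
  rw [hcomp]
  refine h2.congr (fun r hr => ?_) ?_
  · rw [runInv_append_eq w u c hr.1]; rfl
  · rw [runInv_append_eq w u c hs.1]; rfl

/-- The velocity of the pulled back curve is the mismatch `δ` amplified at most by the exponential
of `L` times the duration. -/
theorem norm_pullback_sub_le (h : SteeringSystem F K ℓ b L) (w : List (U × NNReal)) (u : U)
    (c : NNReal) {X : ℝ → E} {y : ℝ → U} {T δ : ℝ}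
    (hX : ∀ s ∈ Icc 0 T, HasDerivWithinAt X (F (X s) (y s)) (Icc 0 T) s)
    (hδ : ∀ s ∈ Icc 0 T, ‖F (X s) (y s) - (c : ℝ) • F (X s) u‖ ≤ δ) {s : ℝ} (hs : s ∈ Icc 0 T) :
    ‖runInv ℓ (w ++ [(u, c * s.toNNReal)]) (X s) - runInv ℓ w (X 0)‖ ≤
      Real.exp (L * (duration w + c * T)) * δ * s := by
  have h0 : runInv ℓ w (X 0) = runInv ℓ (w ++ [(u, c * (0 : ℝ).toNNReal)]) (X 0) := by
    simp [(h.flow u).zero]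
  rw [h0]
  have hb : ∀ r ∈ Ico 0 T, ‖fderiv ℝ (runInv ℓ (w ++ [(u, c * r.toNNReal)])) (X r)
      (F (X r) (y r) - (c : ℝ) • F (X r) u)‖ ≤ Real.exp (L * (duration w + c * T)) * δ := by
    intro r hr
    have hr' := Ico_subset_Icc_self hr
    refine (ContinuousLinearMap.le_opNorm _ _).trans ?_
    refine mul_le_mul ((h.norm_fderiv_runInv_le _ _).trans ?_) (hδ r hr') (norm_nonneg _)
      (Real.exp_nonneg _)
    gcongr
    simp only [duration_append, duration_cons, duration_nil, NNReal.coe_mul, add_zero,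
      Real.coe_toNNReal _ hr.1]
    gcongr
    exact hr.2.le
  have := norm_image_sub_le_of_norm_deriv_le_segment' (a := 0) (b := T)
    (fun r hr => h.hasDerivWithinAt_pullback w u c hr (hX r hr)) hb s hs
  simpa using this

/-- The pullback of a trajectory stays on the graph of `H` as long as it stays over `O`, provided
the pulled back fields are tangent to that graph. -/
theorem pullback_eq_graph (h : SteeringSystem F K ℓ b L) {W : Type*} [NormedAddCommGroup W]
    [NormedSpace ℝ W] {π : E →L[ℝ] W} {H : W → E} {O : Set W} {cH : ℝ}
    (hH : ∀ v ∈ O, DifferentiableAt ℝ H v) (hcH : ∀ v ∈ O, ‖fderiv ℝ H v‖ ≤ cH)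
    (hπ : ∀ v ∈ O, ∀ a, π (fderiv ℝ H v a) = a)
    (htan : ∀ v ∈ O, ∀ (w : List (U × NNReal)) (u : U), ∃ a,
      F (run ℓ 0 w (H v)) u = fderiv ℝ (run ℓ 0 w) (H v) (fderiv ℝ H v a))
    (w : List (U × NNReal)) (u : U) (c : NNReal) {X : ℝ → E} {y : ℝ → U} {T : ℝ}
    (hX : ∀ s ∈ Icc 0 T, HasDerivWithinAt X (F (X s) (y s)) (Icc 0 T) s)
    (hO : ∀ s ∈ Icc 0 T, π (runInv ℓ (w ++ [(u, c * s.toNNReal)]) (X s)) ∈ O)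
    (h0 : runInv ℓ w (X 0) = H (π (runInv ℓ w (X 0)))) :
    ∀ s ∈ Icc 0 T, runInv ℓ (w ++ [(u, c * s.toNNReal)]) (X s) =
      H (π (runInv ℓ (w ++ [(u, c * s.toNNReal)]) (X s))) := by
  set ξ : ℝ → E := fun s => runInv ℓ (w ++ [(u, c * s.toNNReal)]) (X s) with hξdef
  set g : ℝ → E → E := fun s x => fderiv ℝ (runInv ℓ (w ++ [(u, c * s.toNNReal)]))
    (run ℓ 0 (w ++ [(u, c * s.toNNReal)]) x)
      (F (run ℓ 0 (w ++ [(u, c * s.toNNReal)]) x) (y s) -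
        (c : ℝ) • F (run ℓ 0 (w ++ [(u, c * s.toNNReal)]) x) u) with hgdef
  have hξ : ∀ s ∈ Icc 0 T, HasDerivWithinAt ξ (g s (ξ s)) (Icc 0 T) s := by
    intro s hs
    have := h.hasDerivWithinAt_pullback w u c hs (hX s hs)
    simp only [hgdef, hξdef, h.run_runInv]
    exact this
  have hξc : ContinuousOn ξ (Icc 0 T) := fun s hs => (hξ s hs).continuousWithinAt
  have hζc : ContinuousOn (fun s => H (π (ξ s))) (Icc 0 T) := fun s hs =>
    (hH _ (hO s hs)).continuousAt.comp_continuousWithinAt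
      (f := fun s => π (ξ s)) (π.continuous.comp_continuousOn hξc s hs)
  obtain ⟨r₁, hr₁⟩ := isCompact_Icc.exists_bound_of_continuousOn hξc
  obtain ⟨r₂, hr₂⟩ := isCompact_Icc.exists_bound_of_continuousOn hζc
  -- The pulled back field must be Lipschitz in the space variable, uniformly in `s`. Its
  -- ingredients (forward flow, derivative of the backward flow) are smooth in `(s, x)`, hence
  -- Lipschitz and bounded on a compact convex set containing both `ξ` and its projection to the
  -- graph. The Lipschitz bound on `F` is uniform in the control, so `y` need not be continuous.
  have hB : ContDiff ℝ ∞ fun z : ℝ × E => ℓ u 0 (c * z.1) (run ℓ 0 w z.2) :=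
    (h.contDiff_flow u).comp (g := fun z : ℝ × E => ℓ u 0 z.1 z.2)
      (f := fun z : ℝ × E => ((c : ℝ) * z.1, run ℓ 0 w z.2))
      ((contDiff_const.mul contDiff_fst).prodMk ((h.contDiff_run_zero w).comp contDiff_snd))
  have hN : ContDiff ℝ ∞ fun z : (ℝ × E) × E => runInv ℓ w (ℓ u 0 (-(c * z.1.1)) z.2) := by
    refine (h.contDiff_runInv w).comp ((h.contDiff_flow u).comp (g := fun z : ℝ × E => ℓ u 0 z.1 z.2)
      (f := fun z : (ℝ × E) × E => (-((c : ℝ) * z.1.1), z.2)) ?_)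
    exact ((contDiff_const.mul (contDiff_fst.comp contDiff_fst)).neg).prodMk contDiff_snd
  have hΦ : ContDiff ℝ 1 fun z : ℝ × E => fderiv ℝ (fun x => runInv ℓ w (ℓ u 0 (-(c * z.1)) x))
      (ℓ u 0 (c * z.1) (run ℓ 0 w z.2)) :=
    (ContDiff.fderiv (m := ∞) (n := ∞)
      (f := fun (z : ℝ × E) x => runInv ℓ w (ℓ u 0 (-(c * z.1)) x)) hN hB (by simp)).of_le
      (by exact_mod_cast le_top)
  set S : Set (ℝ × E) := Icc 0 T ×ˢ Metric.closedBall 0 (max r₁ r₂)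
  have hSc : IsCompact S := isCompact_Icc.prod (isCompact_closedBall _ _)
  have hSv : Convex ℝ S := (convex_Icc _ _).prod (convex_closedBall _ _)
  obtain ⟨kB, hkB⟩ := (hB.contDiffOn (s := S)).exists_lipschitzOnWith (by simp) hSv hSc
  obtain ⟨kΦ, hkΦ⟩ := (hΦ.contDiffOn (s := S)).exists_lipschitzOnWith one_ne_zero hSv hSc
  obtain ⟨m, hm⟩ := hSc.exists_bound_of_continuousOn hΦ.continuous.continuousOn
  refine eq_graph_of_tangent (ξ := ξ) (g := g) (k := kΦ * (b + c * b) + m * ((L + c * L) * kB)) hH hcH hπ hξ hO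
    ?_ ?_ ?_
  · intro s hs
    have hz₁ : (s, ξ s) ∈ S := ⟨hs, by simpa using Or.inl (hr₁ s hs)⟩
    have hz₂ : (s, H (π (ξ s))) ∈ S := ⟨hs, by simpa using Or.inr (hr₂ s hs)⟩
    have hd : dist (s, ξ s) (s, H (π (ξ s))) = ‖ξ s - H (π (ξ s))‖ := by
      rw [Prod.dist_eq]; simp [dist_eq_norm]
    have e1 := hkB.dist_le_mul _ hz₁ _ hz₂
    have e2 := hkΦ.dist_le_mul _ hz₁ _ hz₂
    have e3 := hm _ hz₂
    rw [hd, dist_eq_norm] at e1 e2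
    have hg : ∀ x, g s x = fderiv ℝ (fun x => runInv ℓ w (ℓ u 0 (-(c * s)) x))
        (ℓ u 0 (c * s) (run ℓ 0 w x)) (F (ℓ u 0 (c * s) (run ℓ 0 w x)) (y s) -
          (c : ℝ) • F (ℓ u 0 (c * s) (run ℓ 0 w x)) u) := fun x => by
      simp only [hgdef, runInv_append_eq w u c hs.1, run_append_eq w u c hs.1]
    rw [hg, hg]
    simp only at e1 e2 e3
    clear_value ξ g
    set B₁ := ℓ u 0 (c * s) (run ℓ 0 w (ξ s))
    set B₂ := ℓ u 0 (c * s) (run ℓ 0 w (H (π (ξ s))))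
    set A₁ := fderiv ℝ (fun x => runInv ℓ w (ℓ u 0 (-(c * s)) x)) B₁
    set A₂ := fderiv ℝ (fun x => runInv ℓ w (ℓ u 0 (-(c * s)) x)) B₂
    set d := ‖ξ s - H (π (ξ s))‖
    have f1 : ‖F B₁ (y s) - (c : ℝ) • F B₁ u‖ ≤ b + c * b := by
      refine (_root_.norm_sub_le _ _).trans (add_le_add (h.bound _ _) ?_)
      rw [norm_smul, NNReal.norm_eq]
      gcongr
      exact h.bound _ _
    have f2 : ‖(F B₁ (y s) - (c : ℝ) • F B₁ u) - (F B₂ (y s) - (c : ℝ) • F B₂ u)‖ ≤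
        (L + c * L) * (kB * d) := by
      have g1 := h.lipschitz B₁ B₂ (y s) (y s)
      have g2 := h.lipschitz B₁ B₂ u u
      rw [dist_self, add_zero] at g1 g2
      have : (F B₁ (y s) - (c : ℝ) • F B₁ u) - (F B₂ (y s) - (c : ℝ) • F B₂ u) =
          (F B₁ (y s) - F B₂ (y s)) - (c : ℝ) • (F B₁ u - F B₂ u) := by
        rw [smul_sub]; abel
      rw [this]
      calc _ ≤ ‖F B₁ (y s) - F B₂ (y s)‖ + ‖(c : ℝ) • (F B₁ u - F B₂ u)‖ := _root_.norm_sub_le _ _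
        _ ≤ L * ‖B₁ - B₂‖ + c * (L * ‖B₁ - B₂‖) := by
          rw [norm_smul, NNReal.norm_eq]
          gcongr
        _ = (L + c * L) * ‖B₁ - B₂‖ := by ring
        _ ≤ _ := by gcongr
    have : A₁ (F B₁ (y s) - (c : ℝ) • F B₁ u) - A₂ (F B₂ (y s) - (c : ℝ) • F B₂ u) =
        (A₁ - A₂) (F B₁ (y s) - (c : ℝ) • F B₁ u) +
          A₂ ((F B₁ (y s) - (c : ℝ) • F B₁ u) - (F B₂ (y s) - (c : ℝ) • F B₂ u)) := by
      rw [map_sub A₂ (F B₁ (y s) - (c : ℝ) • F B₁ u), sub_apply]; abel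
    rw [this]
    calc _ ≤ ‖(A₁ - A₂) (F B₁ (y s) - (c : ℝ) • F B₁ u)‖ +
          ‖A₂ ((F B₁ (y s) - (c : ℝ) • F B₁ u) - (F B₂ (y s) - (c : ℝ) • F B₂ u))‖ :=
        norm_add_le _ _
      _ ≤ (kΦ * d) * (b + c * b) + m * ((L + c * L) * (kB * d)) := by
        gcongr
        · exact ((A₁ - A₂).le_opNorm _).trans (by gcongr)
        · exact (A₂.le_opNorm _).trans
            (mul_le_mul e3 f2 (norm_nonneg _) ((norm_nonneg _).trans e3))
      _ = _ := by ring
  · intro s hs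
    -- Tangency is used for the prolonged word, once for the control of the trajectory and once for
    -- the letter.
    obtain ⟨a₁, ha₁⟩ := htan _ (hO s hs) (w ++ [(u, c * s.toNNReal)]) (y s)
    obtain ⟨a₂, ha₂⟩ := htan _ (hO s hs) (w ++ [(u, c * s.toNNReal)]) u
    refine ⟨a₁ - (c : ℝ) • a₂, ?_⟩
    simp only [hgdef]
    rw [ha₁, ha₂, map_sub, map_smul, h.fderiv_runInv_fderiv_run, h.fderiv_runInv_fderiv_run,
      map_sub, map_smul]
  · simpa [hξdef, (h.flow u).zero] using h0

end SteeringSystem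

end ControlSystem

/-! ### Approximating continuous controls by words -/

namespace ControlSystem
open Filter Topology

/-- `q` is the endpoint of a trajectory of `x' = F(x, y)` which starts at `p`, for some
continuous control `y`. -/
def ContinuousSteer {E U : Type*} [NormedAddCommGroup E] [NormedSpace ℝ E] [TopologicalSpace U]
    (F : E → U → E) (p q : E) : Prop :=
  ∃ (T : ℝ) (y : ℝ → U) (X : ℝ → E), 0 ≤ T ∧ ContinuousOn y (Icc 0 T) ∧
    (∀ s ∈ Icc 0 T, HasDerivWithinAt X (F (X s) (y s)) (Icc 0 T) s) ∧ X 0 = p ∧ X T = q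

theorem hasDerivWithinAt_comp_const_add {E : Type*} [NormedAddCommGroup E] [NormedSpace ℝ E]
    {X : ℝ → E} {X' : E} {a r T s : ℝ} (ha : 0 ≤ a) (har : a + r ≤ T)
    (hX : HasDerivWithinAt X X' (Icc 0 T) (a + s)) :
    HasDerivWithinAt (fun s => X (a + s)) X' (Icc 0 r) s := by
  have h1 : HasDerivWithinAt (fun s => a + s) 1 (Icc 0 r) s :=
    ((hasDerivAt_id s).const_add a).hasDerivWithinAt
  have := hX.scomp s h1 fun x hx => ⟨by linarith [hx.1], by linarith [hx.2]⟩
  simpa using! this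

namespace SteeringSystem

variable {E U : Type*} [NormedAddCommGroup E] [NormedSpace ℝ E] [FiniteDimensional ℝ E]
  [PseudoMetricSpace U] {F : E → U → E} {K : Set E} {ℓ : U → ℝ → ℝ → E → E} {b L : NNReal}

/-- The point `q` can be pulled back as close as desired to `z` by words in the letters `Λ` of
uniformly bounded duration, with pulled back points satisfying `good`. -/
def Tracked (ℓ : U → ℝ → ℝ → E → E) (Λ : Set (U × NNReal)) (good : E → Prop) (z q : E) : Prop :=
  ∃ T : ℝ, ∀ η > 0, ∃ w : List (U × NNReal), (∀ l ∈ w, l ∈ Λ) ∧ duration w ≤ T ∧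
    good (runInv ℓ w q) ∧ ‖runInv ℓ w q - z‖ ≤ η

/-- Pulling back along trajectories preserves `good` as long as one stays near `z`. -/
def StableNear (F : E → U → E) (ℓ : U → ℝ → ℝ → E → E) (good : E → Prop) (z : E) (ρ : ℝ) : Prop :=
  ∀ (w : List (U × NNReal)) (u : U) (c : NNReal) (X : ℝ → E) (y : ℝ → U) (T : ℝ), 0 ≤ T →
    (∀ s ∈ Icc 0 T, HasDerivWithinAt X (F (X s) (y s)) (Icc 0 T) s) →
    (∀ s ∈ Icc 0 T, ‖runInv ℓ (w ++ [(u, c * s.toNNReal)]) (X s) - z‖ < ρ) →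
    good (runInv ℓ w (X 0)) → good (runInv ℓ (w ++ [(u, c * T.toNNReal)]) (X T))

/-- Cut the trajectory into short pieces and replace the control on each by one letter of `Λ`. The
pulled back endpoint then drifts at a speed proportional to the mismatch of the fields, so the total
drift is small and independent of the number of pieces. The dense set `Λ` suffices because both
control and duration of a letter may be slightly wrong. -/
theorem Tracked.step (h : SteeringSystem F K ℓ b L) {Λ : Set (U × NNReal)} (hΛ : Dense Λ)
    {good : E → Prop} {z : E} {ρ : ℝ} (hρ : 0 < ρ) (hgood : StableNear F ℓ good z ρ)
    {p q : E} (hp : Tracked ℓ Λ good z p) (hpq : ContinuousSteer F p q) :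
    Tracked ℓ Λ good z q := by
  obtain ⟨T, y, X, hT, hy, hX, rfl, rfl⟩ := hpq
  obtain rfl | hT := hT.eq_or_lt
  · exact hp
  obtain ⟨T₀, hT₀⟩ := hp
  refine ⟨T₀ + T + 1, fun η hη => ?_⟩
  -- One `η'` is spent on the initial error and one on the drift; `2 * η' < ρ` keeps the pulled back
  -- curve where `hgood` applies.
  obtain ⟨η', hη', hη₁, hη₂⟩ : ∃ η' > 0, 2 * η' ≤ η ∧ 2 * η' < ρ :=
    ⟨min (η / 2) (ρ / 3), by positivity, by linarith [min_le_left (η / 2) (ρ / 3)],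
      by linarith [min_le_right (η / 2) (ρ / 3)]⟩
  set M := Real.exp (L * (T₀ + T + 1)) with hM
  have hM0 : 0 < M := Real.exp_pos _
  obtain ⟨δ, hδ0, hδ⟩ : ∃ δ > 0, M * δ * T = η' := ⟨η' / (M * T), by positivity, by field_simp⟩
  -- `δ'` bounds the oscillation of the control on a piece, the error of the letter's control and
  -- the relative error of its duration. The condition `δ' * T ≤ 1` pays for the `+ 1` in the bound
  -- on the duration.
  obtain ⟨δ', hδ'0, hδ'T, hδ'δ⟩ : ∃ δ' > 0, δ' * T ≤ 1 ∧ L * (2 * δ') + δ' * b ≤ δ := by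
    refine ⟨min (1 / T) (δ / (2 * L + b + 1)), by positivity, ?_, ?_⟩
    · calc _ ≤ 1 / T * T := by gcongr; exact min_le_left _ _
        _ = 1 := by field_simp
    · calc _ = min (1 / T) (δ / (2 * L + b + 1)) * (2 * L + b) := by ring
        _ ≤ (δ / (2 * L + b + 1)) * (2 * L + b + 1) := by
          exact mul_le_mul (min_le_right _ _) (by linarith) (by positivity) (by positivity)
        _ = δ := by field_simp
  obtain ⟨μ, hμ0, hμ⟩ := Metric.uniformContinuousOn_iff.1
    (isCompact_Icc.uniformContinuousOn_of_continuous hy) δ' hδ'0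
  obtain ⟨N, hN⟩ := exists_nat_gt (T / μ)
  have hN0 : (0 : ℝ) < N := lt_of_le_of_lt (by positivity) hN
  set r := T / N with hr
  have hr0 : 0 < r := by positivity
  have hrμ : r < μ := by rw [hr, div_lt_iff₀ hN0, mul_comm]; rwa [div_lt_iff₀ hμ0] at hN
  have hNr : N * r = T := by rw [hr]; field_simp
  have key : ∀ i : ℕ, i ≤ N → ∃ w : List (U × NNReal), (∀ l ∈ w, l ∈ Λ) ∧
      duration w ≤ T₀ + i * (r * (1 + δ')) ∧ good (runInv ℓ w (X (i * r))) ∧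
      ‖runInv ℓ w (X (i * r)) - z‖ ≤ η' + i * (M * δ * r) := by
    intro i
    induction i with
    | zero =>
      intro _
      obtain ⟨w, hw, hd, hg, hn⟩ := hT₀ η' hη'
      exact ⟨w, hw, by simpa using hd, by simpa using hg, by simpa using hn⟩
    | succ i ih =>
      intro hi
      obtain ⟨w, hw, hd, hg, hn⟩ := ih (by omega)
      have hiN : ((i : ℝ) + 1) ≤ N := by exact_mod_cast hi
      have hir : i * r + r ≤ T := by
        rw [← hNr]; nlinarith
      have hi0 : 0 ≤ i * r := by positivity
      have hirT : ∀ s ∈ Icc 0 r, i * r + s ∈ Icc 0 T := fun s hs =>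
        ⟨by linarith [hs.1], by linarith [hs.2]⟩
      obtain ⟨⟨u, τ⟩, hl, hlΛ⟩ := hΛ.exists_dist_lt (y (i * r), r.toNNReal)
        (lt_min hδ'0 (mul_pos hδ'0 hr0))
      rw [Prod.dist_eq, max_lt_iff] at hlΛ
      obtain ⟨hu, hτ⟩ := hlΛ
      replace hu := hu.trans_le (min_le_left _ _)
      replace hτ := hτ.trans_le (min_le_right _ _)
      simp only at hu hτ
      rw [NNReal.dist_eq, Real.coe_toNNReal _ hr0.le] at hτ
      -- The letter lasts `τ` instead of `r`. Running it at speed `c` during the piece makes the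
      -- prolongation end exactly at the letter `(u, τ)`.
      set c : NNReal := τ / r.toNNReal with hc
      have hcr : (c : ℝ) * r = τ := by
        rw [hc, NNReal.coe_div, Real.coe_toNNReal _ hr0.le]; field_simp
      have hcr' : c * r.toNNReal = τ := by
        rw [← NNReal.coe_inj, NNReal.coe_mul, Real.coe_toNNReal _ hr0.le, hcr]
      have hc1 : |1 - (c : ℝ)| ≤ δ' := by
        have : (1 - (c : ℝ)) * r = r - τ := by rw [sub_mul, hcr, one_mul]
        have h2 : |1 - (c : ℝ)| * r ≤ δ' * r := by
          rw [← abs_of_pos hr0, ← abs_mul, abs_of_pos hr0, this]; exact hτ.le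
        exact le_of_mul_le_mul_right h2 hr0
      have hτ' : (τ : ℝ) ≤ r * (1 + δ') := by linarith [(abs_lt.1 hτ).1]
      have hX' : ∀ s ∈ Icc 0 r, HasDerivWithinAt (fun s => X (i * r + s))
          (F (X (i * r + s)) (y (i * r + s))) (Icc 0 r) s := fun s hs =>
        hasDerivWithinAt_comp_const_add hi0 hir (hX _ (hirT s hs))
      have hsmall : ∀ s ∈ Icc 0 r,
          ‖F (X (i * r + s)) (y (i * r + s)) - (c : ℝ) • F (X (i * r + s)) u‖ ≤ δ := by
        intro s hs
        have hds : dist (y (i * r + s)) u ≤ 2 * δ' := by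
          have h1 := hμ (i * r + s) (hirT s hs) (i * r) (by simpa using hirT 0 ⟨le_rfl, hr0.le⟩)
            (by rw [Real.dist_eq, add_sub_cancel_left, abs_of_nonneg hs.1]
                exact hs.2.trans_lt hrμ)
          linarith [dist_triangle (y (i * r + s)) (y (i * r)) u]
        have h2 := h.lipschitz (X (i * r + s)) (X (i * r + s)) (y (i * r + s)) u
        rw [sub_self, norm_zero, zero_add] at h2
        have h3 : F (X (i * r + s)) (y (i * r + s)) - (c : ℝ) • F (X (i * r + s)) u =
            (F (X (i * r + s)) (y (i * r + s)) - F (X (i * r + s)) u) +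
              (1 - (c : ℝ)) • F (X (i * r + s)) u := by
          rw [sub_smul, one_smul]; abel
        rw [h3]
        refine (norm_add_le _ _).trans (le_trans (add_le_add (h2.trans ?_) ?_) hδ'δ)
        · gcongr
        · rw [norm_smul]
          exact mul_le_mul hc1 (h.bound _ _) (norm_nonneg _) hδ'0.le
      have hdur : duration w + c * r ≤ T₀ + T + 1 := by
        have : (i + 1) * (r * (1 + δ')) ≤ N * (r * (1 + δ')) := by gcongr
        rw [hcr]
        nlinarith
      have hdist : ∀ s ∈ Icc 0 r, ‖runInv ℓ (w ++ [(u, c * s.toNNReal)]) (X (i * r + s)) - z‖ ≤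
          η' + (i + 1) * (M * δ * r) := by
        intro s hs
        have h1 := h.norm_pullback_sub_le w u c hX' hsmall hs
        have h2 : Real.exp (L * (duration w + c * r)) * δ * s ≤ M * δ * r := by
          have hE : Real.exp (L * (duration w + c * r)) ≤ M := by rw [hM]; gcongr
          exact mul_le_mul (mul_le_mul_of_nonneg_right hE hδ0.le) hs.2 hs.1 (by positivity)
        simp only [add_zero] at h1
        calc _ ≤ ‖runInv ℓ (w ++ [(u, c * s.toNNReal)]) (X (i * r + s)) - runInv ℓ w (X (i * r))‖ +
              ‖runInv ℓ w (X (i * r)) - z‖ := norm_sub_le_norm_sub_add_norm_sub _ _ _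
          _ ≤ M * δ * r + (η' + i * (M * δ * r)) := add_le_add (h1.trans h2) hn
          _ = _ := by ring
      have htot : η' + (i + 1) * (M * δ * r) ≤ 2 * η' := by
        have : (i + 1) * (M * δ * r) ≤ N * (M * δ * r) := by gcongr
        have h2 : N * (M * δ * r) = η' := by rw [← hδ, ← hNr]; ring
        linarith
      have hcast : ((i + 1 : ℕ) : ℝ) * r = i * r + r := by push_cast; ring
      refine ⟨w ++ [(u, τ)], ?_, ?_, ?_, ?_⟩
      · intro l hl'
        rcases List.mem_append.1 hl' with hl' | hl'
        · exact hw l hl'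
        · rw [List.mem_singleton.1 hl']; exact hl
      · rw [duration_append, duration_cons, duration_nil]
        push_cast
        nlinarith
      · rw [hcast, ← hcr']
        exact hgood w u c _ _ r hr0.le hX' (fun s hs => (hdist s hs).trans_lt (by linarith))
          (by simpa using hg)
      · rw [hcast, ← hcr']
        push_cast
        exact hdist r ⟨hr0.le, le_rfl⟩
  obtain ⟨w, hw, hd, hg, hn⟩ := key N le_rfl
  rw [hNr] at hg hn
  refine ⟨w, hw, hd.trans ?_, hg, hn.trans ?_⟩
  · nlinarith
  · have : N * (M * δ * r) = η' := by rw [← hδ, ← hNr]; ring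
    linarith

theorem Tracked.of_chain (h : SteeringSystem F K ℓ b L) {Λ : Set (U × NNReal)} (hΛ : Dense Λ)
    {good : E → Prop} {z : E} {ρ : ℝ} (hρ : 0 < ρ) (hgood : StableNear F ℓ good z ρ) (hz : good z)
    {q : E} (hzq : Relation.ReflTransGen (ContinuousSteer F) z q) : Tracked ℓ Λ good z q := by
  induction hzq with
  | refl => exact ⟨0, fun η hη => ⟨[], by simp, by simp, by simpa using hz, by simpa using hη.le⟩⟩
  | tail _ hst ih => exact ih.step h hΛ hρ hgood hst

/-- Points reachable with continuous controls are reachable from nearby points by words. -/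
theorem exists_run_of_chain (h : SteeringSystem F K ℓ b L) {p q : E}
    (hpq : Relation.ReflTransGen (ContinuousSteer F) p q) :
    ∃ T : ℝ, ∀ η > 0, ∃ w : List (U × NNReal), duration w ≤ T ∧ ‖runInv ℓ w q - p‖ ≤ η := by
  obtain ⟨T, hT⟩ := Tracked.of_chain h dense_univ (good := fun _ => True) one_pos
    (fun _ _ _ _ _ _ _ _ _ _ => trivial) trivial hpq
  exact ⟨T, fun η hη => (hT η hη).imp fun w hw => ⟨hw.2.1, hw.2.2.2⟩⟩

/-- Points reachable with continuous controls are approximately reachable by words. -/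
theorem exists_norm_run_sub_le_of_chain (h : SteeringSystem F K ℓ b L) {p q : E}
    (hpq : Relation.ReflTransGen (ContinuousSteer F) p q) {η : ℝ} (hη : 0 < η) :
    ∃ w : List (U × NNReal), ‖run ℓ 0 w p - q‖ ≤ η := by
  obtain ⟨T, hT⟩ := h.exists_run_of_chain hpq
  obtain ⟨w, hd, hw⟩ := hT (η / Real.exp (L * T)) (by positivity)
  refine ⟨w, ?_⟩
  have h1 := h.norm_run_sub_le w p (runInv ℓ w q)
  rw [h.run_runInv, norm_sub_rev p] at h1
  refine h1.trans ?_
  calc _ ≤ Real.exp (L * T) * (η / Real.exp (L * T)) := by gcongr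
    _ = η := by field_simp

end SteeringSystem

end ControlSystem

/-! ### Immersed discs of reachable points -/

namespace ControlSystem
open Filter Topology

section Immersion

variable {T E : Type*} [NormedAddCommGroup T] [NormedSpace ℝ T] [FiniteDimensional ℝ T]
  [NormedAddCommGroup E] [NormedSpace ℝ E] [FiniteDimensional ℝ E]

/-- Near `γ a`, the image of an immersion `γ` at `a` is the graph of `γ ∘ j` over a linear
projection `π`. -/
theorem exists_graph_of_immersion {γ : T → E} {a : T} {n : WithTop ℕ∞} (hn : n ≠ 0)
    (hγ : ContDiffAt ℝ n γ a) (hinj : Function.Injective (fderiv ℝ γ a)) :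
    ∃ (π : E →L[ℝ] T) (j : T → T), ContDiffAt ℝ n j (π (γ a)) ∧ j (π (γ a)) = a ∧
      (∀ᶠ τ in 𝓝 a, j (π (γ τ)) = τ) ∧ (∀ᶠ v in 𝓝 (π (γ a)), π (γ (j v)) = v) ∧
      ((∀ᶠ τ in 𝓝 a, ContDiffAt ℝ n γ τ) → ∀ᶠ v in 𝓝 (π (γ a)), ContDiffAt ℝ n j v) := by
  have := FiniteDimensional.complete ℝ T
  -- A linear left inverse of the derivative makes the derivative of `π ∘ γ` at `a` the identity, so
  -- `j` can be its local inverse.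
  obtain ⟨π₀, hπ₀⟩ := LinearMap.exists_leftInverse_of_injective (fderiv ℝ γ a : T →ₗ[ℝ] E)
    (LinearMap.ker_eq_bot.2 hinj)
  set π : E →L[ℝ] T := LinearMap.toContinuousLinearMap π₀
  have hπγ : ContDiffAt ℝ n (fun τ => π (γ τ)) a := π.contDiff.contDiffAt.comp a hγ
  have hd : HasFDerivAt (fun τ => π (γ τ))
      ((ContinuousLinearEquiv.refl ℝ T : T ≃L[ℝ] T) : T →L[ℝ] T) a := by
    refine (π.hasFDerivAt.comp a (hγ.differentiableAt hn).hasFDerivAt).congr_fderiv ?_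
    ext x
    exact congrArg (fun A : T →ₗ[ℝ] T => A x) hπ₀
  have hs : HasStrictFDerivAt (fun τ => π (γ τ))
      ((ContinuousLinearEquiv.refl ℝ T : T ≃L[ℝ] T) : T →L[ℝ] T) a :=
    hπγ.hasStrictFDerivAt' hd hn
  refine ⟨π, hπγ.localInverse hd hn, hπγ.to_localInverse hd hn, hs.localInverse_apply_image,
    hs.eventually_left_inverse, hs.eventually_right_inverse, fun hev => ?_⟩
  -- For `n = ∞`, regularity at a point gives no common neighbourhood for all finite orders, so
  -- regularity of `γ` near `a` is a hypothesis of this clause. Invertibility of the derivative is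
  -- open, hence the inverse function theorem applies at nearby points too.
  have h1 : ∀ᶠ τ in 𝓝 a, fderiv ℝ (fun τ => π (γ τ)) τ ∈ range ((↑) : (T ≃L[ℝ] T) → T →L[ℝ] T) :=
    ((hπγ.of_le (ENat.one_le_iff_ne_zero_withTop.2 hn)).continuousAt_fderiv one_ne_zero).eventually
      (by rw [hd.fderiv]; exact ContinuousLinearEquiv.nhds _)
  have hj : Tendsto (hπγ.localInverse hd hn) (𝓝 (π (γ a))) (𝓝 a) := by
    have := (hπγ.to_localInverse hd hn).continuousAt.tendsto
    rwa [hπγ.localInverse_apply_image hd hn] at this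
  filter_upwards [hj.eventually h1, hj.eventually hev,
    (hπγ.toOpenPartialHomeomorph _ hd hn).open_target.mem_nhds
      (ContDiffAt.image_mem_toOpenPartialHomeomorph_target hπγ hd hn)] with v ⟨e, he⟩ h2 h3
  have h4 : ContDiffAt ℝ n (fun τ => π (γ τ)) (hπγ.localInverse hd hn v) :=
    π.contDiff.contDiffAt.comp _ h2
  refine (hπγ.toOpenPartialHomeomorph _ hd hn).contDiffAt_symm (f₀' := e) h3 ?_ h4
  rw [he]
  exact (h4.differentiableAt hn).hasFDerivAt

-- With differentiability, invariance of dimension is the chain rule: `c ∘ a = id` makes the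
-- derivative of `a` injective.
omit [FiniteDimensional ℝ T] [FiniteDimensional ℝ E] in
theorem finrank_le_of_eventually_leftInverse {a : E → T} {c : T → E} {v : E}
    [FiniteDimensional ℝ T]
    (ha : DifferentiableAt ℝ a v) (hc : DifferentiableAt ℝ c (a v)) (h : ∀ᶠ x in 𝓝 v, c (a x) = x) :
    Module.finrank ℝ E ≤ Module.finrank ℝ T := by
  have h1 : (fderiv ℝ c (a v)).comp (fderiv ℝ a v) = ContinuousLinearMap.id ℝ E :=
    (hc.hasFDerivAt.comp v ha.hasFDerivAt).unique
      ((hasFDerivAt_id v).congr_of_eventuallyEq h)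
  refine LinearMap.finrank_le_finrank_of_injective (f := (fderiv ℝ a v : E →ₗ[ℝ] T)) ?_
  intro x y hxy
  have := congrArg (fderiv ℝ c (a v)) hxy
  have e : ∀ x, fderiv ℝ c (a v) (fderiv ℝ a v x) = x := fun x =>
    congrArg (fun A : E →L[ℝ] E => A x) h1
  simpa [e] using this

end Immersion

section Discs

variable {E U : Type*} [NormedAddCommGroup E] [NormedSpace ℝ E]

/-- `x'` is the endpoint of a word starting at `x`, at parameter `ε`. -/
def Steers (ℓ : U → ℝ → ℝ → E → E) (ε : ℝ) (x x' : E) : Prop :=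
  ∃ w : List (U × NNReal), run ℓ ε w x = x'

omit [NormedAddCommGroup E] [NormedSpace ℝ E] in
theorem Steers.trans {ℓ : U → ℝ → ℝ → E → E} {ε : ℝ} {x y z : E} (h₁ : Steers ℓ ε x y)
    (h₂ : Steers ℓ ε y z) : Steers ℓ ε x z := by
  obtain ⟨w₁, rfl⟩ := h₁
  obtain ⟨w₂, rfl⟩ := h₂
  exact ⟨w₁ ++ w₂, by simp⟩

/-- A family of immersed discs of points to which one can steer, parametrized by the initial
point and by `ε`. -/
def IsDiscAt {T : Type*} [NormedAddCommGroup T] [NormedSpace ℝ T] (ℓ : U → ℝ → ℝ → E → E)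
    (K : Set E) (p : E) (τ : T) (g : ℝ × E × T → E) : Prop :=
  ContDiffAt ℝ 1 g (0, p, τ) ∧ Function.Injective (fderiv ℝ (fun τ => g (0, p, τ)) τ) ∧
    ∀ᶠ z in 𝓝 (0, p, τ), z.2.1 ∈ K → Steers ℓ z.1 z.2.1 (g z)

/-- Some point of `K` can be steered to an `r`-dimensional disc. -/
def HasDisc (ℓ : U → ℝ → ℝ → E → E) (K : Set E) (r : ℕ) : Prop :=
  ∃ p ∈ K, ∃ (τ : Fin r → ℝ) (g : ℝ × E × (Fin r → ℝ) → E), IsDiscAt ℓ K p τ g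

variable {T : Type*} [NormedAddCommGroup T] [NormedSpace ℝ T] {ℓ : U → ℝ → ℝ → E → E} {K : Set E}

theorem contDiffAt_slice {g : ℝ × E × T → E} {p : E} {τ : T} (hg : ContDiffAt ℝ 1 g (0, p, τ)) :
    ContDiffAt ℝ 1 (fun τ => g (0, p, τ)) τ :=
  hg.comp (f := fun τ : T => ((0 : ℝ), p, τ)) τ
    (contDiffAt_const.prodMk (contDiffAt_const.prodMk contDiffAt_id))

/-- Regularity and injectivity of the derivative are open conditions, but steering is known only for
parameters in `A`. This allows a disc to be moved off a boundary point of `A`, such as a flow time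
`0`. -/
theorem eventually_isDiscAt [FiniteDimensional ℝ T] {g : ℝ × E × T → E} {p : E} {τ₀ : T}
    {A : Set T} (hg : ContDiffAt ℝ 1 g (0, p, τ₀))
    (hinj : Function.Injective (fderiv ℝ (fun τ => g (0, p, τ)) τ₀))
    (hst : ∀ᶠ z in 𝓝 (0, p, τ₀), z.2.2 ∈ A → z.2.1 ∈ K → Steers ℓ z.1 z.2.1 (g z)) :
    ∀ᶠ τ in 𝓝 τ₀, τ ∈ interior A → IsDiscAt ℓ K p τ g := by
  have hc : Tendsto (fun τ : T => ((0 : ℝ), p, τ)) (𝓝 τ₀) (𝓝 (0, p, τ₀)) :=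
    (Continuous.prodMk continuous_const (Continuous.prodMk continuous_const continuous_id)).tendsto
      τ₀
  have h1 := hc.eventually (hg.eventually (by simp))
  have h2 : ∀ᶠ τ in 𝓝 τ₀, Function.Injective (fderiv ℝ (fun τ => g (0, p, τ)) τ) :=
    ((contDiffAt_slice hg).continuousAt_fderiv one_ne_zero).eventually
      (ContinuousLinearMap.isOpen_injective.mem_nhds hinj)
  have h3 := hc.eventually (eventually_eventually_nhds.2 hst)
  filter_upwards [h1, h2, h3] with τ h1 h2 h3 hτ
  refine ⟨h1, h2, ?_⟩
  have : ∀ᶠ z : ℝ × E × T in 𝓝 (0, p, τ), z.2.2 ∈ A :=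
    (continuous_snd.comp continuous_snd).continuousAt.eventually
      (mem_of_superset (isOpen_interior.mem_nhds hτ) interior_subset)
  filter_upwards [h3, this] with z hz hA using hz hA

theorem IsDiscAt.hasDisc [FiniteDimensional ℝ T] {g : ℝ × E × T → E} {p : E} {τ : T} {r : ℕ}
    (h : IsDiscAt ℓ K p τ g) (hp : p ∈ K) (hr : Module.finrank ℝ T = r) : HasDisc ℓ K r := by
  let e : (Fin r → ℝ) ≃L[ℝ] T := ContinuousLinearEquiv.ofFinrankEq (by simp [hr])
  obtain ⟨h1, h2, h3⟩ := h
  refine ⟨p, hp, e.symm τ, fun z => g (z.1, z.2.1, e z.2.2), ?_, ?_, ?_⟩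
  · refine ContDiffAt.comp (g := g) (f := fun z : ℝ × E × (Fin r → ℝ) => (z.1, z.2.1, e z.2.2))
      (0, p, e.symm τ) (by simpa using h1) (ContDiff.contDiffAt ?_)
    exact contDiff_fst.prodMk ((contDiff_fst.comp contDiff_snd).prodMk
      (e.contDiff.comp (contDiff_snd.comp contDiff_snd)))
  · have hd : HasFDerivAt (fun τ => g (0, p, τ)) (fderiv ℝ (fun τ => g (0, p, τ)) τ)
        (e (e.symm τ)) := by
      rw [e.apply_symm_apply]
      exact ((contDiffAt_slice h1).differentiableAt one_ne_zero).hasFDerivAt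
    have := (hd.comp (e.symm τ) e.hasFDerivAt).fderiv
    simp only [Function.comp_def] at this
    rw [this]
    exact h2.comp e.injective
  · have hc : Tendsto (fun z : ℝ × E × (Fin r → ℝ) => (z.1, z.2.1, e z.2.2))
        (𝓝 (0, p, e.symm τ)) (𝓝 (0, p, τ)) := by
      have : Continuous (fun z : ℝ × E × (Fin r → ℝ) => (z.1, z.2.1, e z.2.2)) := by fun_prop
      simpa using this.tendsto (0, p, e.symm τ)
    exact hc.eventually h3

theorem hasDisc_zero (hK : K.Nonempty) : HasDisc ℓ K 0 := by
  obtain ⟨p, hp⟩ := hK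
  refine ⟨p, hp, 0, fun z => z.2.1, (contDiff_fst.comp contDiff_snd).contDiffAt,
    Function.injective_of_subsingleton _, Eventually.of_forall fun z _ => ⟨[], by simp⟩⟩

end Discs

end ControlSystem

/-! ### Raising the dimension of a disc: transversality and Baire category -/

namespace ControlSystem
open Filter Topology

/-- Near `q`, the set `K` is the graph of a `C¹` map with domain `W`. -/
def IsLocalGraphAt {E : Type*} [NormedAddCommGroup E] [NormedSpace ℝ E] (K : Set E) (W : Type*)
    [NormedAddCommGroup W] [NormedSpace ℝ W] (q : E) : Prop :=
  ∃ (π : E →L[ℝ] W) (H : W → E), ContDiffAt ℝ 1 H (π q) ∧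
    (∀ᶠ v in 𝓝 (π q), π (H v) = v ∧ H v ∈ K) ∧ ∀ᶠ x in 𝓝[K] q, H (π x) = x

/-- A one-parameter enlargement of an injective linear map by a vector outside its range. -/
theorem injective_coprod_toSpanSingleton {T E : Type*} [NormedAddCommGroup T] [NormedSpace ℝ T]
    [NormedAddCommGroup E] [NormedSpace ℝ E] {A : T →L[ℝ] E} (hA : Function.Injective A) {e : E}
    (he : ∀ t, e ≠ A t) :
    Function.Injective (A.coprod ((1 : ℝ →L[ℝ] ℝ).smulRight e)) := by
  rw [injective_iff_map_eq_zero]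
  rintro ⟨t, s⟩ h
  simp only [ContinuousLinearMap.coprod_apply, ContinuousLinearMap.smulRight_apply,
    one_apply_eq_self] at h
  have hs : s = 0 := by
    by_contra hs
    refine he (-(s⁻¹ • t)) ?_
    rw [map_neg, map_smul, eq_neg_of_add_eq_zero_left h, smul_neg, neg_neg, smul_smul,
      inv_mul_cancel₀ hs, one_smul]
  subst hs
  simp only [zero_smul, add_zero] at h
  rw [(injective_iff_map_eq_zero A).1 hA t h]
  rfl

namespace SteeringSystem

variable {E U : Type*} [NormedAddCommGroup E] [NormedSpace ℝ E] [FiniteDimensional ℝ E]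
  [PseudoMetricSpace U] {F : E → U → E} {K : Set E} {ℓ : U → ℝ → ℝ → E → E} {b L : NNReal}

omit [FiniteDimensional ℝ E] in
theorem mem_of_steers (h : SteeringSystem F K ℓ b L) {ε : ℝ} {x y : E} (hxy : Steers ℓ ε x y)
    (hx : x ∈ K) : y ∈ K := by
  obtain ⟨w, rfl⟩ := hxy
  exact (h.run_mem_iff ε w x).2 hx

theorem fderiv_run_injective (h : SteeringSystem F K ℓ b L) (w : List (U × NNReal)) (x : E) :
    Function.Injective (fderiv ℝ (run ℓ 0 w) x) := fun a a' haa' => by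
  rw [← h.fderiv_runInv_fderiv_run w x a, haa', h.fderiv_runInv_fderiv_run]

/-- A disc which is transverse to some field after transport by a word yields a disc of higher
dimension. -/
theorem hasDisc_succ (h : SteeringSystem F K ℓ b L) {r : ℕ} {p : E} (hp : p ∈ K) {τ₀ : Fin r → ℝ}
    {g : ℝ × E × (Fin r → ℝ) → E} (hg : IsDiscAt ℓ K p τ₀ g) (w : List (U × NNReal)) (u : U)
    (hu : ∀ a, F (run ℓ 0 w (g (0, p, τ₀))) u ≠ fderiv ℝ (run ℓ 0 w) (g (0, p, τ₀))
      (fderiv ℝ (fun τ => g (0, p, τ)) τ₀ a)) : HasDisc ℓ K (r + 1) := by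
  obtain ⟨h1, h2, h3⟩ := hg
  -- Continue the words of the disc by `w` and then by the letter `u`, whose duration is the new
  -- parameter. At duration `0` the new partial derivative is the field `F · u`, transverse to the
  -- transported disc by `hu`.
  set G : ℝ × E × ((Fin r → ℝ) × ℝ) → E :=
    fun z => ℓ u z.1 z.2.2.2 (run ℓ z.1 w (g (z.1, z.2.1, z.2.2.1))) with hG
  have hproj : Continuous (fun z : ℝ × E × ((Fin r → ℝ) × ℝ) => (z.1, z.2.1, z.2.2.1)) := by
    fun_prop
  have hGg : ContDiffAt ℝ 1 (fun z : ℝ × E × ((Fin r → ℝ) × ℝ) => g (z.1, z.2.1, z.2.2.1))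
      (0, p, (τ₀, 0)) := by
    refine ContDiffAt.comp (g := g)
      (f := fun z : ℝ × E × ((Fin r → ℝ) × ℝ) => (z.1, z.2.1, z.2.2.1)) _ h1 (ContDiff.contDiffAt ?_)
    fun_prop
  have hGc : ContDiffAt ℝ 1 G (0, p, (τ₀, 0)) := by
    have hrun := ((h.contDiff_run w).of_le (m := 1) (by exact_mod_cast le_top)).contDiffAt.comp
      (g := fun z : ℝ × E => run ℓ z.1 w z.2)
      (f := fun z : ℝ × E × ((Fin r → ℝ) × ℝ) => (z.1, g (z.1, z.2.1, z.2.2.1)))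
      (0, p, (τ₀, 0)) (contDiffAt_fst.prodMk hGg)
    refine ((h.contDiff u).of_le (m := 1) (by exact_mod_cast le_top)).contDiffAt.comp
      (g := fun z : ℝ × ℝ × E => ℓ u z.1 z.2.1 z.2.2)
      (f := fun z : ℝ × E × ((Fin r → ℝ) × ℝ) =>
        (z.1, z.2.2.2, run ℓ z.1 w (g (z.1, z.2.1, z.2.2.1)))) (0, p, (τ₀, 0)) ?_
    exact contDiffAt_fst.prodMk ((contDiff_snd.comp (contDiff_snd.comp contDiff_snd)).contDiffAt.prodMk
      hrun)
  set A := (fderiv ℝ (run ℓ 0 w) (g (0, p, τ₀))).comp (fderiv ℝ (fun τ => g (0, p, τ)) τ₀) with hA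
  have hAi : Function.Injective A := (h.fderiv_run_injective w _).comp h2
  have hder : HasFDerivAt (fun τ => G (0, p, τ))
      (A.coprod ((1 : ℝ →L[ℝ] ℝ).smulRight (F (run ℓ 0 w (g (0, p, τ₀))) u))) (τ₀, (0 : ℝ)) := by
    have hd := (contDiffAt_slice hGc).differentiableAt one_ne_zero |>.hasFDerivAt
    set D := fderiv ℝ (fun τ => G (0, p, τ)) (τ₀, (0 : ℝ)) with hD
    refine hd.congr_fderiv ?_
    have e1 : D.comp (ContinuousLinearMap.inl ℝ (Fin r → ℝ) ℝ) = A := by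
      have := hd.comp (f := fun τ : Fin r → ℝ => (τ, (0 : ℝ))) τ₀ (hasFDerivAt_prodMk_left τ₀ (0 : ℝ))
      refine this.unique ?_
      have hf : (fun τ => G (0, p, τ)) ∘ (fun τ : Fin r → ℝ => (τ, (0 : ℝ))) =
          run ℓ 0 w ∘ fun τ => g (0, p, τ) := by
        funext τ
        simp [hG, (h.flow u).zero]
      rw [hf]
      exact ((h.contDiff_run_zero w).differentiable (by simp) _).hasFDerivAt.comp τ₀
        ((contDiffAt_slice h1).differentiableAt one_ne_zero).hasFDerivAt
    have e2 : D (0, 1) = F (run ℓ 0 w (g (0, p, τ₀))) u := by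
      have h4 := hd.comp_hasDerivAt (f := fun s : ℝ => (τ₀, s)) (0 : ℝ)
        ((hasDerivAt_const _ τ₀).prodMk (hasDerivAt_id (0 : ℝ)))
      have h5 := (h.flow u).deriv (run ℓ 0 w (g (0, p, τ₀))) 0
      rw [(h.flow u).zero] at h5
      exact h4.unique h5
    refine ContinuousLinearMap.ext fun ⟨t, s⟩ => ?_
    have : ((t, s) : (Fin r → ℝ) × ℝ) = (t, 0) + s • (0, 1) := by ext <;> simp
    rw [this, map_add, map_smul, e2]
    have e3 : D (t, 0) = A t := congrArg (fun B : (Fin r → ℝ) →L[ℝ] E => B t) e1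
    simp [e3]
  have hinj : Function.Injective (fderiv ℝ (fun τ => G (0, p, τ)) (τ₀, (0 : ℝ))) := by
    rw [hder.fderiv]
    exact injective_coprod_toSpanSingleton hAi hu
  have hst : ∀ᶠ z in 𝓝 (0, p, (τ₀, 0)), z.2.2 ∈ {τ : (Fin r → ℝ) × ℝ | 0 < τ.2} → z.2.1 ∈ K →
      Steers ℓ z.1 z.2.1 (G z) := by
    filter_upwards [(hproj.tendsto (0, p, (τ₀, 0))).eventually h3] with z hz hz0 hzK
    refine ((hz hzK).trans ⟨w, rfl⟩).trans ⟨[(u, z.2.2.2.toNNReal)], ?_⟩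
    simp [hG, Real.coe_toNNReal _ (le_of_lt hz0)]
  have hev := eventually_isDiscAt hGc hinj hst
  have hop : IsOpen {τ : (Fin r → ℝ) × ℝ | 0 < τ.2} := isOpen_lt continuous_const continuous_snd
  rw [hop.interior_eq] at hev
  -- Durations are nonnegative, so `(τ₀, 0)` is on the boundary of the allowed parameters; the disc
  -- is recentred at a small `s > 0`.
  have hev' : ∀ᶠ s in 𝓝[>] (0 : ℝ), IsDiscAt ℓ K p (τ₀, s) G := by
    have hc : Tendsto (fun s : ℝ => (τ₀, s)) (𝓝[>] 0) (𝓝 (τ₀, 0)) :=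
      ((Continuous.prodMk continuous_const continuous_id).tendsto 0).mono_left nhdsWithin_le_nhds
    filter_upwards [hc.eventually hev, self_mem_nhdsWithin] with s hs hs0 using hs hs0
  obtain ⟨s, hs⟩ := hev'.exists
  exact hs.hasDisc hp (by simp)

/-- Baire category argument: if all points of `K` are reachable, discs of maximal dimension have
the dimension of `K`. -/
theorem hasDisc_succ_of_lt (h : SteeringSystem F K ℓ b L) [TopologicalSpace.SeparableSpace U]
    (hK : IsCompact K) {W : Type*} [NormedAddCommGroup W] [NormedSpace ℝ W] [FiniteDimensional ℝ W]
    (hW : ∀ q ∈ K, IsLocalGraphAt K W q)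
    (hchain : ∀ p ∈ K, ∀ q ∈ K, Relation.ReflTransGen (ContinuousSteer F) p q) {r : ℕ}
    (hr : r < Module.finrank ℝ W) (hdisc : HasDisc ℓ K r) : HasDisc ℓ K (r + 1) := by
  by_contra hno
  obtain ⟨p, hp, τ₀, g, hg⟩ := hdisc
  set γ : (Fin r → ℝ) → E := fun τ => g (0, p, τ) with hγdef
  have hγ : ContDiffAt ℝ 1 γ τ₀ := contDiffAt_slice hg.1
  -- Since no disc of dimension `r + 1` exists, every field is tangent to every transport of the
  -- disc, at all its points near the centre.
  have hztan : ∀ᶠ τ in 𝓝 τ₀, ∀ (w : List (U × NNReal)) (u : U), ∃ a,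
      F (run ℓ 0 w (γ τ)) u = fderiv ℝ (run ℓ 0 w) (γ τ) (fderiv ℝ γ τ a) := by
    have := eventually_isDiscAt (A := univ) hg.1 hg.2.1 (hg.2.2.mono fun z hz _ => hz)
    filter_upwards [this] with τ hτ w u
    by_contra! hcon
    exact hno (h.hasDisc_succ hp (hτ (by simp)) w u hcon)
  obtain ⟨π, j, hj, hj₀, hjl, hjr, -⟩ := exists_graph_of_immersion one_ne_zero hγ hg.2.1
  set z := γ τ₀ with hz
  set H : (Fin r → ℝ) → E := fun v => γ (j v) with hHdef
  have hHz : H (π z) = z := congrArg γ hj₀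
  have hHc : ContDiffAt ℝ 1 H (π z) := by
    refine ContDiffAt.comp (g := γ) (π z) ?_ hj
    rw [hj₀]; exact hγ
  have hjt : Tendsto j (𝓝 (π z)) (𝓝 τ₀) := by
    have := hj.continuousAt.tendsto
    rwa [hj₀] at this
  -- This turns tangency to the parametrized disc into tangency to the graph of `H`.
  have hgr : ∀ᶠ τ in 𝓝 τ₀, fderiv ℝ γ τ = (fderiv ℝ H (π (γ τ))).comp (π.comp (fderiv ℝ γ τ)) := by
    have e0 : ∀ᶠ τ in 𝓝 τ₀, H (π (γ τ)) = γ τ := hjl.mono fun τ hτ => by simp only [hHdef, hτ]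
    have hc : Tendsto (fun τ => π (γ τ)) (𝓝 τ₀) (𝓝 (π z)) :=
      π.continuous.continuousAt.tendsto.comp hγ.continuousAt.tendsto
    filter_upwards [eventually_eventually_nhds.2 e0, hγ.eventually (by simp),
      hc.eventually (hHc.eventually (by simp))] with τ h0 h1 h2
    have hd1 := (h1.differentiableAt one_ne_zero).hasFDerivAt
    have hd2 := (h2.differentiableAt one_ne_zero).hasFDerivAt.comp τ
      (π.hasFDerivAt.comp τ hd1)
    exact (hd2.congr_of_eventuallyEq (h0.mono fun x hx => hx.symm)).fderiv
  have hcont := hHc.continuousAt_fderiv one_ne_zero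
  have hall : ∀ᶠ v in 𝓝 (π z), ContDiffAt ℝ 1 H v ∧ ‖fderiv ℝ H v‖ ≤ ‖fderiv ℝ H (π z)‖ + 1 ∧
      (∀ᶠ v' in 𝓝 v, π (H v') = v') ∧ ∀ (w : List (U × NNReal)) (u : U), ∃ a,
        F (run ℓ 0 w (H v)) u = fderiv ℝ (run ℓ 0 w) (H v) (fderiv ℝ H v a) := by
    filter_upwards [hHc.eventually (by simp), hcont.norm.eventually_le_const (lt_add_one _),
      eventually_eventually_nhds.2 hjr, hjt.eventually hztan, hjt.eventually hgr]
      with v h1 h2 h3 h4 h5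
    refine ⟨h1, h2, h3, fun w u => ?_⟩
    obtain ⟨a, ha⟩ := h4 w u
    have h6 : π (γ (j v)) = v := h3.self_of_nhds
    rw [h6] at h5
    refine ⟨π (fderiv ℝ γ (j v) a), ?_⟩
    refine ha.trans ?_
    simp only [hHdef]
    congr 1
    exact congrArg (fun A : (Fin r → ℝ) →L[ℝ] E => A a) h5
  obtain ⟨ρ, hρ, hball⟩ := Metric.eventually_nhds_iff_ball.1 hall
  have hπ : ∀ v ∈ Metric.ball (π z) ρ, ∀ a, π (fderiv ℝ H v a) = a := by
    intro v hv a
    obtain ⟨h1, -, h3, -⟩ := hball v hv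
    have := (π.hasFDerivAt.comp v (h1.differentiableAt one_ne_zero).hasFDerivAt).unique
      ((hasFDerivAt_id v).congr_of_eventuallyEq h3)
    exact congrArg (fun A : (Fin r → ℝ) →L[ℝ] (Fin r → ℝ) => A a) this
  -- Lying on the graph is the property preserved along the approximation: the pulled back curve
  -- solves an equation tangent to the graph.
  have hstab : StableNear F ℓ (fun ξ => ξ = H (π ξ)) z (ρ / (‖π‖ + 1)) := by
    intro w u c X y T hT hX hnear h0
    refine h.pullback_eq_graph (O := Metric.ball (π z) ρ)
      (fun v hv => (hball v hv).1.differentiableAt one_ne_zero) (fun v hv => (hball v hv).2.1) hπ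
      (fun v hv => (hball v hv).2.2.2) w u c hX ?_ h0 T ⟨hT, le_rfl⟩
    intro s hs
    rw [mem_ball_iff_norm, ← map_sub]
    calc _ ≤ ‖π‖ * ‖runInv ℓ (w ++ [(u, c * s.toNNReal)]) (X s) - z‖ := π.le_opNorm _
      _ ≤ (‖π‖ + 1) * ‖runInv ℓ (w ++ [(u, c * s.toNNReal)]) (X s) - z‖ := by gcongr; linarith
      _ < (‖π‖ + 1) * (ρ / (‖π‖ + 1)) := by
        gcongr
        exact hnear s hs
      _ = ρ := by field_simp
  have hzK : z ∈ K := h.mem_of_steers (hg.2.2.self_of_nhds hp) hp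
  obtain ⟨Λ, hΛc, hΛd⟩ := TopologicalSpace.exists_countable_dense (U × NNReal)
  -- A closed ball of half the radius makes this piece of the disc compact, hence closed, as Baire
  -- requires.
  set S : Set E := {ξ | ξ = H (π ξ) ∧ π ξ ∈ Metric.closedBall (π z) (ρ / 2)} with hS
  have hSub : Metric.closedBall (π z) (ρ / 2) ⊆ Metric.ball (π z) ρ :=
    Metric.closedBall_subset_ball (by linarith)
  have hSc : IsClosed S := by
    have : S = H '' Metric.closedBall (π z) (ρ / 2) := by
      ext ξ
      constructor
      · rintro ⟨h1, h2⟩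
        exact ⟨_, h2, h1.symm⟩
      · rintro ⟨v, hv, rfl⟩
        have : π (H v) = v := (hball v (hSub hv)).2.2.1.self_of_nhds
        exact ⟨by rw [this], by rwa [this]⟩
    rw [this]
    refine IsCompact.isClosed ((isCompact_closedBall _ _).image_of_continuousOn fun v hv => ?_)
    exact (hball v (hSub hv)).1.continuousAt.continuousWithinAt
  have hcover : ∀ q ∈ K, ∃ w : List Λ, runInv ℓ (w.map Subtype.val) q ∈ S := by
    intro q hq
    obtain ⟨T, hT⟩ := Tracked.of_chain h hΛd (by positivity) hstab hHz.symm (hchain z hzK q hq)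
    obtain ⟨w, hwΛ, -, hw, hn⟩ := hT (ρ / 2 / (‖π‖ + 1)) (by positivity)
    refine ⟨w.pmap Subtype.mk hwΛ, ?_⟩
    have hm : (w.pmap Subtype.mk hwΛ).map Subtype.val = w := by
      simp [List.map_pmap]
    rw [hm]
    refine ⟨hw, ?_⟩
    rw [mem_closedBall_iff_norm, ← map_sub]
    calc _ ≤ ‖π‖ * ‖runInv ℓ w q - z‖ := π.le_opNorm _
      _ ≤ (‖π‖ + 1) * (ρ / 2 / (‖π‖ + 1)) := by
        refine mul_le_mul (by linarith) hn (norm_nonneg _) (by positivity)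
      _ = ρ / 2 := by field_simp
  have : Countable Λ := hΛc
  have : CompactSpace K := isCompact_iff_compactSpace.1 hK
  have : Nonempty K := ⟨⟨p, hp⟩⟩
  -- Words in the countable set `Λ` are countable and their closed preimages of `S` cover the
  -- compact space `K`, so one of them has interior.
  obtain ⟨w, ⟨q, hq⟩, hwq⟩ := nonempty_interior_of_iUnion_of_closed
    (f := fun w : List Λ => {q : K | runInv ℓ (w.map Subtype.val) q ∈ S})
    (fun w => hSc.preimage ((h.contDiff_runInv _).continuous.comp continuous_subtype_val))
    (eq_univ_of_forall fun q => mem_iUnion.2 (hcover q q.2))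
  set w' := w.map Subtype.val
  have hwq' : ∀ᶠ x in 𝓝[K] q, runInv ℓ w' x ∈ S := by
    rw [nhdsWithin_eq_map_subtype_coe hq]
    exact Filter.eventually_map.2 (mem_interior_iff_mem_nhds.1 hwq)
  obtain ⟨π', H', hH', hH'K, hH'π⟩ := hW q hq
  have hq' : H' (π' q) = q := hH'π.self_of_nhdsWithin hq
  have htend : Tendsto H' (𝓝 (π' q)) (𝓝[K] q) := by
    refine tendsto_nhdsWithin_iff.2 ⟨?_, hH'K.mono fun v hv => hv.2⟩
    have := hH'.continuousAt.tendsto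
    rwa [hq'] at this
  refine hr.not_ge ?_
  have hrank : Module.finrank ℝ (Fin r → ℝ) = r := by simp
  rw [← hrank]
  have hqS : runInv ℓ w' q ∈ S := hwq'.self_of_nhdsWithin hq
  -- Near `q`, the parameters of `K` map to parameters of the disc by pulling back along `w'`, and
  -- running `w'` from the disc undoes this; so `dim W ≤ r`.
  refine finrank_le_of_eventually_leftInverse (v := π' q)
    (a := fun v => π (runInv ℓ w' (H' v))) (c := fun t => π' (run ℓ 0 w' (H t))) ?_ ?_ ?_
  · exact π.differentiableAt.comp _ (((h.contDiff_runInv w').differentiable (by simp) _).comp _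
      (hH'.differentiableAt one_ne_zero))
  · refine π'.differentiableAt.comp _ (((h.contDiff_run_zero w').differentiable (by simp) _).comp _
      ((hball _ (hSub ?_)).1.differentiableAt one_ne_zero))
    rw [hq']
    exact hqS.2
  · filter_upwards [htend.eventually hwq', hH'K] with v hv hv'
    rw [← hv.1, h.run_runInv, hv'.1]

end SteeringSystem

end ControlSystem

/-! ### From full-dimensional discs to exact and robust steering -/

namespace ControlSystem
open Filter Topology

namespace SteeringSystem

variable {E U : Type*} [NormedAddCommGroup E] [NormedSpace ℝ E] [FiniteDimensional ℝ E]
  [PseudoMetricSpace U] {F : E → U → E} {K : Set E} {ℓ : U → ℝ → ℝ → E → E} {b L : NNReal}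

/-- An equidimensional disc in `K` fills a neighbourhood, robustly. -/
theorem eventually_steers_of_isDiscAt (h : SteeringSystem F K ℓ b L) {W : Type*}
    [NormedAddCommGroup W] [NormedSpace ℝ W] [FiniteDimensional ℝ W]
    (hW : ∀ q ∈ K, IsLocalGraphAt K W q) {T : Type*} [NormedAddCommGroup T] [NormedSpace ℝ T]
    [FiniteDimensional ℝ T] (hTW : Module.finrank ℝ T = Module.finrank ℝ W) {p : E} (hp : p ∈ K)
    {τ₀ : T} {g : ℝ × E × T → E} (hg : IsDiscAt ℓ K p τ₀ g) :
    ∀ᶠ z : ℝ × E × E in 𝓝 (0, p, g (0, p, τ₀)), z.2.1 ∈ K → z.2.2 ∈ K →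
      Steers ℓ z.1 z.2.1 z.2.2 := by
  have := FiniteDimensional.complete ℝ E
  have := FiniteDimensional.complete ℝ T
  have := FiniteDimensional.complete ℝ W
  obtain ⟨h1, h2, h3⟩ := hg
  set q := g (0, p, τ₀) with hq
  have hqK : q ∈ K := h.mem_of_steers (h3.self_of_nhds hp) hp
  obtain ⟨π, H, hH, -, hπ⟩ := hW q hqK
  set γ : T → E := fun τ => g (0, p, τ) with hγ
  have hγd : HasFDerivAt γ (fderiv ℝ γ τ₀) τ₀ :=
    ((contDiffAt_slice h1).differentiableAt one_ne_zero).hasFDerivAt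
  have hγK : Tendsto γ (𝓝 τ₀) (𝓝[K] q) := by
    refine tendsto_nhdsWithin_iff.2 ⟨hγd.continuousAt, ?_⟩
    have hc : Tendsto (fun τ : T => ((0 : ℝ), p, τ)) (𝓝 τ₀) (𝓝 (0, p, τ₀)) :=
      (Continuous.prodMk continuous_const
        (Continuous.prodMk continuous_const continuous_id)).tendsto τ₀
    exact (hc.eventually h3).mono fun τ hτ => h.mem_of_steers (hτ hp) hp
  -- The disc lies in `K`, which is the graph of `H` near `q`, so projecting by `π` loses nothing.
  -- Hence `π ∘ Dγ` is still injective, and bijective as the dimensions agree.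
  have hfac : fderiv ℝ γ τ₀ = (fderiv ℝ H (π q)).comp (π.comp (fderiv ℝ γ τ₀)) := by
    have hd : HasFDerivAt (fun τ => H (π (γ τ))) _ τ₀ :=
      (hH.differentiableAt one_ne_zero).hasFDerivAt.comp τ₀ (π.hasFDerivAt.comp τ₀ hγd)
    exact hγd.unique (hd.congr_of_eventuallyEq ((hγK.eventually hπ).mono fun x hx => hx.symm))
  have hinj : Function.Injective (π.comp (fderiv ℝ γ τ₀)) := by
    intro x y hxy
    refine h2 ?_
    rw [hfac]
    exact congrArg (fderiv ℝ H (π q)) hxy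
  have hsurj : Function.Surjective (π.comp (fderiv ℝ γ τ₀)) :=
    (LinearMap.injective_iff_surjective_of_finrank_eq_finrank
      (f := ((π.comp (fderiv ℝ γ τ₀) : T →L[ℝ] W) : T →ₗ[ℝ] W)) hTW).1 hinj
  -- Keeping `ε` and the initial point as coordinates, local surjectivity of `Ψ` gives one
  -- neighbourhood valid for all of them.
  set Ψ : ℝ × E × T → ℝ × E × W := fun z => (z.1, z.2.1, π (g z)) with hΨ
  have hΨc : ContDiffAt ℝ 1 Ψ (0, p, τ₀) :=
    contDiffAt_fst.prodMk ((contDiff_fst.comp contDiff_snd).contDiffAt.prodMk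
      (π.contDiff.contDiffAt.comp _ h1))
  have hΨd : HasFDerivAt Ψ ((ContinuousLinearMap.fst ℝ ℝ (E × T)).prod
      (((ContinuousLinearMap.fst ℝ E T).comp (ContinuousLinearMap.snd ℝ ℝ (E × T))).prod
        (π.comp (fderiv ℝ g (0, p, τ₀))))) (0, p, τ₀) :=
    hasFDerivAt_fst.prodMk ((hasFDerivAt_fst.comp _ hasFDerivAt_snd).prodMk
      (π.hasFDerivAt.comp _ (h1.differentiableAt one_ne_zero).hasFDerivAt))
  have hslice : ∀ t, fderiv ℝ g (0, p, τ₀) (0, 0, t) = fderiv ℝ γ τ₀ t := by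
    intro t
    have hin : HasFDerivAt (fun τ : T => ((0 : ℝ), p, τ))
        ((0 : T →L[ℝ] ℝ).prod ((0 : T →L[ℝ] E).prod (ContinuousLinearMap.id ℝ T))) τ₀ :=
      (hasFDerivAt_const _ _).prodMk ((hasFDerivAt_const _ _).prodMk (hasFDerivAt_id _))
    have := (h1.differentiableAt one_ne_zero).hasFDerivAt.comp τ₀ hin
    exact (congrArg (fun A : T →L[ℝ] E => A t) (hγd.unique this)).symm
  have hmap := (hΨc.hasStrictFDerivAt' hΨd one_ne_zero).map_nhds_eq_of_surj (by
    refine LinearMap.range_eq_top.2 ?_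
    rintro ⟨e, x, v⟩
    obtain ⟨t, ht⟩ := hsurj (v - π (fderiv ℝ g (0, p, τ₀) (e, x, 0)))
    refine ⟨(e, x, t), ?_⟩
    have hsum : ((e, x, t) : ℝ × E × T) = (e, x, 0) + (0, 0, t) := by simp
    have ht' : π (fderiv ℝ g (0, p, τ₀) (0, 0, t)) = v - π (fderiv ℝ g (0, p, τ₀) (e, x, 0)) := by
      rw [hslice]; exact ht
    have : π (fderiv ℝ g (0, p, τ₀) (e, x, t)) = v := by
      rw [hsum, map_add, map_add, ht']; abel
    simpa using this)
  have hgq : ∀ᶠ z in 𝓝 (0, p, τ₀), g z ∈ K → H (π (g z)) = g z :=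
    h1.continuousAt.eventually (eventually_nhdsWithin_iff.1 hπ)
  have hev : ∀ᶠ z' in 𝓝 (Ψ (0, p, τ₀)), ∃ z, Ψ z = z' ∧
      (z.2.1 ∈ K → Steers ℓ z.1 z.2.1 (g z)) ∧ (g z ∈ K → H (π (g z)) = g z) := by
    rw [← hmap]
    refine Filter.eventually_map.2 ?_
    filter_upwards [h3, hgq] with z hz hz'
    exact ⟨z, rfl, hz, hz'⟩
  have hc : Tendsto (fun z : ℝ × E × E => (z.1, z.2.1, π z.2.2)) (𝓝 (0, p, q))
      (𝓝 (Ψ (0, p, τ₀))) := by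
    have : Continuous (fun z : ℝ × E × E => (z.1, z.2.1, π z.2.2)) := by fun_prop
    exact this.tendsto (0, p, q)
  have hc₂ : Tendsto (fun z : ℝ × E × E => z.2.2) (𝓝 (0, p, q)) (𝓝 q) :=
    (continuous_snd.comp continuous_snd).tendsto (0, p, q)
  filter_upwards [hc.eventually hev, hc₂.eventually (eventually_nhdsWithin_iff.1 hπ)]
  rintro ⟨ε, x, y⟩ ⟨z, hz, hst, hgz⟩ hy hx hyK
  simp only [hΨ, Prod.mk.injEq] at hz hy hx hyK ⊢
  obtain ⟨rfl, rfl, hz⟩ := hz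
  -- Both `g z` and `y` lie in `K` and have the same projection; near `q` this forces them to
  -- coincide.
  have hs := hst hx
  have := hgz (h.mem_of_steers hs hx)
  rw [hz, hy hyK] at this
  rwa [this]

variable [TopologicalSpace.SeparableSpace U] {W : Type*} [NormedAddCommGroup W] [NormedSpace ℝ W]
  [FiniteDimensional ℝ W]

/-- If all points of `K` are joined by chains of trajectories with continuous controls, one can
steer a whole neighbourhood to a whole neighbourhood, robustly. -/
theorem exists_eventually_steers (h : SteeringSystem F K ℓ b L)
    (hK : IsCompact K) (hne : K.Nonempty) (hW : ∀ q ∈ K, IsLocalGraphAt K W q)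
    (hchain : ∀ p ∈ K, ∀ q ∈ K, Relation.ReflTransGen (ContinuousSteer F) p q) :
    ∃ p ∈ K, ∃ q ∈ K, ∀ᶠ z : ℝ × E × E in 𝓝 (0, p, q), z.2.1 ∈ K → z.2.2 ∈ K →
      Steers ℓ z.1 z.2.1 z.2.2 := by
  have hdisc : ∀ r ≤ Module.finrank ℝ W, HasDisc ℓ K r := by
    intro r
    induction r with
    | zero => exact fun _ => hasDisc_zero hne
    | succ r ih => exact fun hr => h.hasDisc_succ_of_lt hK hW hchain hr (ih (by omega))
  obtain ⟨p, hp, τ, g, hg⟩ := hdisc _ le_rfl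
  exact ⟨p, hp, g (0, p, τ), h.mem_of_steers (hg.2.2.self_of_nhds hp) hp,
    h.eventually_steers_of_isDiscAt hW (by simp) hp hg⟩

/-- Only the middle step needs to absorb errors: steer `p` close to `p₀`, pull `q` back close to
`q₀` along a word, and join these two points of `K` by the open steering property at `(p₀, q₀)`. -/
theorem steers_zero_of_chain (h : SteeringSystem F K ℓ b L)
    (hK : IsCompact K) (hW : ∀ q ∈ K, IsLocalGraphAt K W q)
    (hchain : ∀ p ∈ K, ∀ q ∈ K, Relation.ReflTransGen (ContinuousSteer F) p q)
    {p q : E} (hp : p ∈ K) (hq : q ∈ K) : Steers ℓ 0 p q := by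
  obtain ⟨p₀, hp₀, q₀, hq₀, hev⟩ := h.exists_eventually_steers hK ⟨p, hp⟩ hW hchain
  obtain ⟨ρ, hρ, hball⟩ := Metric.eventually_nhds_iff.1 hev
  obtain ⟨w₁, hw₁⟩ := h.exists_norm_run_sub_le_of_chain (hchain p hp p₀ hp₀) (half_pos hρ)
  obtain ⟨T, hT⟩ := h.exists_run_of_chain (hchain q₀ hq₀ q hq)
  obtain ⟨w₂, -, hw₂⟩ := hT (ρ / 2) (half_pos hρ)
  have := hball (y := (0, run ℓ 0 w₁ p, runInv ℓ w₂ q)) (by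
    rw [Prod.dist_eq, Prod.dist_eq, dist_self, dist_eq_norm, dist_eq_norm]
    simp only [max_lt_iff]
    exact ⟨hρ, by linarith, by linarith⟩) ((h.run_mem_iff 0 w₁ p).2 hp) ((h.runInv_mem_iff w₂ q).2 hq)
  exact (Steers.trans ⟨w₁, rfl⟩ this).trans ⟨w₂, h.run_runInv w₂ q⟩

/-- For a pair `(p, q)`, fixed words lead from `p` to `p₀` and from `q₀` to `q`. The last word,
together with `ε`, is a local submersion, so for small `ε` every target near `q` comes from a point
near `q₀`. Compactness of `K × K` then makes `ε` uniform. -/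
theorem eventually_forall_steers (h : SteeringSystem F K ℓ b L)
    (hK : IsCompact K) (hW : ∀ q ∈ K, IsLocalGraphAt K W q)
    (hchain : ∀ p ∈ K, ∀ q ∈ K, Relation.ReflTransGen (ContinuousSteer F) p q) :
    ∀ᶠ ε in 𝓝 (0 : ℝ), ∀ p ∈ K, ∀ q ∈ K, Steers ℓ ε p q := by
  have := FiniteDimensional.complete ℝ E
  obtain rfl | hne := K.eq_empty_or_nonempty
  · simp
  obtain ⟨p₀, hp₀, q₀, hq₀, hev⟩ := h.exists_eventually_steers hK hne hW hchain
  suffices ∀ᶠ ε in 𝓝 (0 : ℝ), ∀ z ∈ K ×ˢ K, z.1 ∈ K → z.2 ∈ K → Steers ℓ ε z.1 z.2 from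
    this.mono fun ε hε p hp q hq => hε (p, q) ⟨hp, hq⟩ hp hq
  refine (hK.prod hK).eventually_forall_of_forall_eventually ?_
  rintro ⟨p, q⟩ ⟨hp, hq⟩
  obtain ⟨w₁, rfl⟩ := h.steers_zero_of_chain hK hW hchain hp hp₀
  obtain ⟨w₂, rfl⟩ := h.steers_zero_of_chain hK hW hchain hq₀ hq
  have hc₁ : Continuous fun z : ℝ × E => run ℓ z.1 w₁ z.2 := (h.contDiff_run w₁).continuous
  set Ψ : ℝ × E → ℝ × E := fun z => (z.1, run ℓ z.1 w₂ z.2) with hΨ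
  have hrun : HasFDerivAt (fun z : ℝ × E => run ℓ z.1 w₂ z.2)
      (fderiv ℝ (fun z : ℝ × E => run ℓ z.1 w₂ z.2) (0, q₀)) (0, q₀) :=
    ((h.contDiff_run w₂).differentiable (by simp) _).hasFDerivAt
  set D := fderiv ℝ (fun z : ℝ × E => run ℓ z.1 w₂ z.2) (0, q₀)
  have hΨc : ContDiff ℝ 1 Ψ :=
    contDiff_fst.prodMk ((h.contDiff_run w₂).of_le (by exact_mod_cast le_top))
  have hslice : ∀ a, D (0, a) = fderiv ℝ (run ℓ 0 w₂) q₀ a := fun a =>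
    (congrArg (fun A : E →L[ℝ] E => A a)
      (hrun.comp q₀ (hasFDerivAt_prodMk_right (0 : ℝ) q₀)).fderiv).symm
  have hsurj : Function.Surjective (fderiv ℝ (run ℓ 0 w₂) q₀) :=
    (LinearMap.injective_iff_surjective (f := (fderiv ℝ (run ℓ 0 w₂) q₀ : E →ₗ[ℝ] E))).1
      (h.fderiv_run_injective w₂ q₀)
  have hmap := (hΨc.contDiffAt.hasStrictFDerivAt' (hasFDerivAt_fst.prodMk hrun)
    one_ne_zero).map_nhds_eq_of_surj (by
      refine LinearMap.range_eq_top.2 ?_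
      rintro ⟨e, x⟩
      obtain ⟨a, ha⟩ := hsurj (x - D (e, 0))
      refine ⟨(e, a), ?_⟩
      have hsum : ((e, a) : ℝ × E) = (e, 0) + (0, a) := by simp
      have : D (e, a) = x := by rw [hsum, map_add, hslice, ha]; abel
      simpa using this)
  have hev₁ : ∀ᶠ z : (ℝ × E) × E in 𝓝 ((0, q₀), p), z.2 ∈ K → z.1.2 ∈ K →
      Steers ℓ z.1.1 z.2 z.1.2 := by
    have hc : Tendsto (fun z : (ℝ × E) × E => (z.1.1, run ℓ z.1.1 w₁ z.2, z.1.2)) (𝓝 ((0, q₀), p))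
        (𝓝 (0, run ℓ 0 w₁ p, q₀)) := by
      have : Continuous (fun z : (ℝ × E) × E => (z.1.1, run ℓ z.1.1 w₁ z.2, z.1.2)) := by
        have := hc₁.comp ((continuous_fst.comp continuous_fst).prodMk continuous_snd :
          Continuous fun z : (ℝ × E) × E => (z.1.1, z.2))
        exact (continuous_fst.comp continuous_fst).prodMk
          (this.prodMk (continuous_snd.comp continuous_fst))
      exact this.tendsto ((0, q₀), p)
    filter_upwards [hc.eventually hev] with z hz h1 h2
    exact Steers.trans ⟨w₁, rfl⟩ (hz ((h.run_mem_iff _ w₁ _).2 h1) h2)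
  rw [nhds_prod_eq] at hev₁
  have hev₂ : ∀ᶠ z : (ℝ × E) × E in 𝓝 (Ψ (0, q₀)) ×ˢ 𝓝 p, z.2 ∈ K → z.1.2 ∈ K →
      Steers ℓ z.1.1 z.2 z.1.2 := by
    rw [← hmap, ← Filter.map_id (f := 𝓝 p), Filter.prod_map_map_eq]
    refine Filter.eventually_map.2 (hev₁.mono fun z hz h1 h2 => ?_)
    exact (hz h1 ((h.run_mem_iff _ w₂ _).1 h2)).trans ⟨w₂, rfl⟩
  rw [← nhds_prod_eq] at hev₂
  have hc : Tendsto (fun z : ℝ × E × E => ((z.1, z.2.2), z.2.1)) (𝓝 (0, p, run ℓ 0 w₂ q₀))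
      (𝓝 (Ψ (0, q₀), p)) := by
    have : Continuous (fun z : ℝ × E × E => ((z.1, z.2.2), z.2.1)) := by fun_prop
    exact this.tendsto (0, p, run ℓ 0 w₂ q₀)
  exact hc.eventually hev₂

end SteeringSystem

end ControlSystem

/-! ### Invariance of the submanifold and slides of the control -/

namespace ControlSystem
open Filter Topology

section Invariance

variable {E V W : Type*} [NormedAddCommGroup E] [NormedSpace ℝ E] [NormedAddCommGroup W]
  [NormedSpace ℝ W]

/-- Near `q`, the set `K` is the graph of a `C¹` map with domain `W`, and the fields `F · u` are
tangent to it. -/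
def IsTangentGraphAt (K : Set E) (W : Type*) [NormedAddCommGroup W] [NormedSpace ℝ W]
    (F : E → V → E) (q : E) : Prop :=
  ∃ (π : E →L[ℝ] W) (H : W → E), ContDiffAt ℝ 1 H (π q) ∧
    (∀ᶠ v in 𝓝 (π q), π (H v) = v ∧ H v ∈ K) ∧
    ∀ᶠ x in 𝓝[K] q, H (π x) = x ∧ ∀ u, fderiv ℝ H (π x) (π (F x u)) = F x u

theorem IsTangentGraphAt.isLocalGraphAt {K : Set E} {F : E → V → E} {q : E}
    (h : IsTangentGraphAt K W F q) : IsLocalGraphAt K W q := by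
  obtain ⟨π, H, h1, h2, h3⟩ := h
  exact ⟨π, H, h1, h2, h3.mono fun x hx => hx.1⟩

/-- Locally `K` is a graph to which the field is tangent, so `eq_graph_of_tangent` applies for a
short time. The factor `c` covers time reversal and the factor `sin ε` of the slides. -/
theorem exists_forall_mem_of_tangent {K : Set E} {F : E → V → E} {L : NNReal}
    (hL : ∀ x x' u, ‖F x u - F x' u‖ ≤ L * ‖x - x'‖) {X : ℝ → E} {y : ℝ → V} {c : ℝ}
    (hX : ∀ t, HasDerivAt X (c • F (X t) (y t)) t) (h0 : X 0 ∈ K)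
    (hq : IsTangentGraphAt K W F (X 0)) : ∃ T > 0, ∀ t ∈ Icc 0 T, X t ∈ K := by
  obtain ⟨π, H, hH, hHK, hπ⟩ := hq
  have hHq : H (π (X 0)) = X 0 := (hπ.self_of_nhdsWithin h0).1
  have htend : Tendsto H (𝓝 (π (X 0))) (𝓝[K] X 0) := by
    refine tendsto_nhdsWithin_iff.2 ⟨?_, hHK.mono fun v hv => hv.2⟩
    have := hH.continuousAt.tendsto
    rwa [hHq] at this
  have hall : ∀ᶠ v in 𝓝 (π (X 0)), ContDiffAt ℝ 1 H v ∧
      ‖fderiv ℝ H v‖ ≤ ‖fderiv ℝ H (π (X 0))‖ + 1 ∧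
      (∀ᶠ v' in 𝓝 v, π (H v') = v' ∧ H v' ∈ K) ∧
      ∀ u, fderiv ℝ H (π (H v)) (π (F (H v) u)) = F (H v) u := by
    filter_upwards [hH.eventually (by simp),
      (hH.continuousAt_fderiv one_ne_zero).norm.eventually_le_const (lt_add_one _),
      eventually_eventually_nhds.2 hHK, htend.eventually hπ] with v h1 h2 h3 h4
    exact ⟨h1, h2, h3, h4.2⟩
  obtain ⟨ρ, hρ, hball⟩ := Metric.eventually_nhds_iff_ball.1 hall
  have hXc : Continuous X := continuous_iff_continuousAt.2 fun t => (hX t).continuousAt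
  have hnear : ∀ᶠ t in 𝓝 (0 : ℝ), π (X t) ∈ Metric.ball (π (X 0)) ρ :=
    (π.continuous.comp hXc).continuousAt.eventually (Metric.ball_mem_nhds _ hρ)
  obtain ⟨T, hT, hTball⟩ := Metric.eventually_nhds_iff_ball.1 hnear
  have hO : ∀ s ∈ Icc 0 (T / 2), π (X s) ∈ Metric.ball (π (X 0)) ρ := fun s hs =>
    hTball s (by
      rw [mem_ball_zero_iff, Real.norm_eq_abs, abs_of_nonneg hs.1]
      linarith [hs.2])
  have hπH : ∀ v ∈ Metric.ball (π (X 0)) ρ, π (H v) = v ∧ H v ∈ K := fun v hv =>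
    (hball v hv).2.2.1.self_of_nhds
  have key := eq_graph_of_tangent (π := π) (H := H) (g := fun s x => c • F x (y s))
    (k := |c| * L) (T := T / 2)
    (fun v hv => (hball v hv).1.differentiableAt one_ne_zero) (fun v hv => (hball v hv).2.1)
    (fun v hv a => by
      have := (π.hasFDerivAt.comp v
        ((hball v hv).1.differentiableAt one_ne_zero).hasFDerivAt).unique
        ((hasFDerivAt_id v).congr_of_eventuallyEq ((hball v hv).2.2.1.mono fun x hx => hx.1))
      exact congrArg (fun A : W →L[ℝ] W => A a) this)
    (fun s _ => (hX s).hasDerivWithinAt) hO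
    (fun s _ => by
      rw [← smul_sub, norm_smul, Real.norm_eq_abs, mul_assoc]
      gcongr
      exact hL _ _ _)
    (fun s hs => by
      refine ⟨c • π (F (H (π (X s))) (y s)), ?_⟩
      rw [map_smul]
      have := (hball _ (hO s hs)).2.2.2 (y s)
      rw [(hπH _ (hO s hs)).1] at this
      rw [this])
    hHq.symm
  refine ⟨T / 2, half_pos hT, fun t ht => ?_⟩
  rw [key t ht]
  exact (hπH _ (hO t ht)).2

/-- Curves driven by fields tangent to `K` do not leave `K`. -/
theorem mem_of_tangent {K : Set E} (hK : IsClosed K) {F : E → V → E} {L : NNReal}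
    (hL : ∀ x x' u, ‖F x u - F x' u‖ ≤ L * ‖x - x'‖) (htan : ∀ q ∈ K, IsTangentGraphAt K W F q)
    {X : ℝ → E} {y : ℝ → V} {c : ℝ} (hX : ∀ t, HasDerivAt X (c • F (X t) (y t)) t) {t₀ : ℝ}
    (h0 : X t₀ ∈ K) (t : ℝ) : X t ∈ K := by
  have hXc : Continuous X := continuous_iff_continuousAt.2 fun t => (hX t).continuousAt
  have hcl : IsClopen {t | X t ∈ K} := by
    refine ⟨hK.preimage hXc, isOpen_iff_mem_nhds.2 fun s hs => ?_⟩
    obtain ⟨T₁, hT₁, h1⟩ := exists_forall_mem_of_tangent (X := fun r => X (s + r))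
      (y := fun r => y (s + r)) hL (fun r => (hX (s + r)).comp_const_add s r)
      (by simpa using! hs) (by simpa using htan _ hs)
    obtain ⟨T₂, hT₂, h2⟩ := exists_forall_mem_of_tangent (X := fun r => X (s - r)) (c := -c)
      (y := fun r => y (s - r)) hL
      (fun r => by simpa using! (hX (s - r)).comp_const_sub s r)
      (by simpa using! hs) (by simpa using htan _ hs)
    filter_upwards [Ioo_mem_nhds (sub_lt_self s hT₂) (lt_add_of_pos_right s hT₁)] with r hr
    rcases le_total s r with hsr | hsr
    · simpa using h1 (r - s) ⟨by linarith, by linarith [hr.2]⟩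
    · simpa using h2 (s - r) ⟨by linarith, by linarith [hr.1]⟩
  have : t ∈ {t | X t ∈ K} := by
    rw [hcl.eq_univ ⟨t₀, h0⟩]
    trivial
  exact this

end Invariance

section Slides

variable {E V W : Type*} [NormedAddCommGroup E] [NormedSpace ℝ E]
  [NormedAddCommGroup V] [NormedSpace ℝ V] [NormedAddCommGroup W] [NormedSpace ℝ W]

/-- A piece of trajectory of the extended system with constant control of norm at most `R`. -/
def SlideStep (F : E → V → E) (C : Set V) (R : ℝ) (p q : E × V) : Prop :=
  ∃ (v : V) (S : ℝ) (X : ℝ → E), ‖v‖ ≤ R ∧ 0 ≤ S ∧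
    (∀ t, HasDerivAt X (F (X t) (p.2 + t • v)) t) ∧ X 0 = p.1 ∧ X S = q.1 ∧ p.2 + S • v = q.2 ∧
    ∀ t ∈ Icc 0 S, p.2 + t • v ∈ C

/-- A smooth family of maps, the identity for `ε = 0`, which are realized by the extended system
while `y` moves from `a` to `b` in time proportional to `sin ε`. -/
structure IsSlide (F : E → V → E) (K : Set E) (C : Set V) (a b : V) (A : ℝ → E → E) : Prop where
  contDiff : ContDiff ℝ ∞ fun z : ℝ × E => A z.1 z.2
  zero : ∀ x, A 0 x = x
  mem_iff : ∀ ε x, A ε x ∈ K ↔ x ∈ K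
  surjective : ∀ ε, Function.Surjective (A ε)
  steps : ∀ ε, 0 < Real.sin ε → ∀ x,
    Relation.ReflTransGen (SlideStep F C (Metric.diam C / Real.sin ε)) (x, a) (A ε x, b)

variable {F : E → V → E} {K : Set E} {C : Set V}

theorem IsSlide.refl (a : V) : IsSlide F K C a a fun _ x => x :=
  ⟨contDiff_snd, fun _ => rfl, fun _ _ => Iff.rfl, fun _ => Function.surjective_id,
    fun _ _ _ => .refl⟩

theorem IsSlide.trans {a b c : V} {A B : ℝ → E → E} (hA : IsSlide F K C a b A)
    (hB : IsSlide F K C b c B) : IsSlide F K C a c fun ε x => B ε (A ε x) where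
  contDiff := hB.contDiff.comp (g := fun z : ℝ × E => B z.1 z.2) (f := fun z : ℝ × E => (z.1, A z.1 z.2))
    (contDiff_fst.prodMk hA.contDiff)
  zero x := by rw [hA.zero, hB.zero]
  mem_iff ε x := by rw [hB.mem_iff, hA.mem_iff]
  surjective ε := (hB.surjective ε).comp (hA.surjective ε)
  steps ε hε x := (hA.steps ε hε x).trans (hB.steps ε hε _)

variable [FiniteDimensional ℝ E]

/-- Both the position `s` on the segment and the parameter `ε` are made state variables: `x' = sin ε
• F(x, y + s (z - y))`, `s' = 1`, `ε' = 0`. The slide is the time-one map, so smoothness in `(ε, x)`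
is smoothness of a single flow. Using `sin ε` instead of `ε` keeps the augmented field bounded and
globally Lipschitz. -/
theorem exists_isSlide_segment (hF : ContDiff ℝ ∞ fun z : E × V => F z.1 z.2) {b L : NNReal}
    (hb : ∀ x u, ‖F x u‖ ≤ b) (hL : LipschitzWith L fun z : E × V => F z.1 z.2) (hK : IsClosed K)
    (htan : ∀ q ∈ K, IsTangentGraphAt K W F q) (hC : Bornology.IsBounded C) {y z : V}
    (hyz : segment ℝ y z ⊆ C) : ∃ A, IsSlide F K C y z A := by
  have hL' : ∀ x x' u, ‖F x u - F x' u‖ ≤ L * ‖x - x'‖ := fun x x' u => by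
    have := hL.dist_le_mul (x, u) (x', u)
    rwa [Prod.dist_eq, dist_self, max_eq_left dist_nonneg, dist_eq_norm, dist_eq_norm] at this
  set Q : E × ℝ × ℝ → E := fun p => F p.1 (y + p.2.1 • (z - y)) with hQ
  set G : E × ℝ × ℝ → E × ℝ × ℝ := fun p => (Real.sin p.2.2 • Q p, 1, 0) with hG
  have hin : ContDiff ℝ ∞ fun p : E × ℝ × ℝ => (p.1, y + p.2.1 • (z - y)) :=
    contDiff_fst.prodMk (contDiff_const.add ((contDiff_fst.comp contDiff_snd).smul contDiff_const))
  have hQc : ContDiff ℝ ∞ Q := hF.comp hin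
  have hGc : ContDiff ℝ ∞ G :=
    ((Real.contDiff_sin.comp (contDiff_snd.comp contDiff_snd)).smul hQc).prodMk contDiff_const
  have hGc₁ : ContDiff ℝ 1 G := hGc.of_le (by exact_mod_cast le_top)
  have hQL : ∀ p p', ‖Q p - Q p'‖ ≤ L * (1 + ‖z - y‖) * ‖p - p'‖ := by
    intro p p'
    have h1 := hL.dist_le_mul (p.1, y + p.2.1 • (z - y)) (p'.1, y + p'.2.1 • (z - y))
    rw [dist_eq_norm, dist_eq_norm] at h1
    refine h1.trans ?_
    rw [mul_assoc]
    gcongr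
    rw [Prod.norm_def]
    have e1 : ‖p.1 - p'.1‖ ≤ ‖p - p'‖ := norm_fst_le (p - p')
    have e2 : ‖p.2.1 - p'.2.1‖ ≤ ‖p - p'‖ :=
      (norm_fst_le (p - p').2).trans (norm_snd_le (p - p'))
    refine max_le ?_ ?_
    · calc _ ≤ 1 * ‖p - p'‖ := by simpa using e1
        _ ≤ _ := by gcongr; linarith [norm_nonneg (z - y)]
    · have : (p.1, y + p.2.1 • (z - y)).2 - (p'.1, y + p'.2.1 • (z - y)).2 =
          (p.2.1 - p'.2.1) • (z - y) := by simp only [sub_smul]; abel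
      rw [Prod.snd_sub, this, norm_smul, mul_comm]
      gcongr
      linarith
  have hGb : ∀ p, ‖G p‖ ≤ (b + 1 : NNReal) := by
    intro p
    have h1 : ‖Real.sin p.2.2 • Q p‖ ≤ b := by
      rw [norm_smul, Real.norm_eq_abs]
      calc _ ≤ 1 * (b : ℝ) := by
            gcongr
            · exact Real.abs_sin_le_one _
            · exact hb _ _
        _ = b := one_mul _
    have h2 : (1 : ℝ) ≤ b + 1 := le_add_of_nonneg_left b.2
    simp only [hG, Prod.norm_def, norm_one, norm_zero, NNReal.coe_add, NNReal.coe_one]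
    exact max_le (h1.trans (by linarith)) (max_le h2 (zero_le_one.trans h2))
  have hGL : LipschitzWith (b + L * (1 + ‖z - y‖₊)) G := by
    refine LipschitzWith.of_dist_le_mul fun p p' => ?_
    rw [dist_eq_norm, dist_eq_norm]
    have e2 : ‖p.2.2 - p'.2.2‖ ≤ ‖p - p'‖ :=
      (norm_snd_le (p - p').2).trans (norm_snd_le (p - p'))
    have e3 : ‖Real.sin p.2.2 - Real.sin p'.2.2‖ ≤ ‖p - p'‖ :=
      (by simpa [dist_eq_norm] using Real.lipschitzWith_sin.dist_le_mul p.2.2 p'.2.2 :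
        ‖Real.sin p.2.2 - Real.sin p'.2.2‖ ≤ ‖p.2.2 - p'.2.2‖).trans e2
    have h1 : ‖Real.sin p.2.2 • Q p - Real.sin p'.2.2 • Q p'‖ ≤
        (b + L * (1 + ‖z - y‖)) * ‖p - p'‖ := by
      have : Real.sin p.2.2 • Q p - Real.sin p'.2.2 • Q p' =
          (Real.sin p.2.2 - Real.sin p'.2.2) • Q p + Real.sin p'.2.2 • (Q p - Q p') := by
        rw [sub_smul, smul_sub]; abel
      rw [this]
      refine (norm_add_le _ _).trans ?_
      rw [norm_smul, norm_smul, add_mul]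
      refine add_le_add ?_ ?_
      · rw [mul_comm]
        gcongr
        exact hb _ _
      · calc _ ≤ 1 * ‖Q p - Q p'‖ := by gcongr; exact Real.abs_sin_le_one _
          _ ≤ _ := by rw [one_mul]; exact hQL p p'
    have h2 : G p - G p' = (Real.sin p.2.2 • Q p - Real.sin p'.2.2 • Q p', 0, 0) := by
      ext <;> simp [hG]
    rw [h2, Prod.norm_def]
    simpa using h1
  obtain ⟨Φ, hΦ⟩ := exists_isFlow hGc₁ hGb hGL
  have hΦc := hΦ.contDiff hGc
  have hcomp : ∀ (p : E × ℝ × ℝ) (t : ℝ), HasDerivAt (fun t => (Φ t p).1) (G (Φ t p)).1 t ∧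
      (Φ t p).2 = (p.2.1 + t, p.2.2) := by
    intro p t
    have hd : ∀ t, HasDerivAt (fun t => Φ t p) (G (Φ t p)) t := hΦ.deriv p
    refine ⟨(ContinuousLinearMap.fst ℝ E (ℝ × ℝ)).hasFDerivAt.comp_hasDerivAt t (hd t), ?_⟩
    have hd2 : ∀ t, HasDerivAt (fun t => (Φ t p).2 - (t, (0 : ℝ))) 0 t := fun t => by
      have h1 := (ContinuousLinearMap.snd ℝ E (ℝ × ℝ)).hasFDerivAt.comp_hasDerivAt t (hd t)
      have h2 : HasDerivAt (fun t : ℝ => (t, (0 : ℝ))) (1, 0) t :=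
        (hasDerivAt_id t).prodMk (hasDerivAt_const t 0)
      simpa [hG] using! h1.sub h2
    have h3 := is_const_of_deriv_eq_zero (fun t => (hd2 t).differentiableAt)
      (fun t => (hd2 t).deriv) t 0
    rw [hΦ.zero, sub_eq_iff_eq_add] at h3
    rw [h3]
    ext <;> simp
  have hX : ∀ (x : E) (s ε t : ℝ), HasDerivAt (fun t => (Φ t (x, s, ε)).1)
      (Real.sin ε • F (Φ t (x, s, ε)).1 (y + (s + t) • (z - y))) t := by
    intro x s ε t
    have := hcomp (x, s, ε) t
    simpa [hG, hQ, this.2] using! this.1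
  have hyC : y ∈ C := hyz (left_mem_segment ℝ y z)
  have hzC : z ∈ C := hyz (right_mem_segment ℝ y z)
  refine ⟨fun ε x => (Φ 1 (x, 0, ε)).1, ?_, ?_, ?_, ?_, ?_⟩
  · refine contDiff_fst.comp (hΦc.comp (g := fun z : (E × ℝ × ℝ) × ℝ => Φ z.2 z.1)
      (f := fun z : ℝ × E => ((z.2, 0, z.1), 1)) ?_)
    exact (contDiff_snd.prodMk (contDiff_const.prodMk contDiff_fst)).prodMk contDiff_const
  · intro x
    have hd : ∀ t, HasDerivAt (fun t => (Φ t (x, 0, 0)).1) 0 t := fun t => by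
      simpa using! hX x 0 0 t
    have := is_const_of_deriv_eq_zero (fun t => (hd t).differentiableAt)
      (fun t => (hd t).deriv) 1 0
    rw [this, hΦ.zero]
  · intro ε x
    have h0 : (Φ 0 (x, 0, ε)).1 = x := by rw [hΦ.zero]
    constructor
    · intro h
      have := mem_of_tangent hK hL' htan (hX x 0 ε) h 0
      rwa [h0] at this
    · intro h
      exact mem_of_tangent hK hL' htan (hX x 0 ε) (t₀ := 0) (by rwa [h0]) 1
  · intro ε x
    -- A preimage is found by flowing back for time one from the far end `s = 1` of the segment.
    have h1 := (hcomp (x, 1, ε) (-1)).2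
    refine ⟨(Φ (-1) (x, 1, ε)).1, ?_⟩
    have h2 : ((Φ (-1) (x, 1, ε)).1, 0, ε) = Φ (-1) (x, 1, ε) := by
      refine Prod.ext rfl ?_
      rw [h1]
      simp
    have h3 := hΦ.add hGc₁ (-1) 1 (x, 1, ε)
    simp only [h2]
    rw [← h3]
    simp [hΦ.zero]
  · intro ε hε x
    -- Slowing time by the factor `sin ε` removes the factor from the field and makes `y` move with
    -- velocity `(z - y) / sin ε`. The bound by the diameter is the same for every segment.
    refine .single ⟨(Real.sin ε)⁻¹ • (z - y), Real.sin ε, fun t => (Φ ((Real.sin ε)⁻¹ * t) (x, 0, ε)).1,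
      ?_, hε.le, ?_, ?_, ?_, ?_, ?_⟩
    · rw [norm_smul, norm_inv, Real.norm_eq_abs, abs_of_pos hε, div_eq_inv_mul, ← dist_eq_norm]
      gcongr
      exact Metric.dist_le_diam_of_mem hC hzC hyC
    · intro t
      have h1 := (hX x 0 ε ((Real.sin ε)⁻¹ * t)).scomp t
        ((hasDerivAt_id t).const_mul (Real.sin ε)⁻¹)
      refine h1.congr_deriv ?_
      rw [mul_one, smul_smul, inv_mul_cancel₀ hε.ne', one_smul, zero_add, smul_smul,
        mul_comm t]
    · simp [hΦ.zero]
    · simp only [inv_mul_cancel₀ hε.ne']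
    · simp [smul_smul, mul_inv_cancel₀ hε.ne']
    · intro t ht
      refine hyz ?_
      rw [segment_eq_image']
      refine ⟨t * (Real.sin ε)⁻¹, ⟨mul_nonneg ht.1 (inv_nonneg.2 hε.le), ?_⟩, by
        simp only [smul_smul]⟩
      rw [← div_eq_mul_inv]
      exact div_le_one_of_le₀ ht.2 hε.le

theorem exists_isSlide (hF : ContDiff ℝ ∞ fun z : E × V => F z.1 z.2) {b L : NNReal}
    (hb : ∀ x u, ‖F x u‖ ≤ b) (hL : LipschitzWith L fun z : E × V => F z.1 z.2) (hK : IsClosed K)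
    (htan : ∀ q ∈ K, IsTangentGraphAt K W F q) (hC : Bornology.IsBounded C)
    (hconn : IsPolygonallyConnected C) {y z : V} (hy : y ∈ C) (hz : z ∈ C) :
    ∃ A, IsSlide F K C y z A := by
  induction hconn y hy z hz with
  | refl => exact ⟨_, .refl y⟩
  | tail _ hst ih =>
    obtain ⟨A, hA⟩ := ih (hst (left_mem_segment ℝ _ _))
    obtain ⟨B, hB⟩ := exists_isSlide_segment hF hb hL hK htan hC hst
    exact ⟨_, hA.trans hB⟩

/-- The letters of the steering system: slide from `c` to `u`, follow the field `F · u`, and slide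
back to `c`. -/
theorem exists_steeringSystem (hF : ContDiff ℝ ∞ fun z : E × V => F z.1 z.2) {b L : NNReal}
    (hb : ∀ x u, ‖F x u‖ ≤ b) (hL : LipschitzWith L fun z : E × V => F z.1 z.2) (hK : IsClosed K)
    (htan : ∀ q ∈ K, IsTangentGraphAt K W F q) (hC : Bornology.IsBounded C)
    (hconn : IsPolygonallyConnected C) {c : V} (hc : c ∈ C) :
    ∃ ℓ : C → ℝ → ℝ → E → E, SteeringSystem (fun x (u : C) => F x u) K ℓ b L ∧
      ∀ ε, 0 < Real.sin ε →
        (∀ x x', Steers ℓ ε x x' →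
          Relation.ReflTransGen (SlideStep F C (Metric.diam C / Real.sin ε)) (x, c) (x', c)) ∧
        ∀ y ∈ C, ∀ x ∈ K,
          (∃ x' ∈ K, Relation.ReflTransGen (SlideStep F C (Metric.diam C / Real.sin ε))
            (x, y) (x', c)) ∧
          ∃ x' ∈ K, Relation.ReflTransGen (SlideStep F C (Metric.diam C / Real.sin ε))
            (x', c) (x, y) := by
  have hL' : ∀ x x' u, ‖F x u - F x' u‖ ≤ L * ‖x - x'‖ := fun x x' u => by
    have := hL.dist_le_mul (x, u) (x', u)
    rwa [Prod.dist_eq, dist_self, max_eq_left dist_nonneg, dist_eq_norm, dist_eq_norm] at this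
  have hFu : ∀ u : C, ContDiff ℝ ∞ fun x => F x u := fun u =>
    hF.comp (f := fun x : E => (x, (u : V))) (contDiff_id.prodMk contDiff_const)
  have hFu₁ : ∀ u : C, ContDiff ℝ 1 fun x => F x u := fun u =>
    (hFu u).of_le (by exact_mod_cast le_top)
  choose A hA using fun u : C => exists_isSlide hF hb hL hK htan hC hconn hc u.2
  choose B hB using fun u : C => exists_isSlide hF hb hL hK htan hC hconn u.2 hc
  choose φ hφ using fun u : C => exists_isFlow (hFu₁ u) (fun x => hb x u)
    (LipschitzWith.of_dist_le_mul fun x y => by simpa [dist_eq_norm] using hL' x y u)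
  have hφK : ∀ u t x, φ u t x ∈ K ↔ x ∈ K := by
    intro u t x
    have hd : ∀ t, HasDerivAt (fun t => φ u t x) ((1 : ℝ) • F (φ u t x) u) t := fun t => by
      rw [one_smul]; exact (hφ u).deriv x t
    constructor
    · intro h
      simpa [(hφ u).zero] using
        mem_of_tangent hK hL' htan (y := fun _ => (u : V)) hd h 0
    · intro h
      exact mem_of_tangent hK hL' htan (y := fun _ => (u : V)) hd (t₀ := 0)
        (by simpa [(hφ u).zero] using h) t
  refine ⟨fun u ε t x => B u ε (φ u t (A u ε x)), ⟨fun x u => hb x u, ?_, hFu₁, ?_, ?_, ?_⟩, ?_⟩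
  · intro x x' u u'
    have := hL.dist_le_mul (x, (u : V)) (x', (u' : V))
    rw [Prod.dist_eq, dist_eq_norm, dist_eq_norm] at this
    refine this.trans ?_
    gcongr
    exact max_le_add_of_nonneg (norm_nonneg _) dist_nonneg
  · intro u
    refine (hB u).contDiff.comp (g := fun z : ℝ × E => B u z.1 z.2)
      (f := fun z : ℝ × ℝ × E => (z.1, φ u z.2.1 (A u z.1 z.2.2))) (contDiff_fst.prodMk ?_)
    refine ((hφ u).contDiff (hFu u)).comp (g := fun z : E × ℝ => φ u z.2 z.1)
      (f := fun z : ℝ × ℝ × E => (A u z.1 z.2.2, z.2.1))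
      (ContDiff.prodMk ?_ (contDiff_fst.comp contDiff_snd))
    exact (hA u).contDiff.comp (g := fun z : ℝ × E => A u z.1 z.2)
      (f := fun z : ℝ × ℝ × E => (z.1, z.2.2))
      (contDiff_fst.prodMk (contDiff_snd.comp contDiff_snd))
  · intro u ε t x
    rw [(hB u).mem_iff, hφK, (hA u).mem_iff]
  · intro u
    refine ⟨fun x => by rw [(hA u).zero, (hB u).zero, (hφ u).zero], fun x t => ?_⟩
    simp only [(hA u).zero, (hB u).zero]
    exact (hφ u).deriv x t
  · intro ε hε
    refine ⟨?_, fun y hy x hx => ⟨?_, ?_⟩⟩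
    · rintro x x' ⟨w, rfl⟩
      induction w generalizing x with
      | nil => simpa using .refl
      | cons l w ih =>
        obtain ⟨u, t⟩ := l
        rw [run_cons]
        refine Relation.ReflTransGen.trans ?_ (ih _)
        refine ((hA u).steps ε hε x).trans (.trans (.single ?_) ((hB u).steps ε hε _))
        refine ⟨0, t, fun t => φ u t (A u ε x), ?_, t.2, fun s => ?_, ?_, rfl, ?_, fun s _ => ?_⟩
        · simpa using! div_nonneg Metric.diam_nonneg hε.le
        · simpa using! (hφ u).deriv (A u ε x) s
        · simp [(hφ u).zero]
        · simp
        · simp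
    · exact ⟨_, ((hB ⟨y, hy⟩).mem_iff ε x).2 hx, (hB ⟨y, hy⟩).steps ε hε x⟩
    · obtain ⟨x', rfl⟩ := (hA ⟨y, hy⟩).surjective ε x
      exact ⟨x', ((hA ⟨y, hy⟩).mem_iff ε x').1 hx, (hA ⟨y, hy⟩).steps ε hε x'⟩

end Slides

end ControlSystem

/-! ### Absolutely continuous curves in manifolds -/

namespace ControlSystem
open Filter Topology

theorem absolutelyContinuousOnInterval_comp {X Y : Type*} [PseudoMetricSpace X]
    [PseudoMetricSpace Y] {g : X → Y} {f : ℝ → X} {s : Set X} {k : NNReal} {a b : ℝ}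
    (hg : LipschitzOnWith k g s) (hf : AbsolutelyContinuousOnInterval f a b)
    (hs : MapsTo f (uIcc a b) s) : AbsolutelyContinuousOnInterval (g ∘ f) a b := by
  unfold AbsolutelyContinuousOnInterval at *
  refine squeeze_zero' (Eventually.of_forall fun _ => Finset.sum_nonneg fun _ _ => dist_nonneg) ?_
    (by simpa using hf.const_mul (k : ℝ))
  rw [eventually_inf_principal]
  refine Eventually.of_forall fun z hz => ?_
  rw [Finset.mul_sum]
  refine Finset.sum_le_sum fun i hi => ?_
  exact hg.dist_le_mul _ (hs (hz.1 i hi).1) _ (hs (hz.1 i hi).2)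

section Curves

variable {E H N P : Type*} [NormedAddCommGroup E] [NormedSpace ℝ E] [TopologicalSpace H]
  {I : ModelWithCorners ℝ E H} [TopologicalSpace N] [ChartedSpace H N]
  [NormedAddCommGroup P] [NormedSpace ℝ P]

theorem exists_lipschitzOnWith_comp_extChartAt_symm [I.Boundaryless] [IsManifold I 1 N]
    {J : N → P} (hJ : ContMDiff I 𝓘(ℝ, P) 1 J) (z : N) :
    ∃ k, ∃ s ∈ 𝓝 (extChartAt I z z), LipschitzOnWith k (J ∘ (extChartAt I z).symm) s := by
  refine ContDiffAt.exists_lipschitzOnWith (𝕂 := ℝ) ?_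
  rw [← contMDiffAt_iff_contDiffAt]
  refine ContMDiffAt.comp (I' := I) _ hJ.contMDiffAt ?_
  exact (contMDiffOn_extChartAt_symm z).contMDiffAt (extChartAt_target_mem_nhds z)

/-- An absolutely continuous curve in a manifold whose derivative is almost everywhere equal to a
continuous function has that derivative everywhere. -/
theorem hasDerivWithinAt_of_ae [CompleteSpace P] [I.Boundaryless] [IsManifold I 1 N] {J : N → P}
    (hJ : ContMDiff I 𝓘(ℝ, P) 1 J) {T : ℝ} {γ : ℝ → N} (hγ : IsAbsolutelyContinuousCurve I T γ)
    {a b : ℝ} (ha : 0 ≤ a) (hab : a < b) (hb : b ≤ T) {g : ℝ → P} (hg : ContinuousOn g (Icc a b))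
    (hd : ∀ᵐ t, t ∈ Ioo a b → HasDerivAt (J ∘ γ) (g t) t) {t : ℝ} (ht : t ∈ Icc a b) :
    HasDerivWithinAt (J ∘ γ) (g t) (Icc a b) t := by
  -- The continuous extension makes the primitive `Q` differentiable at the endpoints too. Near `t`,
  -- `J` read in a chart is Lipschitz, so `J ∘ γ` is absolutely continuous; minus `Q` it has zero
  -- derivative almost everywhere and is constant.
  set g' : ℝ → P := IccExtend hab.le ((Icc a b).domRestrict g) with hg'
  have hgc : Continuous g' := (continuousOn_iff_continuous_domRestrict.1 hg).Icc_extend'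
  have hgg : ∀ s ∈ Icc a b, g' s = g s := fun s hs => by
    rw [hg', IccExtend_of_mem _ _ hs]; rfl
  set Q : ℝ → P := fun t => ∫ s in a..t, g' s
  have hQ : ∀ t, HasDerivAt Q (g' t) t := fun t =>
    (hgc.integral_hasStrictDerivAt a t).hasDerivAt
  have hQc : ContDiff ℝ 1 Q := contDiff_one_iff_deriv.2
    ⟨fun t => (hQ t).differentiableAt, by
      have : deriv Q = g' := funext fun t => (hQ t).deriv
      rwa [this]⟩
  obtain ⟨k, s, hs, hks⟩ := exists_lipschitzOnWith_comp_extChartAt_symm hJ (γ t)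
  have hγt : ContinuousWithinAt γ (Icc a b) t :=
    (hγ.1 t ⟨ha.trans ht.1, ht.2.trans hb⟩).mono (Icc_subset_Icc ha hb)
  have hnear : ∀ᶠ r in 𝓝[Icc a b] t, γ r ∈ (chartAt H (γ t)).source ∧
      extChartAt I (γ t) (γ r) ∈ s := by
    have h1 : ∀ᶠ y in 𝓝 (γ t), y ∈ (chartAt H (γ t)).source :=
      (chartAt H (γ t)).open_source.mem_nhds (mem_chart_source H (γ t))
    exact hγt.eventually (h1.and ((continuousAt_extChartAt (I := I) (γ t)).eventually hs))
  obtain ⟨δ, hδ, hball⟩ := Metric.mem_nhdsWithin_iff.1 hnear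
  set c := max a (t - δ / 2) with hc
  set d := min b (t + δ / 2) with hd'
  have hct : c ≤ t := max_le ht.1 (by linarith)
  have htd : t ≤ d := le_min ht.2 (by linarith)
  have hcd : c ≤ d := hct.trans htd
  have hac : a ≤ c := le_max_left _ _
  have hdb : d ≤ b := min_le_left _ _
  have hin : ∀ r ∈ Icc c d, γ r ∈ (chartAt H (γ t)).source ∧ extChartAt I (γ t) (γ r) ∈ s := by
    intro r hr
    refine hball ⟨?_, hac.trans hr.1, hr.2.trans hdb⟩
    rw [Metric.mem_ball, Real.dist_eq, abs_lt]
    have h1 : t - δ / 2 ≤ r := (le_max_right _ _).trans hr.1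
    have h2 : r ≤ t + δ / 2 := hr.2.trans (min_le_right _ _)
    constructor <;> linarith
  have hac₁ : AbsolutelyContinuousOnInterval ((J ∘ (extChartAt I (γ t)).symm) ∘
      (extChartAt I (γ t) ∘ γ)) c d :=
    absolutelyContinuousOnInterval_comp hks
      (hγ.2 (γ t) c d (ha.trans hac) hcd (hdb.trans hb) fun r hr => (hin r hr).1)
      (by rw [uIcc_of_le hcd]; exact fun r hr => (hin r hr).2)
  have heq : ∀ r ∈ Icc c d, ((J ∘ (extChartAt I (γ t)).symm) ∘ (extChartAt I (γ t) ∘ γ)) r =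
      (J ∘ γ) r := fun r hr => by
    simp only [Function.comp_apply]
    rw [(extChartAt I (γ t)).left_inv (by rw [extChartAt_source]; exact (hin r hr).1)]
  have hac₂ : AbsolutelyContinuousOnInterval Q c d :=
    hQc.contDiffOn.absolutelyContinuousOnInterval
  obtain ⟨C, hC⟩ := (hac₁.sub hac₂).const_of_ae_hasDerivAt_zero (by
    have hcd0 : ∀ᵐ r : ℝ, r ≠ c ∧ r ≠ d := by
      have h1 : ∀ᵐ r : ℝ, r ∉ ({c} : Set ℝ) := measure_eq_zero_iff_ae_notMem.1 (by simp)
      have h2 : ∀ᵐ r : ℝ, r ∉ ({d} : Set ℝ) := measure_eq_zero_iff_ae_notMem.1 (by simp)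
      filter_upwards [h1, h2] with r h1 h2 using ⟨h1, h2⟩
    filter_upwards [hd, hcd0] with r hr ⟨hrc, hrd⟩ hrcd
    rw [uIcc_of_le hcd] at hrcd
    have hr' : r ∈ Ioo c d := ⟨lt_of_le_of_ne hrcd.1 hrc.symm, lt_of_le_of_ne hrcd.2 hrd⟩
    have hrab : r ∈ Ioo a b := ⟨hac.trans_lt hr'.1, hr'.2.trans_le hdb⟩
    have h1 := (hr hrab).sub (hQ r)
    rw [hgg r (Ioo_subset_Icc_self hrab), sub_self] at h1
    refine h1.congr_of_eventuallyEq ?_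
    filter_upwards [Ioo_mem_nhds hr'.1 hr'.2] with r' hr'
    simp only [Pi.sub_apply, heq r' (Ioo_subset_Icc_self hr')])
  have hfin : ∀ r ∈ Icc c d, (J ∘ γ) r = C + Q r := fun r hr => by
    rw [← hC r (by rwa [uIcc_of_le hcd]), Pi.sub_apply, heq r hr, sub_add_cancel]
  have hmem : Icc c d ∈ 𝓝[Icc a b] t := by
    refine Metric.mem_nhdsWithin_iff.2 ⟨δ / 2, half_pos hδ, fun r hr => ?_⟩
    have := abs_lt.1 (Real.dist_eq r t ▸ Metric.mem_ball.1 hr.1)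
    exact ⟨max_le hr.2.1 (by linarith [this.1]), le_min hr.2.2 (by linarith [this.2])⟩
  rw [← hgg t ht]
  refine ((hQ t).const_add C).hasDerivWithinAt.congr_of_eventuallyEq ?_ (hfin t ⟨hct, htd⟩)
  filter_upwards [hmem] with r hr using hfin r hr

end Curves

end ControlSystem

/-! ### Piecewise constant controls and concatenation of trajectories -/

namespace ControlSystem
open Filter Topology

theorem IsPiecewiseConstant.reflTransGen {N V : Type*} {T : ℝ} {u : ℝ → V}
    (h : IsPiecewiseConstant T u) {R : N → N → Prop} {γ : ℝ → N}
    (hR : ∀ a b, 0 ≤ a → a < b → b ≤ T → (∀ t ∈ Ico a b, u t = u a) → R (γ a) (γ b)) :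
    Relation.ReflTransGen R (γ 0) (γ T) := by
  obtain ⟨k, s, hs, h0, hT, hc⟩ := h
  have key : ∀ i, Relation.ReflTransGen R (γ 0) (γ (s i)) := by
    intro i
    induction i using Fin.induction with
    | zero => rw [h0]
    | succ i ih =>
      refine ih.tail (hR _ _ ?_ (hs i.castSucc_lt_succ) ?_ (hc i))
      · rw [← h0]; exact hs.monotone (Fin.zero_le _)
      · rw [← hT]; exact hs.monotone (Fin.le_last _)
  rw [← hT]
  exact key _

theorem isPiecewiseConstant_zero {V : Type*} (u : ℝ → V) : IsPiecewiseConstant 0 u :=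
  ⟨0, fun _ => 0, fun i j h => absurd (Subsingleton.elim (α := Fin 1) i j) h.ne, rfl, rfl, fun i => i.elim0⟩

theorem IsPiecewiseConstant.snoc {V : Type*} {T S : ℝ} {u : ℝ → V} (h : IsPiecewiseConstant T u)
    (hS : 0 < S) (c : V) : IsPiecewiseConstant (T + S) (fun t => if t < T then u t else c) := by
  obtain ⟨k, s, hs, h0, hT, hc⟩ := h
  refine ⟨k + 1, Fin.snoc s (T + S), ?_, ?_, by simp, ?_⟩
  · refine Fin.strictMono_iff_lt_succ.2 fun i => ?_
    induction i using Fin.lastCases with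
    | last =>
      rw [Fin.snoc_castSucc, Fin.succ_last, Fin.snoc_last, hT]
      linarith
    | cast i =>
      rw [Fin.snoc_castSucc, Fin.succ_castSucc, Fin.snoc_castSucc]
      exact hs i.castSucc_lt_succ
  · rw [← Fin.castSucc_zero, Fin.snoc_castSucc, h0]
  · intro i t ht
    induction i using Fin.lastCases with
    | last =>
      rw [Fin.snoc_castSucc, hT] at ht
      rw [Fin.snoc_castSucc, hT]
      beta_reduce
      rw [if_neg (not_lt.2 ht.1), if_neg (lt_irrefl T)]
    | cast i =>
      rw [Fin.snoc_castSucc, Fin.succ_castSucc, Fin.snoc_castSucc] at ht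
      rw [Fin.snoc_castSucc]
      have h1 : s i.succ ≤ T := hT ▸ hs.monotone (Fin.le_last _)
      beta_reduce
      rw [if_pos (ht.2.trans_le h1), if_pos ((hs i.castSucc_lt_succ).trans_le h1)]
      exact hc i t ht

section Curves

variable {E H N P V : Type*} [NormedAddCommGroup E] [NormedSpace ℝ E] [TopologicalSpace H]
  {I : ModelWithCorners ℝ E H} [TopologicalSpace N] [ChartedSpace H N]
  [NormedAddCommGroup P] [NormedSpace ℝ P] {F : (x : N) → V → TangentSpace I x}

theorem hasDerivAt_comp_of_hasMFDerivAt {J : N → P} {γ : ℝ → N} {t : ℝ} {v : TangentSpace I (γ t)}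
    {J' : TangentSpace I (γ t) →L[ℝ] P} (hJ : HasMFDerivAt I 𝓘(ℝ, P) J (γ t) J')
    (hγ : HasMFDerivAt 𝓘(ℝ, ℝ) I γ t ((1 : ℝ →L[ℝ] ℝ).smulRight v)) :
    HasDerivAt (J ∘ γ) (J' v) t := by
  have h1 : HasFDerivAt (J ∘ γ) ((J' : E →L[ℝ] P).comp ((1 : ℝ →L[ℝ] ℝ).smulRight (v : E))) t :=
    hasMFDerivAt_iff_hasFDerivAt.1 (hJ.comp t hγ)
  refine h1.hasDerivAt.congr_deriv ?_
  exact congrArg J' (one_smul ℝ v)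

/-- On an interval on which the control is constant, the derivative of a trajectory is given by the
field at all times. -/
theorem IsTrajectory.hasDerivWithinAt [CompleteSpace P] [I.Boundaryless] [IsManifold I 1 N]
    {T : ℝ} {u : ℝ → V} {γ : ℝ → N} (hγ : IsTrajectory I F T u γ) {J : N → P}
    (hJ : ContMDiff I 𝓘(ℝ, P) 1 J) {a b : ℝ} (ha : 0 ≤ a) (hab : a < b) (hb : b ≤ T)
    (hu : ∀ t ∈ Ico a b, u t = u a) {g : ℝ → P} (hg : ContinuousOn g (Icc a b))
    (hgJ : ∀ t ∈ Icc a b, mfderiv I 𝓘(ℝ, P) J (γ t) (F (γ t) (u a)) = g t) {t : ℝ}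
    (ht : t ∈ Icc a b) : HasDerivWithinAt (J ∘ γ) (g t) (Icc a b) t := by
  refine hasDerivWithinAt_of_ae hJ hγ.1 ha hab hb hg ?_ ht
  filter_upwards [(ae_restrict_iff' measurableSet_Icc).1 hγ.2] with r hr hr'
  have h1 := hr ⟨ha.trans hr'.1.le, hr'.2.le.trans hb⟩
  rw [hu r (Ioo_subset_Ico_self hr')] at h1
  rw [← hgJ r (Ioo_subset_Icc_self hr')]
  exact hasDerivAt_comp_of_hasMFDerivAt (hJ.mdifferentiableAt one_ne_zero).hasMFDerivAt h1

/-- A `C¹` map to a normed space which has local `C¹` left inverses. -/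
structure HasLocalRetractions (I : ModelWithCorners ℝ E H) (J : N → P) : Prop where
  contMDiff : ContMDiff I 𝓘(ℝ, P) 1 J
  isInducing : IsInducing J
  exists_retraction : ∀ x, ∃ r : P → N, ContMDiffAt 𝓘(ℝ, P) I 1 r (J x) ∧ ∀ᶠ y in 𝓝 x, r (J y) = y

/-- Near `t` the curve equals `r ∘ (J ∘ γ)`, and `Dr ∘ DJ = id` recovers `v`. Continuity of `γ`,
needed to stay where `r` retracts, comes from `J` being inducing. -/
theorem HasLocalRetractions.hasMFDerivAt {J : N → P} (hJ : HasLocalRetractions I J) {γ : ℝ → N}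
    {t : ℝ} {v : TangentSpace I (γ t)}
    (hd : HasDerivAt (J ∘ γ) (mfderiv I 𝓘(ℝ, P) J (γ t) v) t) :
    HasMFDerivAt 𝓘(ℝ, ℝ) I γ t ((1 : ℝ →L[ℝ] ℝ).smulRight v) := by
  obtain ⟨r, hr, hrJ⟩ := hJ.exists_retraction (γ t)
  have hc : ContinuousAt γ t := hJ.isInducing.continuousAt_iff.2 hd.continuousAt
  have hJd := (hJ.contMDiff.mdifferentiableAt (x := γ t) one_ne_zero).hasMFDerivAt
  have hrd := (hr.mdifferentiableAt one_ne_zero).hasMFDerivAt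
  have hid : HasMFDerivAt I I (r ∘ J) (γ t) (ContinuousLinearMap.id ℝ E) :=
    (hasMFDerivAt_id (γ t)).congr_of_eventuallyEq hrJ
  have huniq := hasMFDerivAt_unique (hrd.comp (γ t) hJd) hid
  have h1 : HasMFDerivAt 𝓘(ℝ, ℝ) 𝓘(ℝ, P) (J ∘ γ) t
      ((1 : ℝ →L[ℝ] ℝ).smulRight (mfderiv I 𝓘(ℝ, P) J (γ t) v)) :=
    hasMFDerivAt_iff_hasFDerivAt.2 hd.hasFDerivAt
  have h2 := (hrd.comp (f := J ∘ γ) t h1).congr_of_eventuallyEq (f₁ := γ)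
    ((hc.eventually hrJ).mono fun s hs => hs.symm)
  have h3 : (mfderiv 𝓘(ℝ, P) I r (J (γ t))).comp
      ((1 : ℝ →L[ℝ] ℝ).smulRight (mfderiv I 𝓘(ℝ, P) J (γ t) v)) =
      (1 : ℝ →L[ℝ] ℝ).smulRight v := by
    ext
    have := congrArg (fun A : E →L[ℝ] E => A v) huniq
    exact (congrArg _ (one_smul ℝ _)).trans (this.trans (one_smul ℝ v).symm)
  exact h3 ▸ h2

/-- A chart composed with a local retraction is `C¹`, so the coordinates of the curve are locally
Lipschitz, hence Lipschitz on a compact interval. -/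
theorem HasLocalRetractions.isAbsolutelyContinuousCurve [I.Boundaryless] [IsManifold I 1 N]
    {J : N → P} (hJ : HasLocalRetractions I J) {T : ℝ} {γ : ℝ → N} {k : NNReal}
    (hk : LipschitzOnWith k (J ∘ γ) (Icc 0 T)) : IsAbsolutelyContinuousCurve I T γ := by
  have hc : ContinuousOn γ (Icc 0 T) := hJ.isInducing.continuousOn_iff.2 hk.continuousOn
  refine ⟨hc, fun z a b ha hab hb hz => ?_⟩
  have hsub : Icc a b ⊆ Icc 0 T := Icc_subset_Icc ha hb
  have hloc : LocallyLipschitzOn (Icc a b) (extChartAt I z ∘ γ) := by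
    intro t ht
    obtain ⟨r, hr, hrJ⟩ := hJ.exists_retraction (γ t)
    have hrt : r (J (γ t)) = γ t := hrJ.self_of_nhds
    have hcd : ContDiffAt ℝ 1 (extChartAt I z ∘ r) (J (γ t)) := by
      rw [← contMDiffAt_iff_contDiffAt]
      refine ContMDiffAt.comp (I' := I) _ ?_ hr
      rw [hrt]
      exact (contMDiffOn_extChartAt (I := I) (x := z)).contMDiffAt
        ((chartAt H z).open_source.mem_nhds (hz ht))
    obtain ⟨k', s, hs, hk'⟩ := hcd.exists_lipschitzOnWith
    have hct : ContinuousWithinAt γ (Icc a b) t := (hc t (hsub ht)).mono hsub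
    have hJct : ContinuousWithinAt (J ∘ γ) (Icc a b) t :=
      (hk.continuousOn t (hsub ht)).mono hsub
    refine ⟨k' * k, {x | x ∈ Icc a b ∧ r (J (γ x)) = γ x ∧ (J ∘ γ) x ∈ s}, ?_, ?_⟩
    · filter_upwards [self_mem_nhdsWithin, hct.eventually hrJ, hJct.eventually hs] with x h1 h2 h3
      exact ⟨h1, h2, h3⟩
    · have h1 : LipschitzOnWith (k' * k) ((extChartAt I z ∘ r) ∘ (J ∘ γ))
          {x | x ∈ Icc a b ∧ r (J (γ x)) = γ x ∧ (J ∘ γ) x ∈ s} :=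
        hk'.comp (hk.mono fun x hx => hsub hx.1) fun x hx => hx.2.2
      intro x hx y hy
      have := h1 hx hy
      simpa only [Function.comp_apply, hx.2.1, hy.2.1] using this
  obtain ⟨k', hk'⟩ := hloc.exists_lipschitzOnWith_of_compact isCompact_Icc
  exact LipschitzOnWith.absolutelyContinuousOnInterval (by rwa [uIcc_of_le hab])

theorem hasMFDerivAt_congr {γ γ' : ℝ → N} {t : ℝ} {u u' : V} (h : γ' =ᶠ[𝓝 t] γ) (hu : u' = u)
    (hd : HasMFDerivAt 𝓘(ℝ, ℝ) I γ t ((1 : ℝ →L[ℝ] ℝ).smulRight (F (γ t) u))) :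
    HasMFDerivAt 𝓘(ℝ, ℝ) I γ' t ((1 : ℝ →L[ℝ] ℝ).smulRight (F (γ' t) u')) := by
  subst hu
  have h2 := hd.congr_of_eventuallyEq h
  have h3 : (F (γ t) u' : E) = (F (γ' t) u' : E) :=
    congrArg (fun x => (F x u' : E)) h.eq_of_nhds.symm
  have h4 : ((1 : ℝ →L[ℝ] ℝ).smulRight (F (γ t) u' : E)) =
      (1 : ℝ →L[ℝ] ℝ).smulRight (F (γ' t) u' : E) :=
    congrArg (fun e : E => (1 : ℝ →L[ℝ] ℝ).smulRight e) h3
  exact h4 ▸ h2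

/-- A piece of trajectory with constant control, which is part of a Lipschitz trajectory defined
at all times. -/
def ConstantStep (I : ModelWithCorners ℝ E H) (F : (x : N) → V → TangentSpace I x) (S : Set N)
    (U : Set V) (J : N → P) (p q : N) : Prop :=
  ∃ u ∈ U, ∃ (T : ℝ) (γ : ℝ → N) (k : NNReal), 0 ≤ T ∧
    (∀ t ∈ Icc 0 T, HasDerivAt (J ∘ γ) (mfderiv I 𝓘(ℝ, P) J (γ t) (F (γ t) u)) t) ∧
    LipschitzWith k (J ∘ γ) ∧ (∀ t ∈ Icc 0 T, γ t ∈ S) ∧ γ 0 = p ∧ γ T = q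

/-- Reachability by trajectories which are Lipschitz after composition with `J`. -/
def LipschitzReachable (I : ModelWithCorners ℝ E H) (F : (x : N) → V → TangentSpace I x)
    (S : Set N) (U : Set V) (J : N → P) (p q : N) : Prop :=
  ∃ (T : ℝ) (u : ℝ → V) (γ : ℝ → N) (k : NNReal), 0 ≤ T ∧
    IsPiecewiseConstant T u ∧ (∀ t ∈ Icc 0 T, u t ∈ U) ∧ LipschitzOnWith k (J ∘ γ) (Icc 0 T) ∧
    (∀ᵐ t, t ∈ Icc 0 T →
      HasMFDerivAt 𝓘(ℝ, ℝ) I γ t ((1 : ℝ →L[ℝ] ℝ).smulRight (F (γ t) (u t)))) ∧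
    (∀ t ∈ Icc 0 T, γ t ∈ S) ∧ γ 0 = p ∧ γ T = q

/-- A Lipschitz bound on `J ∘ γ` passes through the junction by the triangle inequality, and the
junction time is negligible for the differential equation. This is why concatenation is done here
and absolute continuity is deduced only at the end. -/
theorem LipschitzReachable.snoc {S : Set N} {U : Set V} {J : N → P}
    (hJ : HasLocalRetractions I J) {p q q' : N} (hpq : LipschitzReachable I F S U J p q)
    (hqq' : ConstantStep I F S U J q q') : LipschitzReachable I F S U J p q' := by
  obtain ⟨T, u, γ, k, hT, hpc, hu, hk, hd, hS, h0, rfl⟩ := hpq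
  obtain ⟨c, hc, R, δ, k', hR, hδ, hk', hδS, hδ0, rfl⟩ := hqq'
  -- Partitions are strictly increasing, so a step of zero duration must be dropped.
  obtain rfl | hR := hR.eq_or_lt
  · rw [hδ0]
    exact ⟨T, u, γ, k, hT, hpc, hu, hk, hd, hS, h0, rfl⟩
  set σ : ℝ → N := fun t => if t ≤ T then γ t else δ (t - T) with hσ
  have hσ₁ : ∀ t, t ≤ T → σ t = γ t := fun t ht => if_pos ht
  have hσ₂ : ∀ t, T ≤ t → σ t = δ (t - T) := fun t ht => by
    rcases ht.eq_or_lt with rfl | ht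
    · rw [hσ₁ _ le_rfl, sub_self, hδ0]
    · exact if_neg (not_le.2 ht)
  refine ⟨T + R, fun t => if t < T then u t else c, σ, max k k', by linarith, hpc.snoc hR c, ?_, ?_,
    ?_, ?_, ?_, ?_⟩
  · intro t ht
    dsimp only
    split_ifs with h
    · exact hu t ⟨ht.1, h.le⟩
    · exact hc
  · have e1 : ∀ x ∈ Icc 0 T, ∀ y ∈ Icc 0 T, dist ((J ∘ σ) x) ((J ∘ σ) y) ≤
        (max k k' : NNReal) * dist x y := by
      intro x hx y hy
      simp only [Function.comp_apply, hσ₁ x hx.2, hσ₁ y hy.2]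
      exact (hk.dist_le_mul x hx y hy).trans (by gcongr; exact le_max_left _ _)
    have e2 : ∀ x, T ≤ x → ∀ y, T ≤ y → dist ((J ∘ σ) x) ((J ∘ σ) y) ≤
        (max k k' : NNReal) * dist x y := by
      intro x hx y hy
      simp only [Function.comp_apply, hσ₂ x hx, hσ₂ y hy]
      refine (hk'.dist_le_mul (x - T) (y - T)).trans ?_
      rw [dist_sub_right]
      gcongr
      exact le_max_right _ _
    have e3 : ∀ x ∈ Icc 0 T, ∀ y, T ≤ y → dist ((J ∘ σ) x) ((J ∘ σ) y) ≤
        (max k k' : NNReal) * dist x y := by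
      intro x hx y hy
      refine (dist_triangle _ ((J ∘ σ) T) _).trans
        ((add_le_add (e1 x hx T ⟨hT, le_rfl⟩) (e2 T le_rfl y hy)).trans ?_)
      rw [← mul_add]
      gcongr
      rw [Real.dist_eq, Real.dist_eq, Real.dist_eq, abs_of_nonpos (by linarith [hx.2]),
        abs_of_nonpos (by linarith), abs_of_nonpos (by linarith [hx.2])]
      linarith
    refine LipschitzOnWith.of_dist_le_mul fun x hx y hy => ?_
    rcases le_total x T with hxT | hxT <;> rcases le_total y T with hyT | hyT
    · exact e1 x ⟨hx.1, hxT⟩ y ⟨hy.1, hyT⟩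
    · exact e3 x ⟨hx.1, hxT⟩ y hyT
    · rw [dist_comm, dist_comm x]; exact e3 y ⟨hy.1, hyT⟩ x hxT
    · exact e2 x hxT y hyT
  · have hne : ∀ᵐ t : ℝ, t ∉ ({T} : Set ℝ) := measure_eq_zero_iff_ae_notMem.1 (by simp)
    filter_upwards [hd, hne] with t ht htT ht'
    rcases lt_or_gt_of_ne htT with h | h
    · refine hasMFDerivAt_congr ?_ (if_pos h) (ht ⟨ht'.1, h.le⟩)
      filter_upwards [Iio_mem_nhds h] with s hs using hσ₁ s (le_of_lt hs)
    · refine hasMFDerivAt_congr (γ := fun t => δ (t - T)) ?_ (if_neg (not_lt.2 h.le)) ?_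
      · filter_upwards [Ioi_mem_nhds h] with s hs using hσ₂ s (le_of_lt hs)
      · exact hJ.hasMFDerivAt (γ := fun t => δ (t - T))
          ((hδ (t - T) ⟨by linarith, by linarith [ht'.2]⟩).comp_sub_const t T)
  · intro t ht
    rcases le_total t T with h | h
    · rw [hσ₁ t h]; exact hS t ⟨ht.1, h⟩
    · rw [hσ₂ t h]; exact hδS _ ⟨by linarith, by linarith [ht.2]⟩
  · rw [hσ₁ 0 hT, h0]
  · rw [hσ₂ _ (by linarith), add_sub_cancel_left]

theorem LipschitzReachable.reachable [I.Boundaryless] [IsManifold I 1 N] {S : Set N} {U : Set V}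
    {J : N → P} (hJ : HasLocalRetractions I J) {p q : N} (h : LipschitzReachable I F S U J p q) :
    Reachable I F S U p q := by
  obtain ⟨T, u, γ, k, hT, hpc, hu, hk, hd, h⟩ := h
  exact ⟨T, u, γ, hT, hpc, hu, ⟨hJ.isAbsolutelyContinuousCurve hk,
    (ae_restrict_iff' measurableSet_Icc).2 hd⟩, h⟩

theorem reachable_of_reflTransGen [I.Boundaryless] [IsManifold I 1 N] {S : Set N} {U : Set V}
    {J : N → P} (hJ : HasLocalRetractions I J) (hU : U.Nonempty) {p q : N} (hp : p ∈ S)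
    (h : Relation.ReflTransGen (ConstantStep I F S U J) p q) : Reachable I F S U p q := by
  suffices LipschitzReachable I F S U J p q from this.reachable hJ
  induction h with
  | refl =>
    -- Even on `[0, 0]` the control needs a value in `U` at time `0`.
    obtain ⟨c, hc⟩ := hU
    refine ⟨0, fun _ => c, fun _ => p, 0, le_rfl, isPiecewiseConstant_zero _, fun _ _ => hc, ?_, ?_,
      fun _ _ => hp, rfl, rfl⟩
    · exact LipschitzOnWith.of_dist_le_mul fun x _ y _ => by simp
    · have hne : ∀ᵐ t : ℝ, t ∉ ({0} : Set ℝ) := measure_eq_zero_iff_ae_notMem.1 (by simp)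
      filter_upwards [hne] with t ht ht'
      exact absurd (le_antisymm ht'.2 ht'.1) ht
  | tail _ hst ih => exact ih.snoc hJ hst

end Curves

end ControlSystem

/-! ### Embedding of the manifold and extension of the field -/

namespace ControlSystem
open Filter Topology

section Embedding

variable {E H M P V : Type*} [NormedAddCommGroup E] [NormedSpace ℝ E] [FiniteDimensional ℝ E]
  [TopologicalSpace H] {I : ModelWithCorners ℝ E H} [I.Boundaryless] [TopologicalSpace M]
  [ChartedSpace H M] [IsManifold I ∞ M] [NormedAddCommGroup P] [NormedSpace ℝ P]
  [FiniteDimensional ℝ P] [NormedAddCommGroup V] [NormedSpace ℝ V] {ι : M → P}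

/-- Near `p₀`, an immersed manifold is parametrized by one of its projections. -/
theorem exists_local_parametrization (hι : ContMDiff I 𝓘(ℝ, P) ∞ ι) {p₀ : M}
    (hinj : Function.Injective (mfderiv I 𝓘(ℝ, P) ι p₀)) :
    ∃ (π : P →L[ℝ] E) (ρ : E → M),
      (∀ᶠ v in 𝓝 (π (ι p₀)), ContMDiffAt 𝓘(ℝ, E) I ∞ ρ v ∧ π (ι (ρ v)) = v) ∧
      ∀ᶠ p in 𝓝 p₀, ρ (π (ι p)) = p := by
  set φ := extChartAt I p₀ with hφ
  have hφs : ∀ᶠ τ in 𝓝 (φ p₀), ContMDiffAt 𝓘(ℝ, E) I ∞ φ.symm τ := by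
    filter_upwards [(isOpen_extChartAt_target (I := I) p₀).mem_nhds (mem_extChartAt_target p₀)]
      with τ hτ
    exact (contMDiffOn_extChartAt_symm p₀).contMDiffAt
      ((isOpen_extChartAt_target (I := I) p₀).mem_nhds hτ)
  have hγ : ∀ᶠ τ in 𝓝 (φ p₀), ContDiffAt ℝ ∞ (ι ∘ φ.symm) τ := by
    filter_upwards [hφs] with τ hτ
    rw [← contMDiffAt_iff_contDiffAt]
    exact ContMDiffAt.comp (I' := I) τ hι.contMDiffAt hτ
  have hγ₀ : (ι ∘ φ.symm) (φ p₀) = ι p₀ := by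
    simp only [Function.comp_apply, hφ, extChartAt_to_inv]
  have hder : Function.Injective (fderiv ℝ (ι ∘ φ.symm) (φ p₀)) := by
    have h1 := (hι.mdifferentiableAt (x := p₀) (by simp)).mfderiv
    rw [I.range_eq_univ, fderivWithin_univ] at h1
    rw [h1] at hinj
    exact hinj
  obtain ⟨π, j, -, hj₀, hjl, hjr, hjc⟩ :=
    exists_graph_of_immersion (n := ∞) (by simp) hγ.self_of_nhds hder
  rw [hγ₀] at hj₀ hjr hjc
  have hjc := hjc hγ
  have hjt : Tendsto j (𝓝 (π (ι p₀))) (𝓝 (φ p₀)) := by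
    have := hjc.self_of_nhds.continuousAt.tendsto
    rwa [hj₀] at this
  refine ⟨π, φ.symm ∘ j, ?_, ?_⟩
  · filter_upwards [hjr, hjc, hjt.eventually hφs] with v h1 h2 h3
    exact ⟨ContMDiffAt.comp (I' := 𝓘(ℝ, E)) v h3 h2.contMDiffAt, h1⟩
  · filter_upwards [(continuousAt_extChartAt (I := I) p₀).eventually hjl,
      (chartAt H p₀).open_source.mem_nhds (mem_chart_source H p₀)] with p hp hps
    have hinv : φ.symm (φ p) = p := φ.left_inv (by rw [hφ, extChartAt_source]; exact hps)
    have hp' : j (π (ι (φ.symm (φ p)))) = φ p := hp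
    rw [hinv] at hp'
    simp only [Function.comp_apply, hp', hinv]

theorem hasLocalRetractions_of_embedding (hι : ContMDiff I 𝓘(ℝ, P) ∞ ι) (hemb : IsInducing ι)
    (hinj : ∀ p, Function.Injective (mfderiv I 𝓘(ℝ, P) ι p)) : HasLocalRetractions I ι where
  contMDiff := hι.of_le (by exact_mod_cast le_top)
  isInducing := hemb
  exists_retraction p := by
    obtain ⟨π, ρ, h1, h2⟩ := exists_local_parametrization hι (hinj p)
    refine ⟨ρ ∘ π, ?_, h2⟩
    refine ContMDiffAt.comp (I' := 𝓘(ℝ, E)) _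
      (h1.self_of_nhds.1.of_le (by exact_mod_cast le_top)) π.contDiff.contMDiff.contMDiffAt

omit [FiniteDimensional ℝ E] [I.Boundaryless] [IsManifold I ∞ M] [FiniteDimensional ℝ P] in
theorem HasLocalRetractions.prodMap_id (h : HasLocalRetractions I ι) :
    HasLocalRetractions (I.prod 𝓘(ℝ, V)) (Prod.map ι (id : V → V)) where
  contMDiff := by
    rw [modelWithCornersSelf_prod, ← chartedSpaceSelf_prod]
    exact h.contMDiff.prodMap contMDiff_id
  isInducing := h.isInducing.prodMap IsInducing.id
  exists_retraction x := by
    obtain ⟨r, hr, hr'⟩ := h.exists_retraction x.1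
    refine ⟨Prod.map r id, ?_, ?_⟩
    · rw [modelWithCornersSelf_prod, ← chartedSpaceSelf_prod]
      exact hr.prodMap contMDiffAt_id
    · rw [nhds_prod_eq]
      filter_upwards [hr'.prod_inl (𝓝 x.2)] with y hy
      exact Prod.ext hy rfl

-- Near `p₀` the embedding satisfies `ι = (ι ∘ ρ) ∘ (π ∘ ι)`; differentiating this and applying it
-- to `f p u` gives tangency. The neighbourhood comes from `ι` alone, so it serves all `u` at once.
omit [NormedAddCommGroup V] [NormedSpace ℝ V] in
theorem isTangentGraphAt_range (hι : ContMDiff I 𝓘(ℝ, P) ∞ ι) (hemb : IsInducing ι)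
    {p₀ : M} (hinj : Function.Injective (mfderiv I 𝓘(ℝ, P) ι p₀)) {F : P → V → P}
    {f : (x : M) → V → TangentSpace I x}
    (hF : ∀ p u, F (ι p) u = mfderiv I 𝓘(ℝ, P) ι p (f p u)) :
    IsTangentGraphAt (range ι) E F (ι p₀) := by
  obtain ⟨π, ρ, h1, h2⟩ := exists_local_parametrization hι hinj
  have hH : ∀ᶠ v in 𝓝 (π (ι p₀)), ContDiffAt ℝ 1 (ι ∘ ρ) v := by
    filter_upwards [h1] with v hv
    rw [← contMDiffAt_iff_contDiffAt]
    exact ContMDiffAt.comp (I' := I) v (hι.of_le (by exact_mod_cast le_top)).contMDiffAt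
      (hv.1.of_le (by exact_mod_cast le_top))
  refine ⟨π, ι ∘ ρ, hH.self_of_nhds, h1.mono fun v hv => ⟨hv.2, mem_range_self _⟩, ?_⟩
  rw [← hemb.map_nhds_eq p₀]
  refine Filter.eventually_map.2 ?_
  filter_upwards [eventually_eventually_nhds.2 h2,
    ((π.continuous.comp hemb.continuous).tendsto p₀).eventually hH] with p hp hHp
  have hp₀ := hp.self_of_nhds
  refine ⟨by simp only [Function.comp_apply, hp₀], fun u => ?_⟩
  have hιd := (hι.mdifferentiableAt (x := p) (by simp)).hasMFDerivAt
  have h3 : HasMFDerivAt I 𝓘(ℝ, P) ((ι ∘ ρ) ∘ (π ∘ ι)) p _ :=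
    HasMFDerivAt.comp p (hHp.differentiableAt one_ne_zero).hasFDerivAt.hasMFDerivAt
      (HasMFDerivAt.comp p π.hasFDerivAt.hasMFDerivAt hιd)
  have h4 := hasMFDerivAt_unique hιd (h3.congr_of_eventuallyEq
    (hp.mono fun q hq => by simp only [Function.comp_apply, hq]))
  rw [hF p u]
  exact (congrArg (fun A : E →L[ℝ] P => A (f p u)) h4).symm

/-- A smooth field with parameters on an embedded manifold extends to a smooth field with compact
support which is tangent to the manifold. -/
theorem exists_extension [T2Space M] [CompactSpace M] [FiniteDimensional ℝ V]
    (hι : ContMDiff I 𝓘(ℝ, P) ∞ ι)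
    (hemb : IsClosedEmbedding ι) (hinj : ∀ p, Function.Injective (mfderiv I 𝓘(ℝ, P) ι p))
    {f : (x : M) → V → TangentSpace I x}
    (hf : ContMDiff (I.prod 𝓘(ℝ, V)) I.tangent ∞
      (fun p : M × V => (⟨p.1, f p.1 p.2⟩ : TangentBundle I M)))
    {C : Set V} (hC : IsCompact C) :
    ∃ F : P → V → P, ContDiff ℝ ∞ (fun z : P × V => F z.1 z.2) ∧
      HasCompactSupport (fun z : P × V => F z.1 z.2) ∧
      (∀ p, ∀ u ∈ C, F (ι p) u = mfderiv I 𝓘(ℝ, P) ι p (f p u)) ∧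
      ∀ p, IsTangentGraphAt (range ι) E F (ι p) := by
  set h : M × V → P := fun z => mfderiv I 𝓘(ℝ, P) ι z.1 (f z.1 z.2) with hh
  have hhc : ContMDiff (I.prod 𝓘(ℝ, V)) 𝓘(ℝ, P) ∞ h :=
    (contMDiff_snd_tangentBundle_modelSpace P 𝓘(ℝ, P)).comp
      ((hι.contMDiff_tangentMap (m := ∞) (by simp)).comp hf)
  -- Prescribing values on the submanifold is a convex condition, so local extensions glue by a
  -- partition of unity. Near the submanifold, extend constantly along the fibres of `ρ ∘ π`; away
  -- from it the condition is vacuous.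
  obtain ⟨F₁, hF₁⟩ := exists_contMDiffMap_forall_mem_convex_of_local 𝓘(ℝ, P × V) (n := ⊤)
    (t := fun z : P × V => {e : P | ∀ p, ι p = z.1 → e = h (p, z.2)})
    (fun z => by
      intro e₁ h₁ e₂ h₂ a b _ _ hab p hp
      rw [h₁ p hp, h₂ p hp, ← add_smul, hab, one_smul])
    (by
      rintro ⟨x, u⟩
      by_cases hx : x ∈ range ι
      · obtain ⟨p₀, rfl⟩ := hx
        obtain ⟨π, ρ, h1, h2⟩ := exists_local_parametrization hι (hinj p₀)
        obtain ⟨Z, hZ, hZo, hZmem⟩ := eventually_nhds_iff.1 h1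
        rw [hemb.isInducing.nhds_eq_comap] at h2
        obtain ⟨Y, hY, hYs⟩ := Filter.mem_comap.1 h2
        refine ⟨{z : P × V | z.1 ∈ Y ∧ π z.1 ∈ Z}, ?_, fun z => h (ρ (π z.1), z.2), ?_, ?_⟩
        · have hY' : ∀ᶠ z : P × V in 𝓝 (ι p₀, u), z.1 ∈ Y :=
            continuous_fst.continuousAt.eventually (p := fun x => x ∈ Y) hY
          exact hY'.and ((π.continuous.comp continuous_fst).continuousAt.eventually (hZo.mem_nhds hZmem))
        · rintro ⟨x, v⟩ ⟨-, hxZ⟩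
          refine ContMDiffAt.contMDiffWithinAt ?_
          refine hhc.contMDiffAt.comp (x, v) (ContMDiffAt.prodMk ?_ ?_)
          · exact ContMDiffAt.comp (I' := 𝓘(ℝ, E)) (x, v) (hZ _ hxZ).1
              (π.contDiff.comp contDiff_fst).contMDiff.contMDiffAt
          · exact contDiff_snd.contMDiff.contMDiffAt
        · rintro ⟨x, v⟩ ⟨hxY, -⟩ p rfl
          have : ρ (π (ι p)) = p := hYs hxY
          simp only [this]
      · refine ⟨{z : P × V | z.1 ∈ (range ι)ᶜ}, ?_, fun _ => 0, contMDiffOn_const, ?_⟩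
        · exact (hemb.isClosed_range.isOpen_compl.preimage continuous_fst).mem_nhds hx
        · intro z hz p hp
          exact absurd ⟨p, hp⟩ hz)
  obtain ⟨R, hR⟩ := ((isCompact_range hemb.continuous).prod hC).isBounded.subset_closedBall 0
  -- The cutoff equals `1` on `range ι ×ˢ C`. Elsewhere on the submanifold it only rescales a
  -- tangent vector, so tangency holds for all `u` and not just on `C`.
  let χ : ContDiffBump (0 : P × V) :=
    { rIn := max R 1, rOut := max R 1 + 1, rIn_pos := by positivity, rIn_lt_rOut := by linarith }
  have hF₁' : ∀ p u, F₁ (ι p, u) = h (p, u) := fun p u => hF₁ (ι p, u) p rfl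
  refine ⟨fun x u => χ (x, u) • F₁ (x, u), ?_, ?_, ?_, fun p => ?_⟩
  · exact χ.contDiff.smul F₁.contMDiff.contDiff
  · exact χ.hasCompactSupport.smul_right
  · intro p u hu
    have : χ (ι p, u) = 1 := χ.one_of_mem_closedBall
      (Metric.closedBall_subset_closedBall (le_max_left _ _) (hR ⟨mem_range_self p, hu⟩))
    dsimp only
    rw [this, one_smul, hF₁']
  · refine isTangentGraphAt_range hι hemb.isInducing (hinj p)
      (f := fun q u => χ (ι q, u) • f q u) fun q u => ?_
    rw [hF₁', map_smul]
    rfl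

end Embedding

end ControlSystem

/-! ### Transfer between the manifold and Euclidean space, and the equivalence -/

namespace ControlSystem
open Filter Topology

theorem ContinuousSteer.of_Icc {E U : Type*} [NormedAddCommGroup E] [NormedSpace ℝ E]
    [TopologicalSpace U] {F : E → U → E} {X : ℝ → E} {y : ℝ → U} {a b : ℝ} (hab : a ≤ b)
    (hy : Continuous y)
    (hX : ∀ s ∈ Icc a b, HasDerivWithinAt X (F (X s) (y s)) (Icc a b) s) :
    ContinuousSteer F (X a) (X b) := by
  refine ⟨b - a, fun s => y (a + s), fun s => X (a + s), sub_nonneg.2 hab,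
    (hy.comp (by fun_prop)).continuousOn, fun s hs => ?_, by simp, by simp⟩
  have h1 : HasDerivWithinAt (fun s => a + s) 1 (Icc 0 (b - a)) s :=
    ((hasDerivAt_id s).const_add a).hasDerivWithinAt
  have := (hX (a + s) ⟨by linarith [hs.1], by linarith [hs.2]⟩).scomp s h1
    fun x hx => ⟨by linarith [hx.1], by linarith [hx.2]⟩
  simpa using! this

section Transfer

variable {E H M P V : Type*} [NormedAddCommGroup E] [NormedSpace ℝ E]
  [TopologicalSpace H] {I : ModelWithCorners ℝ E H} [TopologicalSpace M]
  [ChartedSpace H M] [NormedAddCommGroup P] [NormedSpace ℝ P]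
  [NormedAddCommGroup V] [NormedSpace ℝ V] {ι : M → P}
  {f : (x : M) → V → TangentSpace I x} {F : P → V → P} {C : Set V}

omit [NormedSpace ℝ V] in
theorem Reachable.reflTransGen_continuousSteer [CompleteSpace P] [I.Boundaryless]
    [IsManifold I 1 M] (hι : ContMDiff I 𝓘(ℝ, P) 1 ι)
    (hF : ∀ p, ∀ u ∈ C, F (ι p) u = mfderiv I 𝓘(ℝ, P) ι p (f p u))
    (hFc : Continuous fun z : P × V => F z.1 z.2) {p q : M}
    (h : Reachable I f univ C p q) :
    Relation.ReflTransGen (ContinuousSteer fun x (u : C) => F x u) (ι p) (ι q) := by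
  obtain ⟨T, u, γ, hT, hpc, hu, hγ, -, rfl, rfl⟩ := h
  refine Relation.ReflTransGen.lift ι
    (r := fun p q => ContinuousSteer (fun x (u : C) => F x u) (ι p) (ι q)) (fun _ _ h => h) _ _ ?_
  refine hpc.reflTransGen fun a b ha hab hb hua => ?_
  have huC : u a ∈ C := hu a ⟨ha, hab.le.trans hb⟩
  refine ContinuousSteer.of_Icc (X := ι ∘ γ) (y := fun _ => ⟨u a, huC⟩) hab.le continuous_const
    fun s hs => ?_
  refine hγ.hasDerivWithinAt hι ha hab hb hua (g := fun t => F (ι (γ t)) (u a)) ?_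
    (fun t _ => (hF _ _ huC).symm) hs
  have hγc := hγ.1.1.mono (Icc_subset_Icc ha hb)
  exact hFc.comp_continuousOn ((hι.continuous.comp_continuousOn hγc).prodMk continuousOn_const)

/-- The component `y` of the state is a continuous curve in `C` and acts as the control. The control
`v` disappears, since `ι ∘ Prod.fst` does not see the second factor. -/
theorem Reachable.reflTransGen_continuousSteer_of_extended [CompleteSpace P] [I.Boundaryless]
    [IsManifold I 1 M] (hι : ContMDiff I 𝓘(ℝ, P) 1 ι)
    (hF : ∀ p, ∀ u ∈ C, F (ι p) u = mfderiv I 𝓘(ℝ, P) ι p (f p u))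
    (hFc : Continuous fun z : P × V => F z.1 z.2) {B : Set V} {p q : M × V}
    (h : Reachable (I.prod 𝓘(ℝ, V)) (extendedField I f) (univ ×ˢ C) B p q) :
    Relation.ReflTransGen (ContinuousSteer fun x (u : C) => F x u) (ι p.1) (ι q.1) := by
  obtain ⟨T, u, γ, hT, hpc, -, hγ, hS, rfl, rfl⟩ := h
  have hJ : ContMDiff (I.prod 𝓘(ℝ, V)) 𝓘(ℝ, P) 1 (ι ∘ Prod.fst : M × V → P) :=
    hι.comp contMDiff_fst
  refine Relation.ReflTransGen.lift (ι ∘ Prod.fst)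
    (r := fun p q => ContinuousSteer (fun x (u : C) => F x u) ((ι ∘ Prod.fst) p)
      ((ι ∘ Prod.fst : M × V → P) q)) (fun _ _ h => h) _ _ ?_
  refine hpc.reflTransGen fun a b ha hab hb hua => ?_
  have hsub : Icc a b ⊆ Icc 0 T := Icc_subset_Icc ha hb
  have hγc := hγ.1.1.mono hsub
  have hC : ∀ t ∈ Icc a b, (γ t).2 ∈ C := fun t ht => (hS t (hsub ht)).2
  have hres : Continuous fun t : Icc a b => (⟨(γ t).2, hC t t.2⟩ : C) :=
    (continuous_snd.comp (continuousOn_iff_continuous_domRestrict.1 hγc)).subtype_mk _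
  refine ContinuousSteer.of_Icc (X := (ι ∘ Prod.fst) ∘ γ)
    (y := IccExtend hab.le fun t : Icc a b => (⟨(γ t).2, hC t t.2⟩ : C)) hab.le hres.Icc_extend'
    fun s hs => ?_
  rw [IccExtend_of_mem _ _ hs]
  refine hγ.hasDerivWithinAt hJ ha hab hb hua (g := fun t => F (ι (γ t).1) (γ t).2) ?_
    (fun t ht => ?_) hs
  · exact hFc.comp_continuousOn ((hι.continuous.comp_continuousOn
      (continuous_fst.comp_continuousOn hγc)).prodMk (continuous_snd.comp_continuousOn hγc))
  · rw [hF _ _ (hC t ht)]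
    have h1 := ((hι.mdifferentiableAt (x := (γ t).1) one_ne_zero).hasMFDerivAt.comp (γ t)
      (hasMFDerivAt_fst (I := I) (I' := 𝓘(ℝ, V)) (γ t))).mfderiv
    exact congrArg (fun A : E × V →L[ℝ] P => A (f (γ t).1 (γ t).2, u a)) h1

omit [NormedSpace ℝ V] in
theorem reflTransGen_constantStep_of_run [FiniteDimensional ℝ P] (hemb : Function.Injective ι)
    (hF : ∀ p, ∀ u ∈ C, F (ι p) u = mfderiv I 𝓘(ℝ, P) ι p (f p u)) {ℓ : C → ℝ → ℝ → P → P}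
    {b L : NNReal} (h : SteeringSystem (fun x (u : C) => F x u) (range ι) ℓ b L) {p q : M}
    (hpq : Steers ℓ 0 (ι p) (ι q)) :
    Relation.ReflTransGen (ConstantStep I f univ C ι) p q := by
  obtain ⟨w, hw⟩ := hpq
  induction w generalizing p with
  | nil =>
    rw [hemb hw]
  | cons l w ih =>
    obtain ⟨u, t⟩ := l
    rw [run_cons] at hw
    choose γ hγ using fun s : ℝ => (h.mem_iff u 0 s (ι p)).2 (mem_range_self p)
    rw [← hγ] at hw
    refine Relation.ReflTransGen.head ⟨u, u.2, t, γ, b, t.2, fun s _ => ?_, ?_, fun _ _ => trivial,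
      hemb ?_, rfl⟩ (ih hw)
    · have h1 := (h.flow u).deriv (ι p) s
      rw [← hF _ _ u.2]
      have h2 : ι ∘ γ = fun s => ℓ u 0 s (ι p) := funext hγ
      rw [h2, hγ]
      exact h1
    · have h2 : ι ∘ γ = fun s => ℓ u 0 s (ι p) := funext hγ
      rw [h2]
      refine lipschitzWith_of_nnnorm_deriv_le
        (fun s => ((h.flow u).deriv (ι p) s).differentiableAt) fun s => ?_
      rw [((h.flow u).deriv (ι p) s).deriv]
      exact h.bound _ _
    · rw [hγ, (h.flow u).zero]

theorem mfderiv_prodMap_id_apply (hι : ContMDiff I 𝓘(ℝ, P) 1 ι) (z : M × V) (a : E) (v : V) :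
    mfderiv (I.prod 𝓘(ℝ, V)) 𝓘(ℝ, P × V) (Prod.map ι (id : V → V)) z (a, v) =
      ((mfderiv I 𝓘(ℝ, P) ι z.1 a : P), v) := by
  rw [modelWithCornersSelf_prod, ← chartedSpaceSelf_prod]
  have h1 := (hι.mdifferentiableAt (x := z.1) one_ne_zero).hasMFDerivAt.prodMap
    (hasMFDerivAt_id (I := 𝓘(ℝ, V)) z.2)
  refine (congrArg (fun A : E × V →L[ℝ] P × V => A (a, v)) h1.mfderiv).trans (Prod.ext rfl ?_)
  exact congrArg (fun A : V →L[ℝ] V => A v) mfderiv_id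

/-- Tangency keeps `X` in `range ι` at all times, so it lifts to `M`; the velocity of the lifted
curve is the extended field because `F` agrees with `f` over `C`. -/
theorem exists_constantStep_of_slideStep [FiniteDimensional ℝ P] {W : Type*}
    [NormedAddCommGroup W] [NormedSpace ℝ W] (hι : ContMDiff I 𝓘(ℝ, P) 1 ι)
    (hemb : Function.Injective ι) (hcl : IsClosed (range ι))
    (hF : ∀ p, ∀ u ∈ C, F (ι p) u = mfderiv I 𝓘(ℝ, P) ι p (f p u)) {b L : NNReal}
    (hb : ∀ x u, ‖F x u‖ ≤ b) (hL : ∀ x x' u, ‖F x u - F x' u‖ ≤ L * ‖x - x'‖)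
    (htan : ∀ q ∈ range ι, IsTangentGraphAt (range ι) W F q) {R : ℝ} {p : M} {y : V} {z : P × V}
    (h : SlideStep F C R (ι p, y) z) :
    ∃ q, ι q = z.1 ∧ ConstantStep (I.prod 𝓘(ℝ, V)) (extendedField I f) (univ ×ˢ C)
      (Metric.closedBall 0 R) (Prod.map ι id) (p, y) (q, z.2) := by
  obtain ⟨v, S, X, hv, hS, hX, hX0, hXS, hzy, hC⟩ := h
  simp only at hX hX0 hzy hC
  have hXK : ∀ t, X t ∈ range ι := mem_of_tangent hcl hL htan (c := 1) (y := fun t => y + t • v)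
    (fun t => by rw [one_smul]; exact hX t) (t₀ := 0) (by rw [hX0]; exact mem_range_self p)
  choose γ hγ using hXK
  have hJ : Prod.map ι (id : V → V) ∘ (fun t => (γ t, y + t • v)) = fun t => (X t, y + t • v) :=
    funext fun t => Prod.ext (hγ t) rfl
  have hd : ∀ t, HasDerivAt (fun t => (X t, y + t • v)) (F (X t) (y + t • v), v) t := fun t =>
    (hX t).prodMk (by simpa using! ((hasDerivAt_id t).smul_const v).const_add y)
  refine ⟨γ S, by rw [hγ, hXS], v, by simpa using hv, S, fun t => (γ t, y + t • v), max b ‖v‖₊, hS,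
    fun t ht => ?_, ?_, fun t ht => ⟨trivial, hC t ht⟩, ?_, ?_⟩
  · rw [hJ]
    refine (hd t).congr_deriv ?_
    rw [← hγ t, hF _ _ (hC t ht)]
    exact (mfderiv_prodMap_id_apply hι (γ t, y + t • v) (f (γ t) (y + t • v)) v).symm
  · rw [hJ]
    refine lipschitzWith_of_nnnorm_deriv_le (fun t => (hd t).differentiableAt) fun t => ?_
    rw [(hd t).deriv, Prod.nnnorm_def]
    exact max_le_max (hb _ _) le_rfl
  · refine Prod.ext (hemb ?_) (by simp)
    rw [hγ, hX0]
  · exact Prod.ext rfl hzy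

theorem exists_reflTransGen_constantStep [FiniteDimensional ℝ P] {W : Type*}
    [NormedAddCommGroup W] [NormedSpace ℝ W] (hι : ContMDiff I 𝓘(ℝ, P) 1 ι)
    (hemb : Function.Injective ι) (hcl : IsClosed (range ι))
    (hF : ∀ p, ∀ u ∈ C, F (ι p) u = mfderiv I 𝓘(ℝ, P) ι p (f p u)) {b L : NNReal}
    (hb : ∀ x u, ‖F x u‖ ≤ b) (hL : ∀ x x' u, ‖F x u - F x' u‖ ≤ L * ‖x - x'‖)
    (htan : ∀ q ∈ range ι, IsTangentGraphAt (range ι) W F q) {R : ℝ} {p : M} {y : V} {z : P × V}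
    (h : Relation.ReflTransGen (SlideStep F C R) (ι p, y) z) :
    ∃ q, ι q = z.1 ∧ Relation.ReflTransGen (ConstantStep (I.prod 𝓘(ℝ, V)) (extendedField I f)
      (univ ×ˢ C) (Metric.closedBall 0 R) (Prod.map ι id)) (p, y) (q, z.2) := by
  induction h with
  | refl => exact ⟨p, rfl, .refl⟩
  | tail _ hst ih =>
    obtain ⟨q, hq, hpq⟩ := ih
    obtain ⟨q', hq', hqq'⟩ := exists_constantStep_of_slideStep hι hemb hcl hF hb hL htan
      (p := q) (by rw [hq]; exact hst)
    exact ⟨q', hq', hpq.tail hqq'⟩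

end Transfer

/-- A system on a compact manifold is globally controllable if and only if its extension by an
integrator on the controls is. -/
theorem globallyControllable_iff_extendedField {E H M V : Type*} [NormedAddCommGroup E]
    [NormedSpace ℝ E] [FiniteDimensional ℝ E] [TopologicalSpace H] {I : ModelWithCorners ℝ E H}
    [I.Boundaryless] [TopologicalSpace M] [ChartedSpace H M] [IsManifold I ∞ M] [T2Space M]
    [CompactSpace M] [NormedAddCommGroup V] [NormedSpace ℝ V] [FiniteDimensional ℝ V]
    {f : (x : M) → V → TangentSpace I x}
    (hf : ContMDiff (I.prod 𝓘(ℝ, V)) I.tangent ∞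
      (fun p : M × V => (⟨p.1, f p.1 p.2⟩ : TangentBundle I M)))
    {C : Set V} (hC : IsCompact C) (hne : C.Nonempty) (hconn : IsPolygonallyConnected C) :
    GloballyControllable I f univ C ↔ ∃ B : Set V, Bornology.IsBounded B ∧
      GloballyControllable (I.prod 𝓘(ℝ, V)) (extendedField I f) (univ ×ˢ C) B := by
  have : IsManifold I 1 M := IsManifold.of_le (n := ∞) (by exact_mod_cast le_top)
  have : ProperSpace V := FiniteDimensional.proper ℝ V
  obtain ⟨N, ι, hι, hemb, hinj⟩ := exists_embedding_euclidean_of_compact (I := I) (M := M)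
  have hι₁ : ContMDiff I 𝓘(ℝ, EuclideanSpace ℝ (Fin N)) 1 ι := hι.of_le (by exact_mod_cast le_top)
  obtain ⟨F, hFs, hFc, hF, htan'⟩ := exists_extension hι hemb hinj hf hC
  have htan : ∀ q ∈ range ι, IsTangentGraphAt (range ι) E F q := by
    rintro _ ⟨p, rfl⟩
    exact htan' p
  have hret := hasLocalRetractions_of_embedding hι hemb.isInducing hinj
  obtain ⟨b₀, hb₀⟩ := hFs.continuous.bounded_above_of_compact_support hFc
  have hb : ∀ x u, ‖F x u‖ ≤ b₀.toNNReal := fun x u => (hb₀ (x, u)).trans (Real.le_coe_toNNReal _)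
  obtain ⟨L, hL⟩ := hFs.lipschitzWith_of_hasCompactSupport hFc (by simp)
  have hL' : ∀ x x' u, ‖F x u - F x' u‖ ≤ L * ‖x - x'‖ := fun x x' u => by
    have := hL.dist_le_mul (x, u) (x', u)
    rwa [Prod.dist_eq, dist_self, max_eq_left dist_nonneg, dist_eq_norm, dist_eq_norm] at this
  obtain ⟨c, hc⟩ := hne
  obtain ⟨ℓ, hℓ, hslide⟩ :=
    exists_steeringSystem hFs hb hL hemb.isClosed_range htan hC.isBounded hconn hc
  have hK : IsCompact (range ι) := isCompact_range hemb.continuous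
  have hW : ∀ q ∈ range ι, IsLocalGraphAt (range ι) E q := fun q hq => (htan q hq).isLocalGraphAt
  constructor
  · intro hctrl
    have hchain : ∀ p ∈ range ι, ∀ q ∈ range ι,
        Relation.ReflTransGen (ContinuousSteer fun x (u : C) => F x u) p q := by
      rintro _ ⟨p, rfl⟩ _ ⟨q, rfl⟩
      exact (hctrl p trivial q trivial).reflTransGen_continuousSteer hι₁ hF hFs.continuous
    -- One `ε` serves all pairs of points, and `0 < ε < π` makes `sin ε` positive; it determines the
    -- radius of `B`.
    obtain ⟨ε, hε, hε0, hεπ⟩ := (((hℓ.eventually_forall_steers hK hW hchain).filter_mono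
      nhdsWithin_le_nhds).and (Ioo_mem_nhdsGT Real.pi_pos)).exists
    have hsin : 0 < Real.sin ε := Real.sin_pos_of_pos_of_lt_pi hε0 hεπ
    obtain ⟨hrun, hends⟩ := hslide ε hsin
    refine ⟨Metric.closedBall 0 (Metric.diam C / Real.sin ε), Metric.isBounded_closedBall, ?_⟩
    rintro ⟨p, y⟩ hp ⟨q, z⟩ hq
    -- The route is: slide `y` to `c`, run a word from `p'` to `q'`, then slide from `c` to `z`,
    -- where `q'` is chosen so that the last slide ends at `q`.
    obtain ⟨⟨_, ⟨p', rfl⟩, h1⟩, -⟩ := hends y hp.2 (ι p) (mem_range_self p)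
    obtain ⟨-, _, ⟨q', rfl⟩, h2⟩ := hends z hq.2 (ι q) (mem_range_self q)
    have h3 := hrun _ _ (hε (ι p') (mem_range_self p') (ι q') (mem_range_self q'))
    obtain ⟨q'', hq'', h4⟩ := exists_reflTransGen_constantStep hι₁ hemb.injective
      hemb.isClosed_range hF hb hL' htan ((h1.trans h3).trans h2)
    rw [hemb.injective hq''] at h4
    exact reachable_of_reflTransGen hret.prodMap_id
      ⟨0, Metric.mem_closedBall_self (div_nonneg Metric.diam_nonneg hsin.le)⟩ hp h4
  · rintro ⟨B, -, hctrl⟩ p - q -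
    have hchain : ∀ p ∈ range ι, ∀ q ∈ range ι,
        Relation.ReflTransGen (ContinuousSteer fun x (u : C) => F x u) p q := by
      rintro _ ⟨p, rfl⟩ _ ⟨q, rfl⟩
      exact (hctrl (p, c) ⟨trivial, hc⟩ (q, c)
        ⟨trivial, hc⟩).reflTransGen_continuousSteer_of_extended hι₁ hF hFs.continuous
    exact reachable_of_reflTransGen hret ⟨c, hc⟩ trivial
      (reflTransGen_constantStep_of_run hemb.injective hF hℓ
        (hℓ.steers_zero_of_chain hK hW hchain (mem_range_self p) (mem_range_self q)))

end ControlSystem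

theorem corollary2 {n m : ℕ} {M : Type*} [TopologicalSpace M]
    [ChartedSpace (EuclideanSpace ℝ (Fin n)) M] [IsManifold (𝓡 n) ∞ M]
    [T2Space M] [SecondCountableTopology M] [ConnectedSpace M] [CompactSpace M]
    (f : (x : M) → EuclideanSpace ℝ (Fin m) → TangentSpace (𝓡 n) x)
    (hf : ContMDiff ((𝓡 n).prod 𝓘(ℝ, EuclideanSpace ℝ (Fin m))) (𝓡 n).tangent ∞
      (fun p : M × EuclideanSpace ℝ (Fin m) =>
        (⟨p.1, f p.1 p.2⟩ : TangentBundle (𝓡 n) M)))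
    (C : Set (EuclideanSpace ℝ (Fin m))) (hC : IsCompact C) (hC_ne : C.Nonempty)
    (hC_conn : ControlSystem.IsPolygonallyConnected C) :
    ControlSystem.GloballyControllable (𝓡 n) f Set.univ C ↔
      ∃ B : Set (EuclideanSpace ℝ (Fin m)), Bornology.IsBounded B ∧
        ControlSystem.GloballyControllable ((𝓡 n).prod 𝓘(ℝ, EuclideanSpace ℝ (Fin m)))
          (ControlSystem.extendedField (𝓡 n) f) (Set.univ ×ˢ C) B := by
  exact ControlSystem.globallyControllable_iff_extendedField hf hC hC_ne hC_conn
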